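/- Let $\hbar,m,\sigma_0>0$ and $\beta\in(\mathbb R\setminus\{0\})\cup\{\infty\}$. Let $\mathsf H_\beta$ be the operator in $L^2(\mathbb R)$ which acts as $-\frac{\hbar^2}{2m}\frac{d^2}{dx^2}$ on $\mathbb R\setminus\{0\}$, with domain consisting of all $\psi\in H^2(\mathbb R\setminus\{0\})$ such that $\psi'(0^+)=\psi'(0^-)=:\psi'(0)$ and $\psi(0^+)-\psi(0^-)=\frac{2m\beta}{\hbar^2}\psi'(0)$ (for $\beta=\infty$: $\psi'(0^+)=\psi'(0^-)=0$). For every such $\hbar,m,\beta$ there is exactly one strongly continuous unitary group $e^{-i\frac t\hbar \mathsf H_\beta}$, $t\in\mathbb R$, whose generator is $-\frac i\hbar\mathsf H_\beta$. For $\xi=(q,p)\in\mathbb R^2$, $x\in\mathbb R$ and $\sigma\in\mathbb C$ with $\operatorname{Re}\sigma=\sigma_0$ put $$\psi^\hbar_{\sigma,\xi}(x)=\phi^\hbar_{\sigma,x}(\xi)=\frac{1}{(2\pi\hbar)^{1/4}\sqrt\sigma}\exp\Big(-\frac{(x-q)^2}{4\hbar\sigma_0\sigma}+\frac i\hbar p(x-q)\Big),$$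 and for $t\in\mathbb R$ put $\sigma_t=\sigma_0+\frac{it}{2m\sigma_0}$, $A_t=\frac{p^2t}{2m}$. Let $B(p)=-\frac{2\beta}{\hbar^3}p^2$ (with $\frac1{B(p)}=0$ if $\beta=\infty$) and, for $f:\mathbb R^2\to\mathbb C$, let $$(e^{itL_B}f)(q,p)=f\Big(q+\frac{pt}m,p\Big)-\frac{\theta(-tqp)\,\theta\big(\frac{|pt|}m-|q|\big)}{1-\operatorname{sgn}(t)\frac{2i|p|}{mB(p)}}\Big(f\Big(q+\frac{pt}m,p\Big)-f\Big(-q-\frac{pt}m,-p\Big)\Big),$$ where $\theta$ is the Heaviside function. For $qp\neq0$ put $t_{coll}(\xi)=-\frac{mq}p$ and $$\underline h=\max\Big\{\frac{\hbar\sigma_0^2}{q^2},\ \frac{\hbar}{\sigma_0^2p^2},\ \frac{\hbar}{(m|\beta p|)^{1/3}}\Big\}$$ (the last entry being $0$ if $\beta=\infty$). Then for every $0<\lambda<\frac12$ there exist constants $0<h_*<1$ and $C_*,c_0>0$, depending only on $\lambda$, such that for all $\hbar,m,\sigma_0>0$, all $\beta\in(\mathbb R\setminus\{0\})\cup\{\infty\}$,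 all $\xi=(q,p)\in\mathbb R^2$ with $qp\ne0$ and $\underline h<h_*$, and all $t\in\mathbb R$ with $$|t-t_{coll}(\xi)|\ \ge\ c_0\,|t_{coll}(\xi)|\,\sqrt{\big(\tfrac72-\lambda\big)\,\underline h\,|\ln\underline h|},$$ one has $$\Big\|e^{-i\frac t\hbar\mathsf H_\beta}\psi^\hbar_{\sigma_0,\xi}-e^{\frac i\hbar A_t}\big(e^{itL_B}\phi^\hbar_{\sigma_t,(\cdot)}\big)(\xi)\Big\|_{L^2(\mathbb R)}\ \le\ C_*\,\underline h^{\frac72-\lambda}.$$ -/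

import Mathlib

open MeasureTheory Complex OnePoint

noncomputable section

namespace DeltaPrime

/-- The Hilbert space `L²(ℝ)` of complex-valued functions, with Lebesgue measure. -/
abbrev L2 : Type := Lp ℂ 2 (volume : Measure ℝ)

/-! ### The quantum Hamiltonian and its unitary group -/

/-- `ψ ∈ H²(ℝ ∖ {0})`, with boundary values `ψ(0⁺) = up`, `ψ(0⁻) = um`, `ψ'(0⁺) = vp`,
`ψ'(0⁻) = vm`, and `w ∈ L²(ℝ)` is the second derivative of `ψ` on `ℝ ∖ {0}`.
Here `u` is the representative of `ψ`, absolutely continuous together with its derivative `v` on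
each of the two half-lines. -/
def HasSecondDeriv (ψ w : L2) (up um vp vm : ℂ) : Prop :=
  ∃ u v : ℝ → ℂ, (ψ : ℝ → ℂ) =ᵐ[volume] u ∧ MemLp v 2 volume ∧
    (∀ x : ℝ, 0 < x → u x = up + ∫ y in (0 : ℝ)..x, v y) ∧
    (∀ x : ℝ, x < 0 → u x = um + ∫ y in (0 : ℝ)..x, v y) ∧
    (∀ x : ℝ, 0 < x → v x = vp + ∫ y in (0 : ℝ)..x, w y) ∧
    (∀ x : ℝ, x < 0 → v x = vm + ∫ y in (0 : ℝ)..x, w y)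

/-- The boundary conditions at the origin for the coupling `β ∈ ℝ ∪ {∞}`: for real `β`,
`ψ'(0⁺) = ψ'(0⁻) = ψ'(0)` and `ψ(0⁺) - ψ(0⁻) = (2mβ/ħ²) ψ'(0)`; for `β = ∞`,
`ψ'(0⁺) = ψ'(0⁻) = 0`. -/
def BoundaryCondition (ħ m : ℝ) (β : OnePoint ℝ) (up um vp vm : ℂ) : Prop :=
  vp = vm ∧ β.elim (vp = 0) (fun b => up - um = ((2 * m * b / ħ ^ 2 : ℝ) : ℂ) * vp)

/-- The operator `H_β`, given by its graph: `Hamiltonian ħ m β ψ χ` says that `ψ` lies in the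
domain of `H_β` and `H_β ψ = χ`. On `ℝ ∖ {0}` the operator acts as `-(ħ²/2m) d²/dx²`; for real `β`,
the term `β ψ'(0) δ₀'` cancels the singular part at `0` of the distributional second derivative. -/
def Hamiltonian (ħ m : ℝ) (β : OnePoint ℝ) (ψ χ : L2) : Prop :=
  ∃ (w : L2) (up um vp vm : ℂ), HasSecondDeriv ψ w up um vp vm ∧
    BoundaryCondition ħ m β up um vp vm ∧ χ = ((-(ħ ^ 2 / (2 * m)) : ℝ) : ℂ) • w

/-- `U` is the strongly continuous one-parameter unitary group `t ↦ exp(-i (t/ħ) H)`, where the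
operator `H` is given by its graph: `H` (including its domain) is exactly the generator of `U`. -/
structure IsUnitaryGroupOf (ħ : ℝ) (H : L2 → L2 → Prop) (U : ℝ → L2 ≃ₗᵢ[ℂ] L2) : Prop where
  map_zero : ∀ ψ, U 0 ψ = ψ
  map_add : ∀ s t ψ, U (s + t) ψ = U s (U t ψ)
  continuous : ∀ ψ, Continuous fun t => U t ψ
  generator : ∀ ψ χ, H ψ χ ↔ HasDerivAt (fun t => U t ψ) (-(I / (ħ : ℂ)) • χ) 0

/-! ### Coherent states -/

/-- The Gaussian wave packet `ψ^ħ_{σ,ξ}(x)`, `ξ = (q, p)`. -/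
def coherent (ħ σ₀ : ℝ) (σ : ℂ) (ξ : ℝ × ℝ) (x : ℝ) : ℂ :=
  1 / ((((2 * Real.pi * ħ) ^ (1 / 4 : ℝ) : ℝ) : ℂ) * σ ^ (1 / 2 : ℂ)) *
    cexp (-(1 / (4 * ħ * σ₀ * σ)) * ((x - ξ.1 : ℝ) : ℂ) ^ 2 + I / ħ * ξ.2 * ((x - ξ.1 : ℝ) : ℂ))

theorem memLp_coherent {ħ σ₀ : ℝ} (hħ : 0 < ħ) (hσ₀ : 0 < σ₀) (ξ : ℝ × ℝ) :
    MemLp (coherent ħ σ₀ σ₀ ξ) 2 volume := by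
  have hc : Continuous (coherent ħ σ₀ σ₀ ξ) := by
    unfold coherent; fun_prop
  rw [memLp_two_iff_integrable_sq_norm hc.aestronglyMeasurable]
  have hb : 0 < 1 / (2 * ħ * σ₀ * σ₀) := by positivity
  have h := ((integrable_exp_neg_mul_sq hb).comp_sub_right ξ.1).const_mul
    (‖1 / ((((2 * Real.pi * ħ) ^ (1 / 4 : ℝ) : ℝ) : ℂ) * (σ₀ : ℂ) ^ (1 / 2 : ℂ))‖ ^ 2)
  refine h.congr (Filter.Eventually.of_forall fun x => ?_)
  have e : (-(1 / (4 * ħ * σ₀ * (σ₀ : ℂ))) * ((x - ξ.1 : ℝ) : ℂ) ^ 2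
      + I / ħ * ξ.2 * ((x - ξ.1 : ℝ) : ℂ))
      = ((-(1 / (4 * ħ * σ₀ * σ₀)) * (x - ξ.1) ^ 2 : ℝ) : ℂ)
        + ((1 / ħ * ξ.2 * (x - ξ.1) : ℝ) : ℂ) * I := by
    push_cast; ring
  simp only [coherent]
  rw [norm_mul, mul_pow, e, Complex.norm_exp, Complex.add_re, Complex.ofReal_re,
    Complex.re_ofReal_mul, Complex.I_re, mul_zero, add_zero, ← Real.exp_nat_mul]
  congr 2
  push_cast
  field_simp
  ring

/-- The coherent state `ψ^ħ_{σ₀,ξ}` as an element of `L²(ℝ)`. -/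
def coherentVec {ħ σ₀ : ℝ} (hħ : 0 < ħ) (hσ₀ : 0 < σ₀) (ξ : ℝ × ℝ) : L2 :=
  (memLp_coherent hħ hσ₀ ξ).toLp (coherent ħ σ₀ σ₀ ξ)

/-- `σ_t = σ₀ + i t / (2 m σ₀)`. -/
def sigmaAt (m σ₀ t : ℝ) : ℂ := σ₀ + I * t / (2 * m * σ₀)

/-! ### The classical evolution on phase space -/

/-- The Heaviside function. -/
def heaviside (x : ℝ) : ℂ := if 0 < x then 1 else 0

/-- The free classical group: `(e^{itL₀} f)(q, p) = f(q + (p/m) t, p)`. -/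
def freeFlow (m t : ℝ) (f : ℝ × ℝ → ℂ) (ξ : ℝ × ℝ) : ℂ := f (ξ.1 + ξ.2 / m * t, ξ.2)

/-- `f_odd(ξ) = f(ξ) - f(-ξ)`. -/
def oddPart (f : ℝ × ℝ → ℂ) (ξ : ℝ × ℝ) : ℂ := f ξ - f (-ξ)

/-- The coefficient `1 / (1 - sgn(t) 2i|p| / (m B(p)))`, where `B(p) = b p²` for real `b` and
`B(p) = ∞`, `1/∞ = 0`, for `b = ∞`. -/
def reflectionCoeff (m : ℝ) (b : OnePoint ℝ) (t p : ℝ) : ℂ :=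
  b.elim 1 (fun b => 1 / (1 - (Real.sign t : ℂ) * (2 * I * |p| / (m * (b * p ^ 2)))))

/-- The classical group `e^{itL_B}`, `B(p) = b p²`, acting on functions on phase space. -/
def classicalGroup (m : ℝ) (b : OnePoint ℝ) (t : ℝ) (f : ℝ × ℝ → ℂ) (ξ : ℝ × ℝ) : ℂ :=
  freeFlow m t f ξ -
    heaviside (-(t * ξ.1 * ξ.2)) * heaviside (|ξ.2 * t| / m - |ξ.1|) *
      reflectionCoeff m b t ξ.2 * freeFlow m t (oddPart f) ξ

/-- The semiclassical approximation `x ↦ e^{(i/ħ)A_t} (e^{itL_B} φ^ħ_{σ_t,x})(ξ)`, where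
`A_t = p² t / (2m)`, `φ^ħ_{σ,x}(ξ) = ψ^ħ_{σ,ξ}(x)` and `B(p) = -(2β/ħ³) p²`. -/
def classicalApprox (ħ m σ₀ : ℝ) (β : OnePoint ℝ) (t : ℝ) (ξ : ℝ × ℝ) (x : ℝ) : ℂ :=
  cexp (I / ħ * ((ξ.2 ^ 2 * t / (2 * m) : ℝ) : ℂ)) *
    classicalGroup m (β.map fun b => -(2 * b / ħ ^ 3)) t
      (fun ζ => coherent ħ σ₀ (sigmaAt m σ₀ t) ζ x) ξ

/-- The collision time `-mq/p`. -/
def collisionTime (m : ℝ) (ξ : ℝ × ℝ) : ℝ := -(m * ξ.1 / ξ.2)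

/-- The maximum of `ħσ₀²/q²`, `ħ/(σ₀²p²)` and `ħ/(m|βp|)^{1/3}`; the last one is `0` for
`β = ∞`. -/
def smallParam (ħ m σ₀ : ℝ) (β : OnePoint ℝ) (ξ : ℝ × ℝ) : ℝ :=
  max (max (ħ * σ₀ ^ 2 / ξ.1 ^ 2) (ħ / (σ₀ ^ 2 * ξ.2 ^ 2)))
    (β.elim 0 (fun b => ħ / (m * |b * ξ.2|) ^ (1 / 3 : ℝ)))

end DeltaPrime

end

open DeltaPrime

/-! The Schrödinger equation is solved exactly for an initial state close to the coherent state; the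
rest is error control. For an amplitude `f` on wave numbers, `scatter` places on the right half-line
the free wave of `f` plus the mirror image of the wave of `(1 - T) f`, and on the left half-line the
wave of `T f`. Here `T` is the transmission amplitude, `1/(1 + i(mβ/ħ²)(2πk))` for real `β` and `0`
for `β = ∞`. The interface condition becomes an algebraic identity for `T` that holds at every real
`k`, so `scatter` intertwines multiplication by `ħ²(2πk)²/(2m)` with `H_β` (`hamiltonian_scatter`),
without wave operators and without restricting the sign of the momentum. Hence the group maps
`scatter` of the initial Gaussian packet to `scatter` of the freely evolved packet
(`unitaryGroup_scatter_packet`).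

By parity one may take `q > 0`. Freeze `T` at the central momentum `p/ħ`. While the centre of the
packet is to the right of the origin, `scatter` of it differs from the free packet only by the
freezing error and the tail on the left (`norm_scatter_sub_le_of_incoming`); when the centre is to
the left, it differs from `T` times the packet plus `1 - T` times its mirror image by the freezing
error and the tail on the right (`norm_scatter_sub_le_of_outgoing`). The first comparison at time
`0` says that the coherent state is nearly a scattering state, and unitarity carries that error to
time `t`. A comparison at time `t` then produces the classical formula, because `1 - T` at `p/ħ` is
exactly the coefficient in `e^{itL_B}` whenever a collision has taken place (`reflectionCoeff_eq`).

With `h` the small parameter, freezing `T` costs `O(h^(7/2))` by the first and seventh momentum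
moments (`norm_transmit_packet_sub_le`). The distance of `t` from the collision time makes the
Gaussian tails `O(h^N)` with `N = 7/2 - λ` (`exp_neg_div_le_rpow`).

Existence of the group is Stone's theorem: `H_β/ħ` is symmetric by Green's identity, and the
equation for its resolvent is solved by a free solution corrected by a multiple of `sgn(x)
e^{-κ|x|}`. Uniqueness follows because two groups with the same generator agree on its dense domain.
-/

noncomputable section

namespace DeltaPrime

/-! ### Stone's theorem for operators given by their graph -/

section Stone

variable {E : Type*} [NormedAddCommGroup E] [InnerProductSpace ℂ E]

/-- `H` is the graph of a self-adjoint operator: a symmetric operator such that `H + iμ` is onto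
for all real `μ ≠ 0`. -/
structure IsSelfAdjointGraph (H : E → E → Prop) : Prop where
  add : ∀ {ψ χ ψ' χ'}, H ψ χ → H ψ' χ' → H (ψ + ψ') (χ + χ')
  smul : ∀ (c : ℂ) {ψ χ}, H ψ χ → H (c • ψ) (c • χ)
  im_inner : ∀ {ψ χ}, H ψ χ → (inner ℂ ψ χ).im = 0
  eq_zero : ∀ {χ}, H 0 χ → χ = 0
  surj : ∀ μ : ℝ, μ ≠ 0 → ∀ f, ∃ ψ χ, H ψ χ ∧ χ + (I * μ) • ψ = f

/-- The cross term is a multiple of the imaginary part of the inner product, which vanishes. Every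
resolvent bound below comes from this identity. -/
theorem norm_sq_add_I_smul {ψ χ : E} (h : (inner ℂ ψ χ).im = 0) (μ : ℝ) :
    ‖χ + (I * μ) • ψ‖ ^ 2 = ‖χ‖ ^ 2 + μ ^ 2 * ‖ψ‖ ^ 2 := by
  have h' : (inner ℂ χ ψ).im = 0 := by
    rw [← inner_conj_symm, conj_im, h, neg_zero]
  rw [norm_add_sq (𝕜 := ℂ), inner_smul_right, norm_smul, norm_mul, norm_I, one_mul, norm_real,
    mul_pow, Real.norm_eq_abs, sq_abs]
  simp [h']

theorem abs_mul_norm_le_norm_add_I_smul {ψ χ : E} (h : (inner ℂ ψ χ).im = 0) (μ : ℝ) :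
    |μ| * ‖ψ‖ ≤ ‖χ + (I * μ) • ψ‖ := by
  have := norm_sq_add_I_smul h μ
  refine abs_le_of_sq_le_sq' ?_ (norm_nonneg _) |>.2
  rw [this, mul_pow, sq_abs]
  nlinarith [sq_nonneg ‖χ‖]

theorem norm_le_norm_add_I_smul {ψ χ : E} (h : (inner ℂ ψ χ).im = 0) (μ : ℝ) :
    ‖χ‖ ≤ ‖χ + (I * μ) • ψ‖ := by
  have := norm_sq_add_I_smul h μ
  refine abs_le_of_sq_le_sq' ?_ (norm_nonneg _) |>.2
  rw [this]
  nlinarith [mul_nonneg (sq_nonneg μ) (sq_nonneg ‖ψ‖)]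

/-! ### Resolvents and bounded approximations of a self-adjoint graph -/

namespace IsSelfAdjointGraph

variable {H : E → E → Prop} (hH : IsSelfAdjointGraph H)

include hH

theorem sub {ψ χ ψ' χ' : E} (h : H ψ χ) (h' : H ψ' χ') : H (ψ - ψ') (χ - χ') := by
  have := hH.add h (hH.smul (-1) h')
  simpa [sub_eq_add_neg] using this

theorem inner_symm {ψ χ ψ' χ' : E} (h : H ψ χ) (h' : H ψ' χ') :
    inner ℂ χ ψ' = inner ℂ ψ χ' := by
  have h1 := hH.im_inner (hH.add h h')
  have h2 := hH.im_inner (hH.add h (hH.smul I h'))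
  have a := hH.im_inner h
  have b := hH.im_inner h'
  have e1 : inner ℂ ψ' χ = (starRingEnd ℂ) (inner ℂ χ ψ') := (inner_conj_symm _ _).symm
  simp only [inner_add_left, inner_add_right, inner_smul_left, inner_smul_right, e1, add_im,
    add_re, mul_im, mul_re, conj_re, conj_im, I_re, I_im] at h1 h2
  apply Complex.ext <;> linarith

/-- The lower bound for `H + iμ` makes the solution supplied by `surj` unique; uniqueness turns the
chosen solution map into a linear one, bounded by `1/|μ|`. -/
theorem exists_resolvent {μ : ℝ} (hμ : μ ≠ 0) :
    ∃ R : E →L[ℂ] E, ∀ f, H (R f) (f - (I * μ) • R f) := by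
  choose r s hrs hf using hH.surj μ hμ
  have key : ∀ {ψ χ f}, H ψ χ → χ + (I * μ) • ψ = f → ψ = r f := by
    intro ψ χ f h e
    have h1 := abs_mul_norm_le_norm_add_I_smul (hH.im_inner (hH.sub h (hrs f))) μ
    have : χ - s f + (I * μ) • (ψ - r f) = 0 := by
      rw [smul_sub]
      calc _ = (χ + (I * μ) • ψ) - (s f + (I * μ) • r f) := by abel
        _ = 0 := by rw [e, hf, sub_self]
    rw [this, norm_zero] at h1
    have h2 : ‖ψ - r f‖ = 0 := by
      have := abs_pos.2 hμ
      nlinarith [norm_nonneg (ψ - r f)]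
    exact sub_eq_zero.1 (norm_eq_zero.1 h2)
  let L : E →ₗ[ℂ] E :=
    { toFun := r
      map_add' := fun f g => (key (hH.add (hrs f) (hrs g)) (by
        conv_rhs => rw [← hf f, ← hf g]
        rw [smul_add]; abel)).symm
      map_smul' := fun c f => (key (hH.smul c (hrs f)) (by
        conv_rhs => rw [← hf f]
        rw [smul_add, smul_comm c])).symm }
  refine ⟨L.mkContinuous (|μ|⁻¹) fun f => ?_, fun f => ?_⟩
  · have h1 := abs_mul_norm_le_norm_add_I_smul (hH.im_inner (hrs f)) μ
    rw [hf] at h1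
    rw [inv_mul_eq_div, le_div_iff₀ (abs_pos.2 hμ), mul_comm]
    exact h1
  · have : f - (I * μ) • r f = s f := by
      rw [sub_eq_iff_eq_add, hf]
    change H (r f) (f - (I * μ) • r f)
    rw [this]; exact hrs f

/-- The resolvent `(H + iμ)⁻¹`. -/
def resolvent (μ : ℝ) : E →L[ℂ] E :=
  if h : μ ≠ 0 then (hH.exists_resolvent h).choose else 0

theorem resolvent_spec {μ : ℝ} (hμ : μ ≠ 0) (f : E) :
    H (hH.resolvent μ f) (f - (I * μ) • hH.resolvent μ f) := by
  rw [resolvent, dif_pos hμ]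
  exact (hH.exists_resolvent hμ).choose_spec f

theorem norm_resolvent_le {μ : ℝ} (hμ : μ ≠ 0) (f : E) :
    |μ| * ‖hH.resolvent μ f‖ ≤ ‖f‖ := by
  have := abs_mul_norm_le_norm_add_I_smul (hH.im_inner (hH.resolvent_spec hμ f)) μ
  simpa using this

theorem norm_sub_resolvent_le {μ : ℝ} (hμ : μ ≠ 0) (f : E) :
    ‖f - (I * μ) • hH.resolvent μ f‖ ≤ ‖f‖ := by
  have := norm_le_norm_add_I_smul (hH.im_inner (hH.resolvent_spec hμ f)) μ
  simpa using this

theorem resolvent_apply_of_graph {μ : ℝ} (hμ : μ ≠ 0) {ψ χ : E} (h : H ψ χ) :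
    hH.resolvent μ (χ + (I * μ) • ψ) = ψ := by
  have h0 := hH.resolvent_spec hμ (χ + (I * μ) • ψ)
  set ρ := hH.resolvent μ (χ + (I * μ) • ψ)
  have h1 := abs_mul_norm_le_norm_add_I_smul (hH.im_inner (hH.sub h0 h)) μ
  have e : χ + (I * μ) • ψ - (I * μ) • ρ - χ + (I * μ) • (ρ - ψ) = 0 := by
    rw [smul_sub]; abel
  rw [e, norm_zero] at h1
  have h2 : ‖ρ - ψ‖ = 0 := by
    have := abs_pos.2 hμ
    nlinarith [norm_nonneg (ρ - ψ)]
  exact sub_eq_zero.1 (norm_eq_zero.1 h2)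

theorem inner_resolvent {μ : ℝ} (hμ : μ ≠ 0) (f g : E) :
    inner ℂ (hH.resolvent μ f) g = inner ℂ f (hH.resolvent (-μ) g) := by
  have h := hH.inner_symm (hH.resolvent_spec hμ f) (hH.resolvent_spec (neg_ne_zero.2 hμ) g)
  simp only [inner_sub_left, inner_sub_right, inner_smul_left, inner_smul_right] at h
  simp only [map_mul, conj_I, conj_ofReal, ofReal_neg] at h
  linear_combination -h

theorem resolvent_identity {μ ν : ℝ} (hμ : μ ≠ 0) (hν : ν ≠ 0) (f : E) :
    hH.resolvent μ f = hH.resolvent ν f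
      + (I * (ν - μ)) • hH.resolvent μ (hH.resolvent ν f) := by
  have h := hH.resolvent_apply_of_graph hμ (hH.resolvent_spec hν f)
  have e : f = f - (I * ν) • hH.resolvent ν f + (I * μ) • hH.resolvent ν f
      + (I * (ν - μ)) • hH.resolvent ν f := by
    rw [mul_sub, sub_smul]; abel
  conv_lhs => rw [e, map_add, h, _root_.map_smul]

theorem resolvent_comm {μ ν : ℝ} (hμ : μ ≠ 0) (hν : ν ≠ 0) (f : E) :
    hH.resolvent μ (hH.resolvent ν f) = hH.resolvent ν (hH.resolvent μ f) := by
  rcases eq_or_ne μ ν with rfl | hne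
  · rfl
  have h1 := hH.resolvent_identity hμ hν f
  have h2 := hH.resolvent_identity hν hμ f
  have h3 : (I * (ν - μ : ℂ)) •
      (hH.resolvent μ (hH.resolvent ν f) - hH.resolvent ν (hH.resolvent μ f)) = 0 := by
    have e : (I * (μ - ν : ℂ)) = -(I * (ν - μ : ℂ)) := by ring
    rw [e, neg_smul] at h2
    rw [smul_sub, ← sub_eq_iff_eq_add'.2 h1, sub_eq_zero]
    rw [← sub_eq_add_neg, eq_sub_iff_add_eq, ← eq_sub_iff_add_eq'] at h2
    exact h2.symm
  have h4 : (I * (ν - μ : ℂ)) ≠ 0 := by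
    refine mul_ne_zero I_ne_zero ?_
    rw [sub_ne_zero]
    exact_mod_cast hne.symm
  exact sub_eq_zero.1 ((smul_eq_zero.1 h3).resolve_left h4)

/-- If `g` is orthogonal to the domain, then the resolvent at `-1`, the adjoint of the one at `1`,
kills `g`. So `g` is a value of `H` at `0`, and `eq_zero` finishes. -/
theorem dense_domain [CompleteSpace E] : Dense {ψ | ∃ χ, H ψ χ} := by
  let D : Submodule ℂ E :=
    { carrier := {ψ | ∃ χ, H ψ χ}
      add_mem' := fun ⟨a, ha⟩ ⟨b, hb⟩ => ⟨_, hH.add ha hb⟩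
      zero_mem' := by
        obtain ⟨ψ, χ, h, -⟩ := hH.surj 1 one_ne_zero 0
        exact ⟨_, by simpa using hH.smul 0 h⟩
      smul_mem' := fun c _ ⟨a, ha⟩ => ⟨_, hH.smul c ha⟩ }
  change Dense (D : Set E)
  rw [Submodule.dense_iff_topologicalClosure_eq_top, Submodule.topologicalClosure_eq_top_iff,
    Submodule.eq_bot_iff]
  intro g hg
  have h1 : (1 : ℝ) ≠ 0 := one_ne_zero
  have hz : hH.resolvent (-1) g = 0 := by
    refine ext_inner_left ℂ fun f => ?_
    rw [inner_zero_right, ← hH.inner_resolvent h1]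
    exact (Submodule.mem_orthogonal _ _).1 hg _ ⟨_, hH.resolvent_spec h1 f⟩
  have h2 := hH.resolvent_spec (neg_ne_zero.2 h1) g
  rw [hz, smul_zero, sub_zero] at h2
  exact hH.eq_zero h2

/-- Self-adjoint bounded approximations `n² H / (H² + n²)` of `H`. -/
def yosida (n : ℕ) : E →L[ℂ] E :=
  ((n + 1 : ℂ) ^ 2 / 2) • (hH.resolvent (n + 1) + hH.resolvent (-(n + 1)))

theorem isSelfAdjoint_yosida [CompleteSpace E] (n : ℕ) : IsSelfAdjoint (hH.yosida n) := by
  rw [ContinuousLinearMap.isSelfAdjoint_iff_isSymmetric]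
  intro f g
  have hn : (n + 1 : ℝ) ≠ 0 := by positivity
  have e1 := hH.inner_resolvent hn f g
  have e2 := hH.inner_resolvent (neg_ne_zero.2 hn) f g
  rw [neg_neg] at e2
  simp only [yosida, ContinuousLinearMap.coe_coe, _root_.smul_apply,
    _root_.add_apply, inner_smul_left, inner_smul_right, inner_add_left,
    inner_add_right, e1, e2]
  have : (starRingEnd ℂ) ((n + 1 : ℂ) ^ 2 / 2) = (n + 1 : ℂ) ^ 2 / 2 := by
    simp [Complex.conj_ofNat]
  rw [this]; ring

theorem yosida_comm (n k : ℕ) : Commute (hH.yosida n) (hH.yosida k) := by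
  have hn : (n + 1 : ℝ) ≠ 0 := by positivity
  have hk : (k + 1 : ℝ) ≠ 0 := by positivity
  have c : ∀ {μ ν : ℝ}, μ ≠ 0 → ν ≠ 0 → Commute (hH.resolvent μ) (hH.resolvent ν) :=
    fun hμ hν => ContinuousLinearMap.ext fun f => hH.resolvent_comm hμ hν f
  have hn' := neg_ne_zero.2 hn
  have hk' := neg_ne_zero.2 hk
  unfold yosida
  exact (((c hn hk).add_left (c hn' hk)).add_right
    ((c hn hk').add_left (c hn' hk'))).smul_left _ |>.smul_right _

/-- On the domain the expression equals the resolvent applied to `H φ`, which is `O(1/|μ|)`;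
`norm_sub_resolvent_le` extends the convergence to the closure. -/
theorem tendsto_sub_resolvent [CompleteSpace E] {μ : ℕ → ℝ} (h0 : ∀ n, μ n ≠ 0)
    (hμ : Filter.Tendsto (fun n => |μ n|) Filter.atTop Filter.atTop) (f : E) :
    Filter.Tendsto (fun n => f - (I * μ n) • hH.resolvent (μ n) f) Filter.atTop (nhds 0) := by
  rw [Metric.tendsto_atTop]
  intro ε hε
  obtain ⟨φ, ⟨χ, hφ⟩, hd⟩ := Metric.mem_closure_iff.1 (hH.dense_domain f) (ε / 2) (by positivity)
  obtain ⟨N, hN⟩ := Filter.eventually_atTop.1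
    (hμ.eventually_gt_atTop (2 * ‖χ‖ / ε))
  refine ⟨N, fun n hn => ?_⟩
  have e : f - (I * μ n) • hH.resolvent (μ n) f
      = ((f - φ) - (I * μ n) • hH.resolvent (μ n) (f - φ)) + hH.resolvent (μ n) χ := by
    have h1 := hH.resolvent_apply_of_graph (h0 n) hφ
    rw [map_add, _root_.map_smul] at h1
    have h2 : hH.resolvent (μ n) χ = φ - (I * μ n) • hH.resolvent (μ n) φ :=
      eq_sub_of_add_eq h1
    rw [h2, map_sub, smul_sub]; abel
  rw [dist_zero_right, e]
  have h3 := hH.norm_sub_resolvent_le (h0 n) (f - φ)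
  have h4 := hH.norm_resolvent_le (h0 n) χ
  have h5 := hN n hn
  rw [div_lt_iff₀ hε] at h5
  have hpos : 0 < |μ n| := abs_pos.2 (h0 n)
  have h6 : ‖hH.resolvent (μ n) χ‖ < ε / 2 := by
    by_contra hc
    push Not at hc
    nlinarith
  rw [dist_eq_norm] at hd
  exact (norm_add_le _ _).trans_lt (by linarith)

/-- On the domain the two resolvents in `yosida` turn into resolvents of `χ`; the terms with `ψ`
cancel between the signs, and what remains is `χ` minus the mean of two errors tending to zero. -/
theorem tendsto_yosida [CompleteSpace E] {ψ χ : E} (h : H ψ χ) :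
    Filter.Tendsto (fun n => hH.yosida n ψ) Filter.atTop (nhds χ) := by
  have hn : ∀ n : ℕ, (n + 1 : ℝ) ≠ 0 := fun n => by positivity
  have hn' : ∀ n : ℕ, -(n + 1 : ℝ) ≠ 0 := fun n => neg_ne_zero.2 (hn n)
  have ht : Filter.Tendsto (fun n : ℕ => |(n + 1 : ℝ)|) Filter.atTop Filter.atTop :=
    Filter.tendsto_abs_atTop_atTop.comp
      (Filter.tendsto_atTop_add_const_right _ _ tendsto_natCast_atTop_atTop)
  have ht' : Filter.Tendsto (fun n : ℕ => |-(n + 1 : ℝ)|) Filter.atTop Filter.atTop := by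
    simpa only [abs_neg] using ht
  have t1 := hH.tendsto_sub_resolvent hn ht χ
  have t2 := hH.tendsto_sub_resolvent hn' ht' χ
  have t3 := (tendsto_const_nhds (x := χ)).sub ((t1.add t2).const_smul (1 / 2 : ℂ))
  rw [add_zero, smul_zero, sub_zero] at t3
  refine t3.congr fun n => ?_
  have h1 := hH.resolvent_apply_of_graph (hn n) h
  have h2 := hH.resolvent_apply_of_graph (hn' n) h
  rw [map_add, _root_.map_smul] at h1 h2
  simp only [yosida, _root_.smul_apply, _root_.add_apply]
  have hc : (n + 1 : ℂ) ≠ 0 := by exact_mod_cast hn n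
  have e1 : hH.resolvent (n + 1) ψ
      = (I * (n + 1 : ℂ))⁻¹ • (ψ - hH.resolvent (n + 1) χ) := by
    rw [eq_inv_smul_iff₀ (mul_ne_zero I_ne_zero hc)]
    rw [eq_sub_iff_add_eq']
    simpa using h1
  have e2 : hH.resolvent (-(n + 1)) ψ
      = (-(I * (n + 1 : ℂ)))⁻¹ • (ψ - hH.resolvent (-(n + 1)) χ) := by
    rw [eq_inv_smul_iff₀ (neg_ne_zero.2 (mul_ne_zero I_ne_zero hc))]
    rw [eq_sub_iff_add_eq']
    push_cast at h2
    rwa [mul_neg] at h2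
  rw [e1, e2]
  push_cast
  generalize hH.resolvent (n + 1) χ = a
  generalize hH.resolvent (-(n + 1)) χ = b
  have hI : I⁻¹ = -I := inv_I
  match_scalars <;> field_simp <;> simp <;> ring

end IsSelfAdjointGraph

/-! ### Unitary groups of bounded self-adjoint operators -/

section BoundedGroup

variable [CompleteSpace E] {B B' : E →L[ℂ] E}

/-- The unitary group `exp(-itB)` of a bounded self-adjoint operator. -/
def expGroup (B : E →L[ℂ] E) (t : ℝ) : E →L[ℂ] E := NormedSpace.exp (t • (-I • B))

theorem expGroup_zero (B : E →L[ℂ] E) : expGroup B 0 = 1 := by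
  simp [expGroup]

theorem expGroup_add (B : E →L[ℂ] E) (s t : ℝ) :
    expGroup B (s + t) = expGroup B s * expGroup B t := by
  let _ : NormedAlgebra ℚ (E →L[ℂ] E) := NormedAlgebra.restrictScalars ℚ ℂ _
  rw [expGroup, add_smul]
  exact NormedSpace.exp_add_of_commute (((Commute.refl _).smul_left s).smul_right t)

theorem norm_expGroup_apply (hB : IsSelfAdjoint B) (t : ℝ) (ψ : E) :
    ‖expGroup B t ψ‖ = ‖ψ‖ := by
  have h1 : star (expGroup B t) * expGroup B t = 1 := by
    have : star (expGroup B t) = expGroup B (-t) := by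
      rw [expGroup, NormedSpace.star_exp, expGroup]
      congr 1
      rw [star_smul, star_smul, hB.star_eq]
      simp
    rw [this, ← expGroup_add, neg_add_cancel, expGroup_zero]
  have h2 : inner ℂ (expGroup B t ψ) (expGroup B t ψ) = inner ℂ ψ ψ := by
    rw [← ContinuousLinearMap.adjoint_inner_right, ← ContinuousLinearMap.star_eq_adjoint,
      ← mul_apply_eq_comp, h1, one_apply_eq_self]
  have h3 : ‖expGroup B t ψ‖ ^ 2 = ‖ψ‖ ^ 2 := by
    rw [@norm_sq_eq_re_inner ℂ, @norm_sq_eq_re_inner ℂ, h2]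
  exact (sq_eq_sq₀ (norm_nonneg _) (norm_nonneg _)).1 h3

theorem hasDerivAt_expGroup (B : E →L[ℂ] E) (t : ℝ) (ψ : E) :
    HasDerivAt (fun t => expGroup B t ψ) (expGroup B t (-I • B ψ)) t :=
  ((ContinuousLinearMap.apply ℂ E ψ).restrictScalars ℝ).hasFDerivAt.comp_hasDerivAt t
    (hasDerivAt_exp_smul_const (𝕂 := ℝ) (-I • B) t)

theorem norm_expGroup_sub_le (hB : IsSelfAdjoint B) (t : ℝ) (ψ : E) :
    ‖expGroup B t ψ - ψ‖ ≤ ‖B ψ‖ * |t| := by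
  have := Convex.norm_image_sub_le_of_norm_hasDerivWithin_le (C := ‖B ψ‖)
    (fun x _ => (hasDerivAt_expGroup B x ψ).hasDerivWithinAt)
    (fun x _ => by rw [norm_expGroup_apply hB, norm_smul]; simp) (convex_univ)
    (Set.mem_univ 0) (Set.mem_univ t)
  simpa [expGroup_zero] using this

/-- For commuting generators the quotient of the two groups is the group of the difference, so the
previous estimate applies to `B - B'`. -/
theorem norm_expGroup_sub_expGroup_le (hB : IsSelfAdjoint B) (hB' : IsSelfAdjoint B')
    (h : Commute B B') (t : ℝ) (ψ : E) :
    ‖expGroup B t ψ - expGroup B' t ψ‖ ≤ ‖B ψ - B' ψ‖ * |t| := by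
  let _ : NormedAlgebra ℚ (E →L[ℂ] E) := NormedAlgebra.restrictScalars ℚ ℂ _
  have e : expGroup B t = expGroup B' t * expGroup (B - B') t := by
    rw [expGroup, expGroup, expGroup, ← NormedSpace.exp_add_of_commute]
    · rw [← smul_add, ← smul_add]; simp
    · have hc : Commute B' (B - B') := h.symm.sub_right (Commute.refl _)
      exact (((hc.smul_left _).smul_right _).smul_left _).smul_right _
  rw [e, mul_apply_eq_comp, ← map_sub, norm_expGroup_apply hB']
  exact norm_expGroup_sub_le (hB.sub hB') t ψ

/-- A Taylor estimate that avoids `B² ψ`: the vector `φ` replaces `B ψ`. The bound thus survives `B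
= yosida n → H` when `φ` is in the domain and close to `H ψ`, even if `H ψ` itself is not in the
domain. -/
theorem norm_expGroup_sub_sub_le (hB : IsSelfAdjoint B) (t : ℝ) (ψ φ : E) :
    ‖expGroup B t ψ - ψ + (I * t) • B ψ‖ ≤ (‖B φ‖ * |t| + 2 * ‖B ψ - φ‖) * |t| := by
  have hd : ∀ x : ℝ, HasDerivAt (fun t : ℝ => expGroup B t ψ + (I * t) • B ψ)
      (expGroup B x (-I • B ψ) + I • B ψ) x := fun x => by
    refine (hasDerivAt_expGroup B x ψ).add ?_
    have := ((Complex.ofRealCLM.hasDerivAt (x := x)).const_mul I).smul_const (B ψ)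
    simpa using this
  have := Convex.norm_image_sub_le_of_norm_hasDerivWithin_le
    (C := ‖B φ‖ * |t| + 2 * ‖B ψ - φ‖) (s := Set.Icc (-|t|) |t|)
    (fun x _ => (hd x).hasDerivWithinAt)
    (fun x hx => ?_) (convex_Icc _ _)
    (x := 0) (y := t) (by simp) (by simp [neg_abs_le, le_abs_self])
  · have e : expGroup B t ψ + (I * t) • B ψ - (expGroup B 0 ψ + (I * (0 : ℝ)) • B ψ)
        = expGroup B t ψ - ψ + (I * t) • B ψ := by
      simp [expGroup_zero]; abel
    rw [e, sub_zero] at this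
    exact this
  · have e : expGroup B x (-I • B ψ) + I • B ψ
        = -I • ((expGroup B x φ - φ) + (expGroup B x (B ψ - φ) - (B ψ - φ))) := by
      have : expGroup B x (-I • B ψ) = -I • expGroup B x (B ψ) := _root_.map_smul _ _ _
      rw [this]
      simp only [map_sub, neg_smul, smul_add, smul_sub]; abel
    rw [e, norm_smul, norm_neg, norm_I, one_mul]
    refine (norm_add_le _ _).trans (add_le_add ?_ ?_)
    · exact (norm_expGroup_sub_le hB x φ).trans
        (mul_le_mul_of_nonneg_left (abs_le.2 hx) (norm_nonneg _))
    · refine (norm_sub_le _ _).trans ?_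
      rw [norm_expGroup_apply hB, two_mul]

end BoundedGroup

/-! ### The unitary group of a self-adjoint graph -/

namespace IsSelfAdjointGraph

variable [CompleteSpace E] {H : E → E → Prop} (hH : IsSelfAdjointGraph H)

include hH

theorem cauchySeq_expGroup_yosida (t : ℝ) (ψ : E) :
    CauchySeq fun n => expGroup (hH.yosida n) t ψ := by
  rw [Metric.cauchySeq_iff]
  intro ε hε
  obtain ⟨φ, ⟨χ, hφ⟩, hd⟩ := Metric.mem_closure_iff.1 (hH.dense_domain ψ) (ε / 3) (by positivity)
  obtain ⟨N, hN⟩ := Metric.cauchySeq_iff.1 (hH.tendsto_yosida hφ).cauchySeq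
    (ε / (3 * (|t| + 1))) (by positivity)
  refine ⟨N, fun n hn k hk => ?_⟩
  have h1 := norm_expGroup_sub_expGroup_le (hH.isSelfAdjoint_yosida n)
    (hH.isSelfAdjoint_yosida k) (hH.yosida_comm n k) t φ
  have h2 := hN n hn k hk
  rw [dist_eq_norm, lt_div_iff₀ (by positivity)] at h2
  have e : ∀ n, ‖expGroup (hH.yosida n) t ψ - expGroup (hH.yosida n) t φ‖ = ‖ψ - φ‖ := fun n => by
    rw [← map_sub, norm_expGroup_apply (hH.isSelfAdjoint_yosida n)]
  rw [dist_eq_norm] at hd ⊢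
  have e1 := e n
  have e2 := e k
  rw [norm_sub_rev] at e2
  have h3 : ‖expGroup (hH.yosida n) t φ - expGroup (hH.yosida k) t φ‖ < ε / 3 := by
    refine h1.trans_lt ?_
    nlinarith [norm_nonneg (hH.yosida n φ - hH.yosida k φ)]
  calc _ = ‖(expGroup (hH.yosida n) t ψ - expGroup (hH.yosida n) t φ)
        + (expGroup (hH.yosida n) t φ - expGroup (hH.yosida k) t φ)
        + (expGroup (hH.yosida k) t φ - expGroup (hH.yosida k) t ψ)‖ := by congr 1; abel
    _ ≤ _ := norm_add₃_le
    _ < ε := by linarith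

/-- A self-adjoint operator generates a strongly continuous unitary group. -/
theorem exists_unitaryGroup : ∃ U : ℝ → E ≃ₗᵢ[ℂ] E, (∀ ψ, U 0 ψ = ψ) ∧
    (∀ s t ψ, U (s + t) ψ = U s (U t ψ)) ∧ (∀ ψ, Continuous fun t => U t ψ) ∧
    ∀ ψ χ, H ψ χ ↔ HasDerivAt (fun t => U t ψ) (-I • χ) 0 := by
  choose L hL using fun t ψ => cauchySeq_tendsto_of_complete (hH.cauchySeq_expGroup_yosida t ψ)
  have hnorm : ∀ t ψ, ‖L t ψ‖ = ‖ψ‖ := fun t ψ =>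
    tendsto_nhds_unique (hL t ψ).norm (by
      simp only [norm_expGroup_apply (hH.isSelfAdjoint_yosida _)]
      exact tendsto_const_nhds)
  have hadd : ∀ t ψ φ, L t (ψ + φ) = L t ψ + L t φ := fun t ψ φ =>
    tendsto_nhds_unique (hL t (ψ + φ)) (by
      simp only [map_add]
      exact (hL t ψ).add (hL t φ))
  have hsmul : ∀ t (c : ℂ) ψ, L t (c • ψ) = c • L t ψ := fun t c ψ =>
    tendsto_nhds_unique (hL t (c • ψ)) (by
      simp only [_root_.map_smul]
      exact (hL t ψ).const_smul c)
  have hzero : ∀ ψ, L 0 ψ = ψ := fun ψ =>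
    tendsto_nhds_unique (hL 0 ψ) (by
      simp only [expGroup_zero, one_apply_eq_self]
      exact tendsto_const_nhds)
  have hgroup : ∀ s t ψ, L (s + t) ψ = L s (L t ψ) := fun s t ψ => by
    refine tendsto_nhds_unique (hL (s + t) ψ) ?_
    have h1 : Filter.Tendsto (fun n => expGroup (hH.yosida n) s (expGroup (hH.yosida n) t ψ - L t ψ))
        Filter.atTop (nhds 0) := by
      rw [tendsto_zero_iff_norm_tendsto_zero]
      simp only [norm_expGroup_apply (hH.isSelfAdjoint_yosida _)]
      exact tendsto_iff_norm_sub_tendsto_zero.1 (hL t ψ)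
    have h2 := h1.add (hL s (L t ψ))
    rw [zero_add] at h2
    refine h2.congr fun n => ?_
    rw [expGroup_add, mul_apply_eq_comp, map_sub, sub_add_cancel]
  have hsub : ∀ t ψ φ, L t (ψ - φ) = L t ψ - L t φ := fun t ψ φ => by
    rw [sub_eq_add_neg, hadd, ← neg_one_smul ℂ φ, hsmul, neg_one_smul, ← sub_eq_add_neg]
  let U : ℝ → E ≃ₗᵢ[ℂ] E := fun t =>
    { toFun := L t
      map_add' := hadd t
      map_smul' := hsmul t
      invFun := L (-t)
      left_inv := fun ψ => by rw [← hgroup, neg_add_cancel, hzero]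
      right_inv := fun ψ => by rw [← hgroup, add_neg_cancel, hzero]
      norm_map' := hnorm t }
  have hU : ∀ t ψ, U t ψ = L t ψ := fun _ _ => rfl
  -- Limit in `n` of `norm_expGroup_sub_sub_le`, with the bounded generators applied to `ψ` and `φ`
  -- tending to `χ` and `η`.
  have hgen : ∀ {ψ χ φ η}, H ψ χ → H φ η → ∀ t : ℝ,
      ‖L t ψ - ψ + (I * t) • χ‖ ≤ (‖η‖ * |t| + 2 * ‖χ - φ‖) * |t| := by
    intro ψ χ φ η h h' t
    have tψ := hH.tendsto_yosida h
    have tφ := hH.tendsto_yosida h'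
    refine le_of_tendsto_of_tendsto'
      ((((hL t ψ).sub_const ψ).add (tψ.const_smul (I * t : ℂ))).norm)
      (((tφ.norm.mul_const |t|).add (((tψ.sub_const φ).norm).const_mul 2)).mul_const |t|)
      fun n => norm_expGroup_sub_sub_le (hH.isSelfAdjoint_yosida n) t ψ φ
  have hder : ∀ {ψ χ}, H ψ χ → HasDerivAt (fun t => U t ψ) (-I • χ) 0 := by
    intro ψ χ h
    rw [hasDerivAt_iff_isLittleO, Asymptotics.isLittleO_iff]
    intro ε hε
    obtain ⟨φ, ⟨η, hφ⟩, hd⟩ := Metric.mem_closure_iff.1 (hH.dense_domain χ) (ε / 4) (by positivity)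
    rw [dist_eq_norm] at hd
    have hnh : Metric.ball (0 : ℝ) (ε / (2 * (‖η‖ + 1))) ∈ nhds (0 : ℝ) :=
      Metric.ball_mem_nhds _ (by positivity)
    filter_upwards [hnh] with t ht
    rw [mem_ball_zero_iff, Real.norm_eq_abs, lt_div_iff₀ (by positivity)] at ht
    have e : U t ψ - U 0 ψ - (t - 0) • (-I • χ) = L t ψ - ψ + (I * t) • χ := by
      rw [hU, hU, hzero, sub_zero, ← Complex.coe_smul, smul_smul, sub_eq_add_neg _ (_ • χ),
        ← neg_smul]
      congr 3; ring
    rw [e, sub_zero, Real.norm_eq_abs]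
    refine (hgen h hφ t).trans (mul_le_mul_of_nonneg_right ?_ (abs_nonneg t))
    nlinarith [abs_nonneg t]
  have hlip : ∀ {φ η}, H φ η → ∀ s t : ℝ,
      ‖L t φ - L s φ‖ ≤ ‖η‖ * |t - s| := by
    intro φ η h s t
    have e : L t φ - L s φ = L s (L (t - s) φ - φ) := by
      rw [hsub, ← hgroup, add_sub_cancel]
    rw [e, hnorm]
    refine le_of_tendsto_of_tendsto' ((hL (t - s) φ).sub_const φ).norm
      (((hH.tendsto_yosida h).norm).mul_const |t - s|)
      fun n => norm_expGroup_sub_le (hH.isSelfAdjoint_yosida n) _ _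
  refine ⟨U, hzero, hgroup, fun ψ => ?_, fun ψ χ => ⟨hder, fun h => ?_⟩⟩
  · rw [Metric.continuous_iff]
    intro s ε hε
    obtain ⟨φ, ⟨η, hφ⟩, hd⟩ := Metric.mem_closure_iff.1 (hH.dense_domain ψ) (ε / 4) (by positivity)
    rw [dist_eq_norm] at hd
    refine ⟨ε / (2 * (‖η‖ + 1)), by positivity, fun t ht => ?_⟩
    rw [Real.dist_eq, lt_div_iff₀ (by positivity)] at ht
    rw [dist_eq_norm, hU, hU]
    have h1 := hlip hφ s t
    have h2 : ‖L t (ψ - φ)‖ = ‖ψ - φ‖ := hnorm _ _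
    have h3 : ‖L s (ψ - φ)‖ = ‖ψ - φ‖ := hnorm _ _
    calc _ = ‖L t (ψ - φ) + (L t φ - L s φ) - L s (ψ - φ)‖ := by
          rw [hsub, hsub]; congr 1; abel
      _ ≤ ‖L t (ψ - φ)‖ + ‖L t φ - L s φ‖ + ‖L s (ψ - φ)‖ :=
          (norm_sub_le _ _).trans (add_le_add_left (norm_add_le _ _) _)
      _ < ε := by
          rw [h2, h3]
          nlinarith [abs_nonneg (t - s)]
  -- No proper extension of `H` can be the generator: solve `(H + i) ψ' = χ + iψ`. Conservation of
  -- the norm makes the derivative at `ψ - ψ'` symmetric, so the lower bound for `H + i` forces `ψ =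
  -- ψ'`.
  · obtain ⟨ψ', χ', h', e⟩ := hH.surj 1 one_ne_zero (χ + (I * (1 : ℝ)) • ψ)
    have hd := h.sub (hder h')
    have hd' : HasDerivAt (fun t => U t (ψ - ψ')) (-I • (χ - χ')) 0 := by
      rw [smul_sub]
      refine hd.congr_of_eventuallyEq (Filter.Eventually.of_forall fun t => ?_)
      simp
    have him : (inner ℂ (ψ - ψ') (χ - χ')).im = 0 := by
      have hin := hd'.inner ℂ hd'
      have hc : (fun t => inner ℂ (U t (ψ - ψ')) (U t (ψ - ψ')))
          = fun _ => inner ℂ (ψ - ψ') (ψ - ψ') := by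
        funext t
        exact (U t).inner_map_map _ _
      rw [hc] at hin
      have h0 := hin.unique (hasDerivAt_const _ _)
      simp only [hU, hzero, inner_smul_left, inner_smul_right, map_neg, conj_I, neg_neg] at h0
      rw [← inner_conj_symm (χ - χ') (ψ - ψ')] at h0
      have := congrArg Complex.re h0
      simp [-inner_conj_symm] at this
      linarith
    have hb := abs_mul_norm_le_norm_add_I_smul him 1
    have e0 : χ - χ' + (I * (1 : ℝ)) • (ψ - ψ') = 0 := by
      rw [smul_sub]
      calc _ = (χ + (I * (1 : ℝ)) • ψ) - (χ' + (I * (1 : ℝ)) • ψ') := by abel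
        _ = 0 := by rw [e, sub_self]
    rw [e0, norm_zero, abs_one, one_mul] at hb
    have eψ : ψ = ψ' := sub_eq_zero.1 (norm_eq_zero.1 (le_antisymm hb (norm_nonneg _)))
    subst eψ
    rw [add_left_inj] at e
    rwa [← e]

/-- The derivative is expressed with complex scalars only, so that it transfers to `L2`
independently of the real scalar action used there. -/
theorem exists_unitaryGroup_isLittleO : ∃ U : ℝ → E ≃ₗᵢ[ℂ] E, (∀ ψ, U 0 ψ = ψ) ∧
    (∀ s t ψ, U (s + t) ψ = U s (U t ψ)) ∧ (∀ ψ, Continuous fun t => U t ψ) ∧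
    ∀ ψ χ, H ψ χ ↔ (fun t : ℝ => U t ψ - ψ - (t : ℂ) • (-I • χ)) =o[nhds 0] fun t => t := by
  obtain ⟨U, h0, hadd, hcont, hgen⟩ := hH.exists_unitaryGroup
  refine ⟨U, h0, hadd, hcont, fun ψ χ => ?_⟩
  rw [hgen, hasDerivAt_iff_isLittleO]
  simp only [h0, sub_zero, ← Complex.coe_smul]

end IsSelfAdjointGraph

end Stone

/-! ### Multiplication operators and parity on `L²(ℝ)` -/

/-- Bounded measurable functions. -/
def IsMultiplier (g : ℝ → ℂ) : Prop := Measurable g ∧ ∃ C, ∀ x, ‖g x‖ ≤ C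

theorem IsMultiplier.memLp_mul {g : ℝ → ℂ} (hg : IsMultiplier g) (f : L2) :
    MemLp (fun x => g x * f x) 2 volume := by
  obtain ⟨hm, C, hC⟩ := hg
  refine (Lp.memLp f).of_le_mul (c := C)
    (hm.aestronglyMeasurable.mul (Lp.aestronglyMeasurable f)) (Filter.Eventually.of_forall fun x => ?_)
  rw [norm_mul]
  exact mul_le_mul_of_nonneg_right (hC x) (norm_nonneg _)

/-- Multiplication by a bounded measurable function, as an operator on `L²(ℝ)`. -/
def mulCLM (g : ℝ → ℂ) (hg : IsMultiplier g) : L2 →L[ℂ] L2 :=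
  LinearMap.mkContinuous
    { toFun := fun f => (hg.memLp_mul f).toLp _
      map_add' := fun f f' => by
        apply Lp.ext
        filter_upwards [(hg.memLp_mul (f + f')).coeFn_toLp, (hg.memLp_mul f).coeFn_toLp,
          (hg.memLp_mul f').coeFn_toLp, Lp.coeFn_add f f', Lp.coeFn_add
          ((hg.memLp_mul f).toLp _) ((hg.memLp_mul f').toLp _)] with x h1 h2 h3 h4 h5
        rw [h1, h5, Pi.add_apply, h2, h3, h4, Pi.add_apply, mul_add]
      map_smul' := fun c f => by
        apply Lp.ext
        filter_upwards [(hg.memLp_mul (c • f)).coeFn_toLp, (hg.memLp_mul f).coeFn_toLp,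
          Lp.coeFn_smul c f, Lp.coeFn_smul c ((hg.memLp_mul f).toLp _)] with x h1 h2 h3 h4
        rw [h1, RingHom.id_apply, h4, Pi.smul_apply, h2, h3, Pi.smul_apply, smul_eq_mul,
          smul_eq_mul]
        ring }
    hg.2.choose fun f => by
      apply Lp.norm_le_mul_norm_of_ae_le_mul
      filter_upwards [(hg.memLp_mul f).coeFn_toLp] with x h1
      change ‖((hg.memLp_mul f).toLp _ : ℝ → ℂ) x‖ ≤ _
      rw [h1, norm_mul]
      exact mul_le_mul_of_nonneg_right (hg.2.choose_spec x) (norm_nonneg _)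

theorem coeFn_mulCLM {g : ℝ → ℂ} (hg : IsMultiplier g) (f : L2) :
    mulCLM g hg f =ᵐ[volume] fun x => g x * f x :=
  (hg.memLp_mul f).coeFn_toLp

theorem norm_mulCLM_le {g : ℝ → ℂ} (hg : IsMultiplier g) {C : ℝ} (hC : ∀ x, ‖g x‖ ≤ C) (f : L2) :
    ‖mulCLM g hg f‖ ≤ C * ‖f‖ := by
  apply Lp.norm_le_mul_norm_of_ae_le_mul
  filter_upwards [coeFn_mulCLM hg f] with x h1
  rw [h1, norm_mul]
  exact mul_le_mul_of_nonneg_right (hC x) (norm_nonneg _)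

theorem isMultiplier_indicator {s : Set ℝ} (hs : MeasurableSet s) :
    IsMultiplier (s.indicator 1) := by
  refine ⟨measurable_one.indicator hs, 1, fun x => ?_⟩
  by_cases hx : x ∈ s <;> simp [hx]

/-- Restriction to a measurable set. -/
def cut (s : Set ℝ) (hs : MeasurableSet s) : L2 →L[ℂ] L2 :=
  mulCLM (s.indicator 1) (isMultiplier_indicator hs)

theorem coeFn_cut {s : Set ℝ} (hs : MeasurableSet s) (f : L2) :
    cut s hs f =ᵐ[volume] s.indicator f := by
  filter_upwards [coeFn_mulCLM (isMultiplier_indicator hs) f] with x hx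
  rw [cut, hx]
  by_cases h : x ∈ s <;> simp [h]

theorem norm_cut_le {s : Set ℝ} (hs : MeasurableSet s) (f : L2) : ‖cut s hs f‖ ≤ ‖f‖ := by
  have := norm_mulCLM_le (isMultiplier_indicator hs) (C := 1) (fun x => by
    by_cases hx : x ∈ s <;> simp [hx]) f
  rwa [one_mul] at this

/-- Restriction to the positive half-line. -/
def cutPos : L2 →L[ℂ] L2 := cut (Set.Ioi 0) measurableSet_Ioi

/-- Restriction to the negative half-line. -/
def cutNeg : L2 →L[ℂ] L2 := cut (Set.Iio 0) measurableSet_Iio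

theorem cutPos_add_cutNeg (f : L2) : cutPos f + cutNeg f = f := by
  apply Lp.ext
  have h0 : ∀ᵐ x : ℝ, x ≠ 0 := by simp [ae_iff, measure_singleton]
  filter_upwards [Lp.coeFn_add (cutPos f) (cutNeg f), coeFn_cut measurableSet_Ioi f,
    coeFn_cut measurableSet_Iio f, h0] with x h1 h2 h3 hx
  rw [h1, Pi.add_apply, cutPos, cutNeg, h2, h3]
  rcases lt_or_gt_of_ne hx with h | h
  · simp [h, h.le]
  · simp [h, h.le]

/-- The parity operator `ψ(x) ↦ ψ(-x)`. -/
def parity : L2 →ₗᵢ[ℂ] L2 :=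
  Lp.compMeasurePreservingₗᵢ ℂ Neg.neg (Measure.measurePreserving_neg volume)

theorem ae_comp_neg {p : ℝ → Prop} (h : ∀ᵐ x : ℝ, p x) : ∀ᵐ x : ℝ, p (-x) :=
  (Measure.measurePreserving_neg (volume : Measure ℝ)).quasiMeasurePreserving.ae h

theorem coeFn_parity (f : L2) : parity f =ᵐ[volume] fun x => f (-x) :=
  Lp.coeFn_compMeasurePreserving f (Measure.measurePreserving_neg volume)

theorem parity_parity (f : L2) : parity (parity f) = f := by
  apply Lp.ext
  filter_upwards [coeFn_parity (parity f), ae_comp_neg (coeFn_parity f)] with x h1 h2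
  rw [h1, h2, neg_neg]

/-- The parity operator as a unitary operator. -/
def parityEquiv : L2 ≃ₗᵢ[ℂ] L2 :=
  { parity with
    invFun := parity
    left_inv := parity_parity
    right_inv := parity_parity }

theorem cutNeg_parity (f : L2) : cutNeg (parity f) = parity (cutPos f) := by
  apply Lp.ext
  filter_upwards [coeFn_cut measurableSet_Iio (parity f), coeFn_parity f,
    coeFn_parity (cutPos f), ae_comp_neg (coeFn_cut measurableSet_Ioi f)] with x h1 h2 h3 h4
  rw [cutNeg, h1, h3, cutPos, h4]
  by_cases h : x < 0 <;> simp [h, h2]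

theorem cutPos_parity (f : L2) : cutPos (parity f) = parity (cutNeg f) := by
  have := cutNeg_parity (parity f)
  rw [parity_parity] at this
  rw [this, parity_parity]

/-! ### The Fourier transform on `L²(ℝ)` -/

open FourierTransform in
/-- The inverse Fourier transform on `L²(ℝ)`. -/
def fourierInvL2 : L2 ≃ₗᵢ[ℂ] L2 := (Lp.fourierTransformₗᵢ ℝ ℂ).symm

open FourierTransform in
theorem integral_fourierInv_smul_eq_of_integrable {f g : ℝ → ℂ} (hf : Integrable f)
    (hg : Integrable g) : ∫ x, (𝓕⁻ f) x • g x = ∫ x, f x • (𝓕⁻ g) x := by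
  have h := VectorFourier.integral_fourierIntegral_smul_eq_flip (L := -innerₗ ℝ) (μ := volume)
    (ν := volume) (e := Real.fourierChar) Real.continuous_fourierChar
    (by simp; fun_prop) hf hg
  simp only [Real.fourierInv_eq]
  simp only [VectorFourier.fourierIntegral, LinearMap.neg_apply, LinearMap.flip_apply, neg_neg,
    innerₗ_apply_apply] at h
  rw [h]
  refine integral_congr_ae (Filter.Eventually.of_forall fun x => ?_)
  simp only [real_inner_comm x]

open FourierTransform in
theorem integral_fourier_smul_eq_of_integrable {f g : ℝ → ℂ} (hf : Integrable f)
    (hg : Integrable g) : ∫ x, (𝓕 f) x • g x = ∫ x, f x • (𝓕 g) x := by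
  have h := VectorFourier.integral_fourierIntegral_smul_eq_flip (L := innerₗ ℝ) (μ := volume)
    (ν := volume) (e := Real.fourierChar) Real.continuous_fourierChar
    (by simp; fun_prop) hf hg
  simp only [Real.fourier_eq]
  simp only [VectorFourier.fourierIntegral, LinearMap.flip_apply,
    innerₗ_apply_apply] at h
  rw [h]
  refine integral_congr_ae (Filter.Eventually.of_forall fun x => ?_)
  simp only [real_inner_comm x]

open FourierTransform in
theorem ae_eq_of_integral_schwartz_smul_eq {f g : ℝ → ℂ} (hf : LocallyIntegrable f)
    (hg : LocallyIntegrable g)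
    (h : ∀ s : SchwartzMap ℝ ℂ, ∫ x, s x • f x = ∫ x, s x • g x) : f =ᵐ[volume] g := by
  refine ae_eq_of_integral_contDiff_smul_eq hf hg fun φ hφ hc => ?_
  have hc' : HasCompactSupport fun x => (φ x : ℂ) := hc.comp_left (g := fun r : ℝ => (r : ℂ)) (by simp)
  exact h (hc'.toSchwartzMap (Complex.ofRealCLM.contDiff.comp hφ))

open FourierTransform in
theorem continuous_fourierInv_of_integrable {f : ℝ → ℂ} (hf : Integrable f) :
    Continuous (𝓕⁻ f) := by
  have : Continuous (𝓕 f) :=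
    VectorFourier.fourierIntegral_continuous Real.continuous_fourierChar
      (by simp; fun_prop) hf
  have h : 𝓕⁻ f = fun x => 𝓕 f (-x) := by
    funext x; exact Real.fourierInv_eq_fourier_neg f x
  rw [h]; exact this.comp continuous_neg

open FourierTransform in
-- Both sides define the same tempered distribution: each is tested against Schwartz functions and
-- the transform is moved to the test function.
theorem coeFn_fourierInvL2 {f : L2} (hf : Integrable f) :
    fourierInvL2 f =ᵐ[volume] 𝓕⁻ (f : ℝ → ℂ) := by
  refine ae_eq_of_integral_schwartz_smul_eq
    ((Lp.memLp _).locallyIntegrable (by norm_num))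
    (continuous_fourierInv_of_integrable hf).locallyIntegrable fun s => ?_
  have h := congrArg (fun d => d s) (Lp.fourierInv_toTemperedDistribution_eq f)
  rw [TemperedDistribution.fourierInv_apply, Lp.toTemperedDistribution_apply,
    Lp.toTemperedDistribution_apply] at h
  change _ = ∫ x, s x • (fourierInvL2 f) x at h
  rw [← h, ← integral_fourierInv_smul_eq_of_integrable s.integrable hf, SchwartzMap.fourierInv_coe]

open FourierTransform in
theorem coeFn_fourierInvL2_symm {f : L2} (hf : Integrable f) :
    fourierInvL2.symm f =ᵐ[volume] 𝓕 (f : ℝ → ℂ) := by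
  refine ae_eq_of_integral_schwartz_smul_eq
    ((Lp.memLp _).locallyIntegrable (by norm_num))
    (VectorFourier.fourierIntegral_continuous Real.continuous_fourierChar
      (by simp; fun_prop) hf).locallyIntegrable fun s => ?_
  have h := congrArg (fun d => d s) (Lp.fourier_toTemperedDistribution_eq f)
  rw [TemperedDistribution.fourier_apply, Lp.toTemperedDistribution_apply,
    Lp.toTemperedDistribution_apply] at h
  change _ = ∫ x, s x • (fourierInvL2.symm f) x at h
  rw [← h, ← integral_fourier_smul_eq_of_integrable s.integrable hf, SchwartzMap.fourier_coe]

/-! ### Calculus in `H²(ℝ ∖ {0})` -/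

theorem intervalIntegrable_of_memLp_two {f : ℝ → ℂ} (hf : MemLp f 2 volume) (a b : ℝ) :
    IntervalIntegrable f volume a b :=
  ((hf.locallyIntegrable (by norm_num)).integrableOn_isCompact isCompact_uIcc).intervalIntegrable

theorem intervalIntegrable_coeFn (w : L2) (a b : ℝ) : IntervalIntegrable w volume a b :=
  intervalIntegrable_of_memLp_two (Lp.memLp w) a b

theorem intervalIntegral_congr_ae_eq {f g : ℝ → ℂ} (h : f =ᵐ[volume] g) (a b : ℝ) :
    ∫ y in a..b, f y = ∫ y in a..b, g y :=
  intervalIntegral.integral_congr_ae (h.mono fun _ hx _ => hx)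

namespace HasSecondDeriv

variable {ψ w ψ' w' : L2} {up um vp vm up' um' vp' vm' : ℂ}

theorem add (h : HasSecondDeriv ψ w up um vp vm) (h' : HasSecondDeriv ψ' w' up' um' vp' vm') :
    HasSecondDeriv (ψ + ψ') (w + w') (up + up') (um + um') (vp + vp') (vm + vm') := by
  obtain ⟨u, v, hu, hv, h1, h2, h3, h4⟩ := h
  obtain ⟨u', v', hu', hv', h1', h2', h3', h4'⟩ := h'
  have e : ∀ x : ℝ, ∫ y in (0 : ℝ)..x, (v + v') y
      = (∫ y in (0 : ℝ)..x, v y) + ∫ y in (0 : ℝ)..x, v' y := fun x =>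
    intervalIntegral.integral_add (intervalIntegrable_of_memLp_two hv _ _)
      (intervalIntegrable_of_memLp_two hv' _ _)
  have e' : ∀ x : ℝ, ∫ y in (0 : ℝ)..x, (w + w' : L2) y
      = (∫ y in (0 : ℝ)..x, w y) + ∫ y in (0 : ℝ)..x, w' y := fun x => by
    rw [intervalIntegral_congr_ae_eq (Lp.coeFn_add w w')]
    exact intervalIntegral.integral_add (intervalIntegrable_coeFn w _ _)
      (intervalIntegrable_coeFn w' _ _)
  refine ⟨u + u', v + v', (Lp.coeFn_add ψ ψ').trans (hu.add hu'), hv.add hv', ?_, ?_, ?_, ?_⟩ <;>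
    intro x hx
  · rw [e, Pi.add_apply, h1 x hx, h1' x hx]; ring
  · rw [e, Pi.add_apply, h2 x hx, h2' x hx]; ring
  · rw [e', Pi.add_apply, h3 x hx, h3' x hx]; ring
  · rw [e', Pi.add_apply, h4 x hx, h4' x hx]; ring

theorem smul (c : ℂ) (h : HasSecondDeriv ψ w up um vp vm) :
    HasSecondDeriv (c • ψ) (c • w) (c * up) (c * um) (c * vp) (c * vm) := by
  obtain ⟨u, v, hu, hv, h1, h2, h3, h4⟩ := h
  have e : ∀ x : ℝ, ∫ y in (0 : ℝ)..x, (c • v) y = c * ∫ y in (0 : ℝ)..x, v y := fun x =>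
    intervalIntegral.integral_const_mul _ _
  have e' : ∀ x : ℝ, ∫ y in (0 : ℝ)..x, (c • w : L2) y = c * ∫ y in (0 : ℝ)..x, w y := fun x => by
    rw [intervalIntegral_congr_ae_eq (Lp.coeFn_smul c w)]
    exact intervalIntegral.integral_const_mul _ _
  refine ⟨c • u, c • v, (Lp.coeFn_smul c ψ).trans (hu.const_smul c), hv.const_smul c,
    ?_, ?_, ?_, ?_⟩ <;> intro x hx
  · rw [e, Pi.smul_apply, smul_eq_mul, h1 x hx]; ring
  · rw [e, Pi.smul_apply, smul_eq_mul, h2 x hx]; ring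
  · rw [e', Pi.smul_apply, smul_eq_mul, h3 x hx]; ring
  · rw [e', Pi.smul_apply, smul_eq_mul, h4 x hx]; ring

theorem comp_parity (h : HasSecondDeriv ψ w up um vp vm) :
    HasSecondDeriv (parity ψ) (parity w) um up (-vm) (-vp) := by
  obtain ⟨u, v, hu, hv, h1, h2, h3, h4⟩ := h
  have e : ∀ (f : ℝ → ℂ) (x : ℝ), ∫ y in (0 : ℝ)..x, f (-y) = -∫ y in (0 : ℝ)..(-x), f y := by
    intro f x
    rw [intervalIntegral.integral_comp_neg, neg_zero, intervalIntegral.integral_symm]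
  have ev : ∀ x : ℝ, ∫ y in (0 : ℝ)..x, -v (-y) = ∫ y in (0 : ℝ)..(-x), v y := fun x => by
    rw [intervalIntegral.integral_neg, e, neg_neg]
  have ew : ∀ x : ℝ, ∫ y in (0 : ℝ)..x, (parity w) y = -∫ y in (0 : ℝ)..(-x), w y := fun x => by
    rw [intervalIntegral_congr_ae_eq (coeFn_parity w), e]
  refine ⟨fun x => u (-x), fun x => -v (-x), ?_,
    (hv.comp_measurePreserving (Measure.measurePreserving_neg volume)).neg, ?_, ?_, ?_, ?_⟩
  · filter_upwards [coeFn_parity ψ, ae_comp_neg hu] with x hx hx'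
    rw [hx, hx']
  · intro x hx
    beta_reduce
    rw [h2 (-x) (by linarith), ev]
  · intro x hx
    beta_reduce
    rw [h1 (-x) (by linarith), ev]
  · intro x hx
    beta_reduce
    rw [h4 (-x) (by linarith), ew]; ring
  · intro x hx
    beta_reduce
    rw [h3 (-x) (by linarith), ew]; ring

theorem intervalIntegral_indicator_Ioi_of_pos (f : ℝ → ℂ) {x : ℝ} (hx : 0 < x) :
    ∫ y in (0 : ℝ)..x, (Set.Ioi (0 : ℝ)).indicator f y = ∫ y in (0 : ℝ)..x, f y := by
  refine intervalIntegral.integral_congr_ae (Filter.Eventually.of_forall fun y hy => ?_)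
  rw [Set.uIoc_of_le hx.le] at hy
  exact Set.indicator_of_mem (Set.mem_Ioi.2 hy.1) _

theorem intervalIntegral_indicator_Ioi_of_neg (f : ℝ → ℂ) {x : ℝ} (hx : x < 0) :
    ∫ y in (0 : ℝ)..x, (Set.Ioi (0 : ℝ)).indicator f y = 0 := by
  rw [intervalIntegral.integral_symm, neg_eq_zero]
  refine intervalIntegral.integral_zero_ae (Filter.Eventually.of_forall fun y hy => ?_)
  rw [Set.uIoc_of_le hx.le] at hy
  exact Set.indicator_of_notMem (by simpa using hy.2) _

theorem cutPos (h : HasSecondDeriv ψ w up um vp vm) :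
    HasSecondDeriv (cutPos ψ) (cutPos w) up 0 vp 0 := by
  obtain ⟨u, v, hu, hv, h1, h2, h3, h4⟩ := h
  have ew : ∀ x : ℝ, ∫ y in (0 : ℝ)..x, (DeltaPrime.cutPos w) y
      = ∫ y in (0 : ℝ)..x, (Set.Ioi (0 : ℝ)).indicator w y := fun x =>
    intervalIntegral_congr_ae_eq (coeFn_cut measurableSet_Ioi w) _ _
  refine ⟨(Set.Ioi 0).indicator u, (Set.Ioi 0).indicator v, ?_, hv.indicator measurableSet_Ioi,
    ?_, ?_, ?_, ?_⟩
  · filter_upwards [coeFn_cut measurableSet_Ioi ψ, hu] with x hx hx'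
    rw [DeltaPrime.cutPos, hx]
    by_cases h : x ∈ Set.Ioi (0 : ℝ) <;> simp [h, hx']
  · intro x hx
    rw [intervalIntegral_indicator_Ioi_of_pos v hx, Set.indicator_of_mem (Set.mem_Ioi.2 hx), h1 x hx]
  · intro x hx
    rw [intervalIntegral_indicator_Ioi_of_neg v hx,
      Set.indicator_of_notMem (by simpa using hx.le), zero_add]
  · intro x hx
    rw [ew, intervalIntegral_indicator_Ioi_of_pos w hx, Set.indicator_of_mem (Set.mem_Ioi.2 hx),
      h3 x hx]
  · intro x hx
    rw [ew, intervalIntegral_indicator_Ioi_of_neg w hx,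
      Set.indicator_of_notMem (by simpa using hx.le), zero_add]

theorem cutNeg (h : HasSecondDeriv ψ w up um vp vm) :
    HasSecondDeriv (cutNeg ψ) (cutNeg w) 0 um 0 vm := by
  have := h.comp_parity.cutPos.comp_parity
  rw [cutPos_parity, cutPos_parity, parity_parity, parity_parity] at this
  simpa using this

end HasSecondDeriv

/-! ### Green's identity and uniqueness of the second derivative -/

/-- Product rule for primitives of integrable functions. -/
theorem integral_mul_add_mul_of_primitive {f g F G : ℝ → ℝ} {A B X : ℝ}
    (hf : IntervalIntegrable f volume 0 X) (hg : IntervalIntegrable g volume 0 X)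
    (hF : ∀ x, F x = A + ∫ y in (0 : ℝ)..x, f y) (hG : ∀ x, G x = B + ∫ y in (0 : ℝ)..x, g y) :
    ∫ x in (0 : ℝ)..X, (f x * G x + F x * g x) = F X * G X - A * B := by
  have ac : ∀ {f F : ℝ → ℝ} {A : ℝ}, IntervalIntegrable f volume 0 X →
      (∀ x, F x = A + ∫ y in (0 : ℝ)..x, f y) → AbsolutelyContinuousOnInterval F 0 X := by
    intro f F A hf hF
    have h1 := hf.absolutelyContinuousOnInterval_intervalIntegral (c := 0) (by simp)
    have h2 : AbsolutelyContinuousOnInterval (fun _ : ℝ => A) 0 X :=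
      ((LipschitzWith.const A).lipschitzOnWith (s := Set.uIcc 0 X)).absolutelyContinuousOnInterval
    have e : F = (fun _ : ℝ => A) + fun x => ∫ y in (0 : ℝ)..x, f y := by
      funext x; exact hF x
    rw [e]; exact h2.add h1
  have der : ∀ {f F : ℝ → ℝ} {A : ℝ}, IntervalIntegrable f volume 0 X →
      (∀ x, F x = A + ∫ y in (0 : ℝ)..x, f y) → ∀ᵐ x, x ∈ Set.uIcc 0 X → deriv F x = f x := by
    intro f F A hf hF
    filter_upwards [hf.ae_hasDerivAt_integral] with x hx hx'
    have h := (hx hx' 0 (by simp)).const_add A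
    have e : F = fun x => A + ∫ y in (0 : ℝ)..x, f y := by
      funext x; exact hF x
    rw [e]; exact h.deriv
  have key := (ac hf hF).integral_deriv_mul_eq_sub (ac hg hG)
  have hF0 : F 0 = A := by rw [hF]; simp
  have hG0 : G 0 = B := by rw [hG]; simp
  rw [hF0, hG0] at key
  rw [← key]
  refine intervalIntegral.integral_congr_ae ?_
  filter_upwards [der hf hF, der hg hG] with x h1 h2 hx
  have hx' := Set.uIoc_subset_uIcc hx
  rw [h1 hx', h2 hx']

theorem eq_zero_of_tendsto_of_integrableOn_Ioi {F : ℝ → ℝ} {l : ℝ}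
    (hF : IntegrableOn F (Set.Ioi 0)) (hl : Filter.Tendsto F Filter.atTop (nhds l)) : l = 0 := by
  by_contra hne
  have hpos : 0 < |l| / 2 := by positivity
  have hev : ∀ᶠ x in Filter.atTop, |l| / 2 ≤ |F x| :=
    hl.abs.eventually_const_le (by linarith [abs_pos.2 hne])
  obtain ⟨N, hN⟩ := Filter.eventually_atTop.1 hev
  have h1 : IntegrableOn F (Set.Ioi (max N 0)) :=
    hF.mono_set (Set.Ioi_subset_Ioi (le_max_right _ _))
  have h2 : IntegrableOn (fun _ : ℝ => |l| / 2) (Set.Ioi (max N 0)) := by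
    refine Integrable.mono h1 aestronglyMeasurable_const ?_
    filter_upwards [ae_restrict_mem measurableSet_Ioi] with x hx
    rw [Real.norm_eq_abs, abs_of_pos hpos, Real.norm_eq_abs]
    exact hN x ((le_max_left _ _).trans (le_of_lt hx))
  rw [integrableOn_const_iff (by finiteness)] at h2
  simp [hpos.ne'] at h2

theorem memLp_two_mul_integrable {f g : ℝ → ℂ} {s : Set ℝ} (hf : MemLp f 2 (volume.restrict s))
    (hg : MemLp g 2 (volume.restrict s)) :
    IntegrableOn (fun x => (starRingEnd ℂ (f x)) * g x) s := by
  have h := hf.star.integrable_mul hg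
  exact h

/-- Green's identity on the positive half-line. -/
theorem integral_Ioi_im_conj_mul {u v w : ℝ → ℂ} {a b : ℂ} (hu : MemLp u 2 volume)
    (hv : MemLp v 2 volume) (hw : MemLp w 2 volume)
    (h1 : ∀ x : ℝ, 0 < x → u x = a + ∫ y in (0 : ℝ)..x, v y)
    (h2 : ∀ x : ℝ, 0 < x → v x = b + ∫ y in (0 : ℝ)..x, w y) :
    ∫ x in Set.Ioi (0 : ℝ), (starRingEnd ℂ (u x) * w x).im = -(starRingEnd ℂ a * b).im := by
  have iv := intervalIntegrable_of_memLp_two hv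
  have iw := intervalIntegrable_of_memLp_two hw
  have re_int : ∀ {f : ℝ → ℂ} {a b : ℝ}, IntervalIntegrable f volume a b →
      IntervalIntegrable (fun x => (f x).re) volume a b := fun h => ⟨h.1.re, h.2.re⟩
  have im_int : ∀ {f : ℝ → ℂ} {a b : ℝ}, IntervalIntegrable f volume a b →
      IntervalIntegrable (fun x => (f x).im) volume a b := fun h => ⟨h.1.im, h.2.im⟩
  have re_eq : ∀ {f : ℝ → ℂ} {a b : ℝ}, IntervalIntegrable f volume a b →
      (∫ y in a..b, f y).re = ∫ y in a..b, (f y).re := fun h =>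
    (Complex.reCLM.intervalIntegral_comp_comm h).symm
  have im_eq : ∀ {f : ℝ → ℂ} {a b : ℝ}, IntervalIntegrable f volume a b →
      (∫ y in a..b, f y).im = ∫ y in a..b, (f y).im := fun h =>
    (Complex.imCLM.intervalIntegral_comp_comm h).symm
  have key : ∀ X : ℝ, 0 < X → ∫ x in (0 : ℝ)..X, (starRingEnd ℂ (u x) * w x).im
      = (starRingEnd ℂ (u X) * v X).im - (starRingEnd ℂ a * b).im := by
    intro X hX
    -- The imaginary part of `conj u * w` is `Re u Im w - Im u Re w`; each product is integrated by
    -- parts separately, and the terms in `v` cancel in the difference.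
    have p1 := integral_mul_add_mul_of_primitive (F := fun x => a.re + ∫ y in (0 : ℝ)..x, (v y).re)
      (G := fun x => b.im + ∫ y in (0 : ℝ)..x, (w y).im) (X := X)
      (re_int (iv 0 X)) (im_int (iw 0 X)) (fun _ => rfl) (fun _ => rfl)
    have p2 := integral_mul_add_mul_of_primitive (F := fun x => a.im + ∫ y in (0 : ℝ)..x, (v y).im)
      (G := fun x => b.re + ∫ y in (0 : ℝ)..x, (w y).re) (X := X)
      (im_int (iv 0 X)) (re_int (iw 0 X)) (fun _ => rfl) (fun _ => rfl)
    have ur : ∀ x, 0 < x → a.re + ∫ y in (0 : ℝ)..x, (v y).re = (u x).re := fun x hx => by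
      rw [h1 x hx, add_re, re_eq (iv _ _)]
    have ui : ∀ x, 0 < x → a.im + ∫ y in (0 : ℝ)..x, (v y).im = (u x).im := fun x hx => by
      rw [h1 x hx, add_im, im_eq (iv _ _)]
    have vr : ∀ x, 0 < x → b.re + ∫ y in (0 : ℝ)..x, (w y).re = (v x).re := fun x hx => by
      rw [h2 x hx, add_re, re_eq (iw _ _)]
    have vi : ∀ x, 0 < x → b.im + ∫ y in (0 : ℝ)..x, (w y).im = (v x).im := fun x hx => by
      rw [h2 x hx, add_im, im_eq (iw _ _)]
    have cont : ∀ {f : ℝ → ℝ} (c : ℝ), IntervalIntegrable f volume 0 X →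
        ContinuousOn (fun x => c + ∫ y in (0 : ℝ)..x, f y) (Set.uIcc 0 X) := fun c hf =>
      continuousOn_const.add (intervalIntegral.continuousOn_primitive_interval'
        hf (by simp))
    have i1 : IntervalIntegrable (fun x => (v x).re * (b.im + ∫ y in (0 : ℝ)..x, (w y).im)
        + (a.re + ∫ y in (0 : ℝ)..x, (v y).re) * (w x).im) volume 0 X :=
      ((re_int (iv 0 X)).mul_continuousOn (cont _ (im_int (iw 0 X)))).add
        ((im_int (iw 0 X)).continuousOn_mul (cont _ (re_int (iv 0 X))))
    have i2 : IntervalIntegrable (fun x => (v x).im * (b.re + ∫ y in (0 : ℝ)..x, (w y).re)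
        + (a.im + ∫ y in (0 : ℝ)..x, (v y).im) * (w x).re) volume 0 X :=
      ((im_int (iv 0 X)).mul_continuousOn (cont _ (re_int (iw 0 X)))).add
        ((re_int (iw 0 X)).continuousOn_mul (cont _ (im_int (iv 0 X))))
    have p3 := intervalIntegral.integral_sub i1 i2
    rw [p1, p2] at p3
    simp only [ur X hX, ui X hX, vr X hX, vi X hX] at p3
    have e : ∫ x in (0 : ℝ)..X, (starRingEnd ℂ (u x) * w x).im
        = ∫ x in (0 : ℝ)..X, ((v x).re * (b.im + ∫ y in (0 : ℝ)..x, (w y).im)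
        + (a.re + ∫ y in (0 : ℝ)..x, (v y).re) * (w x).im
        - ((v x).im * (b.re + ∫ y in (0 : ℝ)..x, (w y).re)
        + (a.im + ∫ y in (0 : ℝ)..x, (v y).im) * (w x).re)) := by
      refine intervalIntegral.integral_congr_ae (Filter.Eventually.of_forall fun x hx => ?_)
      rw [Set.uIoc_of_le hX.le] at hx
      rw [ur x hx.1, ui x hx.1, vr x hx.1, vi x hx.1]
      simp only [mul_im, conj_re, conj_im]
      ring
    rw [e, p3]
    simp only [mul_im, conj_re, conj_im]
    ring
  have int1 : IntegrableOn (fun x => (starRingEnd ℂ (u x) * w x).im) (Set.Ioi 0) :=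
    (memLp_two_mul_integrable (hu.restrict _) (hw.restrict _)).im
  have int2 : IntegrableOn (fun x => (starRingEnd ℂ (u x) * v x).im) (Set.Ioi 0) :=
    (memLp_two_mul_integrable (hu.restrict _) (hv.restrict _)).im
  have t1 := intervalIntegral_tendsto_integral_Ioi 0 int1 Filter.tendsto_id
  -- The boundary term at infinity has a limit because the other terms of `key` do; being integrable
  -- on the half-line, it can only tend to zero.
  have t2 : Filter.Tendsto (fun X => (starRingEnd ℂ (u X) * v X).im) Filter.atTop
      (nhds ((∫ x in Set.Ioi (0 : ℝ), (starRingEnd ℂ (u x) * w x).im)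
        + (starRingEnd ℂ a * b).im)) := by
    refine (t1.add_const _).congr' ?_
    filter_upwards [Filter.eventually_gt_atTop 0] with X hX
    rw [id, key X hX]; ring
  have := eq_zero_of_tendsto_of_integrableOn_Ioi int2 t2
  linarith

theorem inner_eq_integral (f g : L2) :
    inner ℂ f g = ∫ x : ℝ, (starRingEnd ℂ (f x)) * g x := by
  rw [L2.inner_def]
  simp only [RCLike.inner_apply, mul_comm]

namespace HasSecondDeriv

variable {ψ w : L2} {up um vp vm : ℂ}

theorem im_inner_cutPos (h : HasSecondDeriv ψ w up um vp vm) :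
    ∫ x in Set.Ioi (0 : ℝ), (starRingEnd ℂ (ψ x) * w x).im = -(starRingEnd ℂ up * vp).im := by
  obtain ⟨u, v, hu, hv, h1, h2, h3, h4⟩ := h
  rw [← integral_Ioi_im_conj_mul ((memLp_congr_ae hu).1 (Lp.memLp ψ)) hv (Lp.memLp w) h1 h3]
  refine integral_congr_ae (ae_restrict_of_ae ?_)
  filter_upwards [hu] with x hx
  rw [hx]

theorem im_inner (h : HasSecondDeriv ψ w up um vp vm) :
    (inner ℂ ψ w).im = (starRingEnd ℂ um * vm).im - (starRingEnd ℂ up * vp).im := by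
  have hint : Integrable (fun x => (starRingEnd ℂ (ψ x)) * w x) :=
    by simpa using memLp_two_mul_integrable (s := Set.univ) ((Lp.memLp ψ).restrict _)
        ((Lp.memLp w).restrict _)
  have e : (inner ℂ ψ w).im = ∫ x : ℝ, (starRingEnd ℂ (ψ x) * w x).im := by
    rw [inner_eq_integral]
    exact (Complex.imCLM.integral_comp_comm hint).symm
  have hp := h.im_inner_cutPos
  have hn := h.comp_parity.im_inner_cutPos
  have hn' : ∫ x in Set.Ioi (0 : ℝ), (starRingEnd ℂ (parity ψ x) * parity w x).im
      = ∫ x in Set.Iic (0 : ℝ), (starRingEnd ℂ (ψ x) * w x).im := by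
    rw [← neg_zero, ← integral_comp_neg_Ioi, neg_zero]
    refine integral_congr_ae (ae_restrict_of_ae ?_)
    filter_upwards [coeFn_parity ψ, coeFn_parity w] with x h1 h2
    rw [h1, h2]
  rw [hn'] at hn
  have him : Integrable (fun x => (starRingEnd ℂ (ψ x) * w x).im) := hint.im
  rw [e, ← intervalIntegral.integral_Iic_add_Ioi him.integrableOn him.integrableOn (b := 0)]
  rw [hn, hp]
  simp
  ring

end HasSecondDeriv

/-- A locally integrable function whose primitive vanishes on a half-line vanishes there. -/
theorem ae_eq_zero_of_primitive {f : ℝ → ℂ} (hf : LocallyIntegrable f) {c : ℂ}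
    (h : ∀ᵐ x : ℝ, 0 < x → c + ∫ y in (0 : ℝ)..x, f y = 0) : ∀ᵐ x : ℝ, 0 < x → f x = 0 := by
  set F : ℝ → ℂ := fun x => c + ∫ y in (0 : ℝ)..x, f y with hF
  have hc : Continuous F := continuous_const.add
    (intervalIntegral.continuous_primitive
      (fun a b => (hf.integrableOn_isCompact isCompact_uIcc).intervalIntegrable) 0)
  have h0 : Set.EqOn F (fun _ => 0) (Set.Ioi 0) := by
    refine Measure.eqOn_open_of_ae_eq (μ := volume) ?_ isOpen_Ioi hc.continuousOn
      continuousOn_const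
    exact (ae_restrict_iff' measurableSet_Ioi).2 h
  filter_upwards [LocallyIntegrable.ae_hasDerivAt_integral hf] with x hx hx0
  have h1 : HasDerivAt F (f x) x := (hx 0).const_add c
  have h2 : HasDerivAt F 0 x := by
    refine (hasDerivAt_const x (0 : ℂ)).congr_of_eventuallyEq ?_
    filter_upwards [Ioi_mem_nhds hx0] with y hy using h0 hy
  exact h1.unique h2

theorem locallyIntegrable_of_memLp_two {f : ℝ → ℂ} (hf : MemLp f 2 volume) :
    LocallyIntegrable f := hf.locallyIntegrable (by norm_num)

namespace HasSecondDeriv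

variable {w : L2} {up um vp vm : ℂ}

theorem cutPos_eq_zero (h : HasSecondDeriv 0 w up um vp vm) : DeltaPrime.cutPos w = 0 := by
  obtain ⟨u, v, hu, hv, h1, h2, h3, h4⟩ := h
  have hv0 : ∀ᵐ x : ℝ, 0 < x → v x = 0 := by
    refine ae_eq_zero_of_primitive (locallyIntegrable_of_memLp_two hv) (c := up) ?_
    filter_upwards [hu, Lp.coeFn_zero ℂ 2 (volume : Measure ℝ)] with x hx hx' hpos
    rw [← h1 x hpos, ← hx, hx', Pi.zero_apply]
  have hw0 : ∀ᵐ x : ℝ, 0 < x → w x = 0 := by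
    refine ae_eq_zero_of_primitive (locallyIntegrable_of_memLp_two (Lp.memLp w)) (c := vp) ?_
    filter_upwards [hv0] with x hx hpos
    rw [← h3 x hpos, hx hpos]
  apply Lp.ext
  filter_upwards [coeFn_cut measurableSet_Ioi w, hw0, Lp.coeFn_zero ℂ 2 (volume : Measure ℝ)]
    with x hx hx' hz
  rw [DeltaPrime.cutPos, hx, hz]
  by_cases hpos : 0 < x
  · simp [hpos, hx' hpos]
  · simp [hpos]

theorem eq_zero (h : HasSecondDeriv 0 w up um vp vm) : w = 0 := by
  have h1 := h.cutPos_eq_zero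
  have h2 := h.comp_parity
  rw [map_zero] at h2
  have h3 := h2.cutPos_eq_zero
  rw [cutPos_parity] at h3
  have h4 : DeltaPrime.cutNeg w = 0 := by
    rw [← parity_parity (DeltaPrime.cutNeg w), h3, map_zero]
  rw [← cutPos_add_cutNeg w, h1, h4, add_zero]

end HasSecondDeriv

/-! ### Fourier representation -/

section Fourier

open FourierTransform

theorem fourierInv_eq_integral_cexp (f : ℝ → ℂ) (x : ℝ) :
    𝓕⁻ f x = ∫ k : ℝ, cexp (2 * Real.pi * k * x * I) * f k := by
  rw [Real.fourierInv_eq']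
  refine integral_congr_ae (Filter.Eventually.of_forall fun k => ?_)
  simp only [smul_eq_mul]
  congr 2
  simp
  ring

theorem integrable_cexp_mul {f : ℝ → ℂ} (hf : Integrable f) (x : ℝ) :
    Integrable fun k : ℝ => cexp (2 * Real.pi * k * x * I) * f k := by
  refine hf.bdd_mul (c := 1) (by fun_prop) (Filter.Eventually.of_forall fun k => ?_)
  have : (2 * Real.pi * k * x * I : ℂ) = ((2 * Real.pi * k * x : ℝ) : ℂ) * I := by push_cast; ring
  rw [this, norm_exp_ofReal_mul_I]

theorem conj_integral_cexp_mul (a b k : ℝ) :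
    (starRingEnd ℂ) (∫ y in a..b, cexp (-(2 * Real.pi * y * k) * I)) * (2 * Real.pi * k * I)
      = cexp (2 * Real.pi * k * b * I) - cexp (2 * Real.pi * k * a * I) := by
  rcases eq_or_ne k 0 with rfl | hk
  · simp
  have hc : (-(2 * Real.pi * k * I) : ℂ) ≠ 0 := by
    have : (Real.pi : ℂ) ≠ 0 := by exact_mod_cast Real.pi_ne_zero
    have : (k : ℂ) ≠ 0 := by exact_mod_cast hk
    simp [*]
  have e : ∀ y : ℝ, cexp (-(2 * Real.pi * y * k) * I) = cexp (-(2 * Real.pi * k * I) * y) :=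
    fun y => by congr 1; ring
  simp only [e]
  rw [integral_exp_mul_complex hc, map_div₀, map_sub, ← exp_conj, ← exp_conj]
  simp only [map_mul, map_neg, conj_I, conj_ofReal, map_ofNat]
  have e1 : ∀ y : ℝ, -(2 * Real.pi * k * -I : ℂ) * y = 2 * Real.pi * k * y * I := fun y => by ring
  rw [e1, e1]
  have : (-(2 * Real.pi * k * -I) : ℂ) = 2 * Real.pi * k * I := by ring
  rw [this, div_mul_cancel₀]
  simpa using hc

theorem coeFn_fourierInvL2_symm_indicator (a b : ℝ) (hab : a ≤ b) :
    fourierInvL2.symm (indicatorConstLp 2 (measurableSet_Ioc (a := a) (b := b))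
      (by simp) (1 : ℂ)) =ᵐ[volume]
      fun k : ℝ => ∫ y in a..b, cexp (-(2 * Real.pi * y * k) * I) := by
  set f : L2 := indicatorConstLp 2 (measurableSet_Ioc (a := a) (b := b)) (by simp) (1 : ℂ)
  have hf : f =ᵐ[volume] (Set.Ioc a b).indicator fun _ => 1 := indicatorConstLp_coeFn
  have hint : Integrable f := by
    refine Integrable.congr ?_ hf.symm
    exact (integrable_indicator_iff measurableSet_Ioc).2 (by simp)
  refine (coeFn_fourierInvL2_symm hint).trans (Filter.Eventually.of_forall fun k => ?_)
  beta_reduce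
  rw [Real.fourier_eq', intervalIntegral.integral_of_le hab,
    ← integral_indicator measurableSet_Ioc]
  refine integral_congr_ae ?_
  filter_upwards [hf] with y hy
  rw [hy]
  by_cases h : y ∈ Set.Ioc a b
  · simp only [h, Set.indicator_of_mem, smul_eq_mul, mul_one]
    congr 1
    simp
    ring
  · simp [h]

/-- `g` need not be integrable, so its inverse transform is not given by an integral. Plancherel
against the indicator of `(a, b]` avoids this: the transform of the indicator, multiplied by `2πik`,
is a difference of exponentials, which may be paired with the integrable `f`. -/
theorem integral_fourierInvL2_of_le {f g : L2} (hf : Integrable f)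
    (hg : g =ᵐ[volume] fun k : ℝ => 2 * Real.pi * k * I * f k) {a b : ℝ} (hab : a ≤ b) :
    ∫ y in a..b, fourierInvL2 g y = 𝓕⁻ (f : ℝ → ℂ) b - 𝓕⁻ (f : ℝ → ℂ) a := by
  have h1 := L2.inner_indicatorConstLp_eq_inner_setIntegral (𝕜 := ℂ) (μ := (volume : Measure ℝ))
    (measurableSet_Ioc (a := a) (b := b)) (by simp) (1 : ℂ) (fourierInvL2 g)
  rw [intervalIntegral.integral_of_le hab]
  have h2 : inner ℂ (1 : ℂ) (∫ y in Set.Ioc a b, fourierInvL2 g y)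
      = ∫ y in Set.Ioc a b, fourierInvL2 g y := by simp
  rw [← h2, ← h1, ← LinearIsometryEquiv.inner_map_map fourierInvL2.symm,
    LinearIsometryEquiv.symm_apply_apply, inner_eq_integral, fourierInv_eq_integral_cexp,
    fourierInv_eq_integral_cexp, ← integral_sub (integrable_cexp_mul hf b)
      (integrable_cexp_mul hf a)]
  refine integral_congr_ae ?_
  filter_upwards [coeFn_fourierInvL2_symm_indicator a b hab, hg] with k h3 h4
  rw [h3, h4, ← mul_assoc, conj_integral_cexp_mul, sub_mul]

theorem fourierInv_eq_add_integral {f g : L2} (hf : Integrable f)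
    (hg : g =ᵐ[volume] fun k : ℝ => 2 * Real.pi * k * I * f k) (x : ℝ) :
    𝓕⁻ (f : ℝ → ℂ) x = 𝓕⁻ (f : ℝ → ℂ) 0 + ∫ y in (0 : ℝ)..x, fourierInvL2 g y := by
  rcases le_total 0 x with h | h
  · rw [integral_fourierInvL2_of_le hf hg h]; ring
  · rw [intervalIntegral.integral_symm, integral_fourierInvL2_of_le hf hg h]; ring

theorem memLp_inv_one_add_sq : MemLp (fun k : ℝ => (1 / (1 + (2 * Real.pi * k) ^ 2) : ℂ)) 2 volume := by
  have hc : Continuous (fun k : ℝ => (1 / (1 + (2 * Real.pi * k) ^ 2) : ℂ)) := by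
    refine continuous_const.div (by fun_prop) fun k => ?_
    have : (1 + (2 * Real.pi * k) ^ 2 : ℝ) ≠ 0 := by positivity
    exact_mod_cast this
  rw [memLp_two_iff_integrable_sq_norm hc.aestronglyMeasurable]
  refine integrable_inv_one_add_sq.mono' (hc.norm.pow 2).aestronglyMeasurable (Filter.Eventually.of_forall fun k => ?_)
  have e : (1 / (1 + (2 * Real.pi * k) ^ 2) : ℂ) = ((1 / (1 + (2 * Real.pi * k) ^ 2) : ℝ) : ℂ) := by
    push_cast; ring
  have hy : k ^ 2 ≤ (2 * Real.pi * k) ^ 2 := by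
    rw [mul_pow]
    exact le_mul_of_one_le_left (sq_nonneg k) (by nlinarith [Real.pi_gt_three])
  rw [e, norm_real, Real.norm_eq_abs, abs_of_nonneg (by positivity), Real.norm_eq_abs,
    abs_of_nonneg (by positivity), one_div]
  calc ((1 + (2 * Real.pi * k) ^ 2)⁻¹) ^ 2 ≤ (1 + (2 * Real.pi * k) ^ 2)⁻¹ := by
        refine pow_le_of_le_one (by positivity) ?_ (by norm_num)
        exact inv_le_one_of_one_le₀ (by nlinarith [sq_nonneg (2 * Real.pi * k)])
    _ ≤ (1 + k ^ 2)⁻¹ := by gcongr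

theorem memLp_mul_inv_one_add_sq :
    MemLp (fun k : ℝ => (2 * Real.pi * k * I / (1 + (2 * Real.pi * k) ^ 2) : ℂ)) 2 volume := by
  have hc : Continuous (fun k : ℝ => (2 * Real.pi * k * I / (1 + (2 * Real.pi * k) ^ 2) : ℂ)) := by
    refine Continuous.div (by fun_prop) (by fun_prop) fun k => ?_
    have : (1 + (2 * Real.pi * k) ^ 2 : ℝ) ≠ 0 := by positivity
    exact_mod_cast this
  rw [memLp_two_iff_integrable_sq_norm hc.aestronglyMeasurable]
  refine integrable_inv_one_add_sq.mono' (hc.norm.pow 2).aestronglyMeasurable (Filter.Eventually.of_forall fun k => ?_)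
  have e : (2 * Real.pi * k * I / (1 + (2 * Real.pi * k) ^ 2) : ℂ)
      = ((2 * Real.pi * k / (1 + (2 * Real.pi * k) ^ 2) : ℝ) : ℂ) * I := by
    push_cast; ring
  have hy : k ^ 2 ≤ (2 * Real.pi * k) ^ 2 := by
    rw [mul_pow]
    exact le_mul_of_one_le_left (sq_nonneg k) (by nlinarith [Real.pi_gt_three])
  rw [e, norm_mul, norm_I, mul_one, norm_real, Real.norm_eq_abs, Real.norm_eq_abs, abs_sq, sq_abs,
    div_pow]
  calc (2 * Real.pi * k) ^ 2 / (1 + (2 * Real.pi * k) ^ 2) ^ 2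
      ≤ (1 + (2 * Real.pi * k) ^ 2) / (1 + (2 * Real.pi * k) ^ 2) ^ 2 := by
        gcongr; linarith
    _ = (1 + (2 * Real.pi * k) ^ 2)⁻¹ := by field_simp
    _ ≤ (1 + k ^ 2)⁻¹ := by gcongr

section

variable {f g : L2} (hg : g =ᵐ[volume] fun k : ℝ => -(2 * Real.pi * k : ℂ) ^ 2 * f k)

include hg

/-- Since `f - g = (1 + (2πk)²) f`, moments of `f` are obtained by multiplying the square integrable
`f - g` by an explicit weight. Both `1/(1 + (2πk)²)` and `2πik/(1 + (2πk)²)` are square integrable,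
hence the integrability lemmas below. -/
theorem ae_eq_mul_sub_of_sq_mul (c : ℝ → ℂ) :
    (fun k : ℝ => c k / (1 + (2 * Real.pi * k) ^ 2) * (f - g : L2) k)
      =ᵐ[volume] fun k => c k * f k := by
  filter_upwards [hg, Lp.coeFn_sub f g] with k h1 h2
  have : (1 + (2 * Real.pi * k) ^ 2 : ℂ) ≠ 0 := by
    have : (1 + (2 * Real.pi * k) ^ 2 : ℝ) ≠ 0 := by positivity
    exact_mod_cast this
  rw [h2, Pi.sub_apply, h1, div_mul_eq_mul_div, div_eq_iff this]
  ring

theorem integrable_of_sq_mul : Integrable f := by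
  have h := memLp_inv_one_add_sq.integrable_mul (Lp.memLp (f - g))
  refine h.congr ?_
  filter_upwards [ae_eq_mul_sub_of_sq_mul hg 1] with k h1
  simpa using h1

theorem integrable_mul_of_sq_mul : Integrable fun k : ℝ => 2 * Real.pi * k * I * f k := by
  have h := memLp_mul_inv_one_add_sq.integrable_mul (Lp.memLp (f - g))
  exact h.congr (ae_eq_mul_sub_of_sq_mul hg fun k => 2 * Real.pi * k * I)

theorem memLp_mul_of_sq_mul : MemLp (fun k : ℝ => 2 * Real.pi * k * I * f k) 2 volume := by
  have hm : IsMultiplier fun k : ℝ => (2 * Real.pi * k * I / (1 + (2 * Real.pi * k) ^ 2) : ℂ) := by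
    refine ⟨by fun_prop, 1, fun k => ?_⟩
    have e : (2 * Real.pi * k * I / (1 + (2 * Real.pi * k) ^ 2) : ℂ)
        = ((2 * Real.pi * k / (1 + (2 * Real.pi * k) ^ 2) : ℝ) : ℂ) * I := by
      push_cast; ring
    beta_reduce
    rw [e, norm_mul, norm_I, mul_one, norm_real, Real.norm_eq_abs, abs_div,
      abs_of_pos (by positivity : 0 < 1 + (2 * Real.pi * k) ^ 2), div_le_one (by positivity)]
    nlinarith [sq_abs (2 * Real.pi * k), sq_nonneg (|2 * Real.pi * k| - 1),
      abs_nonneg (2 * Real.pi * k)]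
  exact (memLp_congr_ae (ae_eq_mul_sub_of_sq_mul hg fun k => 2 * Real.pi * k * I)).1
    (hm.memLp_mul (f - g))

/-- Functions whose Fourier transform decays fast enough belong to `H²(ℝ)`. -/
theorem hasSecondDeriv_fourierInvL2 :
    HasSecondDeriv (fourierInvL2 f) (fourierInvL2 g) (∫ k, f k) (∫ k, f k)
      (∫ k : ℝ, 2 * Real.pi * k * I * f k) (∫ k : ℝ, 2 * Real.pi * k * I * f k) := by
  have i0 := integrable_of_sq_mul hg
  have i1 := integrable_mul_of_sq_mul hg
  have m1 := memLp_mul_of_sq_mul hg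
  set f1 : L2 := m1.toLp _ with hf1
  have e1 : f1 =ᵐ[volume] fun k : ℝ => 2 * Real.pi * k * I * f k := m1.coeFn_toLp
  have i1' : Integrable f1 := i1.congr e1.symm
  have e2 : g =ᵐ[volume] fun k : ℝ => 2 * Real.pi * k * I * f1 k := by
    filter_upwards [hg, e1] with k h1 h2
    rw [h1, h2]
    linear_combination (-(2 * Real.pi * k : ℂ) ^ 2 * f k) * I_sq
  have z : ∀ h : ℝ → ℂ, 𝓕⁻ h 0 = ∫ k, h k := fun h => by
    rw [fourierInv_eq_integral_cexp]; simp
  have z1 : 𝓕⁻ (f1 : ℝ → ℂ) 0 = ∫ k : ℝ, 2 * Real.pi * k * I * f k := by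
    rw [z]; exact integral_congr_ae e1
  have hv := coeFn_fourierInvL2 i1'
  have hu : ∀ x : ℝ, 𝓕⁻ (f : ℝ → ℂ) x = (∫ k, f k) + ∫ y in (0 : ℝ)..x, 𝓕⁻ (f1 : ℝ → ℂ) y := by
    intro x
    rw [fourierInv_eq_add_integral i0 e1, z, intervalIntegral_congr_ae_eq hv]
  have hw : ∀ x : ℝ, 𝓕⁻ (f1 : ℝ → ℂ) x = (∫ k : ℝ, 2 * Real.pi * k * I * f k)
      + ∫ y in (0 : ℝ)..x, fourierInvL2 g y := by
    intro x
    rw [fourierInv_eq_add_integral i1' e2, z1]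
  exact ⟨𝓕⁻ (f : ℝ → ℂ), 𝓕⁻ (f1 : ℝ → ℂ), coeFn_fourierInvL2 i0,
    (memLp_congr_ae hv).1 (Lp.memLp _), fun x _ => hu x, fun x _ => hu x, fun x _ => hw x,
    fun x _ => hw x⟩

end

end Fourier

/-! ### The resolvent of the Hamiltonian -/

section Exponential

variable {κ : ℂ} (hκ : 0 < κ.re)

include hκ

theorem memLp_indicator_exp :
    MemLp ((Set.Ioi (0 : ℝ)).indicator fun x : ℝ => cexp (-κ * x)) 2 volume := by
  have hc : Continuous fun x : ℝ => cexp (-κ * x) := by fun_prop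
  rw [memLp_indicator_iff_restrict measurableSet_Ioi,
    memLp_two_iff_integrable_sq_norm hc.aestronglyMeasurable]
  refine (exp_neg_integrableOn_Ioi 0 (by linarith : 0 < 2 * κ.re)).congr
    (Filter.Eventually.of_forall fun x => ?_)
  beta_reduce
  rw [norm_exp, ← Real.exp_nat_mul, re_mul_ofReal, neg_re]
  congr 1
  push_cast
  ring

/-- The function `e^{-κx}` on the positive half-line, extended by zero. -/
def expPos : L2 := (memLp_indicator_exp hκ).toLp _

theorem hasSecondDeriv_expPos :
    HasSecondDeriv (expPos hκ) (κ ^ 2 • expPos hκ) 1 0 (-κ) 0 := by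
  have h0 : κ ≠ 0 := fun h => by simp [h] at hκ
  have prim : ∀ x : ℝ, ∫ y in (0 : ℝ)..x, cexp (-κ * y) = (1 - cexp (-κ * x)) / κ := by
    intro x
    rw [integral_exp_mul_complex (neg_ne_zero.2 h0)]
    simp
    field_simp
    ring
  have hE : expPos hκ =ᵐ[volume] (Set.Ioi (0 : ℝ)).indicator fun x : ℝ => cexp (-κ * x) :=
    (memLp_indicator_exp hκ).coeFn_toLp
  have hw : (κ ^ 2 • expPos hκ : L2) =ᵐ[volume]
      fun y => κ ^ 2 * (Set.Ioi (0 : ℝ)).indicator (fun x : ℝ => cexp (-κ * x)) y := by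
    filter_upwards [Lp.coeFn_smul (κ ^ 2) (expPos hκ), hE] with x h1 h2
    rw [h1, Pi.smul_apply, h2, smul_eq_mul]
  refine ⟨(Set.Ioi (0 : ℝ)).indicator fun x : ℝ => cexp (-κ * x),
    fun y => -κ * (Set.Ioi (0 : ℝ)).indicator (fun x : ℝ => cexp (-κ * x)) y, hE,
    (memLp_indicator_exp hκ).const_mul (-κ), ?_, ?_, ?_, ?_⟩ <;> intro x hx
  · rw [intervalIntegral.integral_const_mul,
      HasSecondDeriv.intervalIntegral_indicator_Ioi_of_pos _ hx, prim,
      Set.indicator_of_mem (Set.mem_Ioi.2 hx)]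
    field_simp
    ring
  · rw [intervalIntegral.integral_const_mul,
      HasSecondDeriv.intervalIntegral_indicator_Ioi_of_neg _ hx,
      Set.indicator_of_notMem (by simpa using hx.le)]
    simp
  · beta_reduce
    rw [intervalIntegral_congr_ae_eq hw, intervalIntegral.integral_const_mul,
      HasSecondDeriv.intervalIntegral_indicator_Ioi_of_pos _ hx, prim,
      Set.indicator_of_mem (Set.mem_Ioi.2 hx)]
    field_simp
    ring
  · beta_reduce
    rw [intervalIntegral_congr_ae_eq hw, intervalIntegral.integral_const_mul,
      HasSecondDeriv.intervalIntegral_indicator_Ioi_of_neg _ hx,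
      Set.indicator_of_notMem (by simpa using hx.le)]
    simp

/-- The function `sgn(x) e^{-κ|x|}`. -/
def expOdd : L2 := expPos hκ - parity (expPos hκ)

theorem hasSecondDeriv_expOdd :
    HasSecondDeriv (expOdd hκ) (κ ^ 2 • expOdd hκ) 1 (-1) (-κ) (-κ) := by
  have h := hasSecondDeriv_expPos hκ
  have := h.add (h.comp_parity.smul (-1))
  convert this using 1
  · simp [expOdd, sub_eq_add_neg]
  · simp [expOdd, sub_eq_add_neg]
  all_goals simp

end Exponential

theorem exists_sq_eq_I_mul {r : ℝ} (hr : r ≠ 0) :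
    ∃ κ : ℂ, κ ^ 2 = I * r ∧ 0 < κ.re ∧ κ.im ≠ 0 := by
  have hs : 0 < Real.sqrt (|r| / 2) := Real.sqrt_pos.2 (by positivity)
  have hsq : Real.sqrt (|r| / 2) ^ 2 = |r| / 2 := Real.sq_sqrt (by positivity)
  set s := Real.sqrt (|r| / 2)
  rcases lt_or_gt_of_ne hr with h | h
  · refine ⟨⟨s, -s⟩, ?_, hs, neg_ne_zero.2 hs.ne'⟩
    rw [abs_of_neg h] at hsq
    apply Complex.ext
    · simp [sq]
    · simp [sq]
      nlinarith
  · refine ⟨⟨s, s⟩, ?_, hs, hs.ne'⟩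
    rw [abs_of_pos h] at hsq
    apply Complex.ext
    · simp [sq]
    · simp [sq]
      nlinarith

/-- Solvability of `-c ψ'' + iν ψ = F` in `H²(ℝ)`. -/
theorem exists_free_resolvent {c ν : ℝ} (hc : 0 < c) (hν : ν ≠ 0) (F : L2) :
    ∃ (ψ w : L2) (u v : ℂ), HasSecondDeriv ψ w u u v v ∧
      (-(c : ℂ)) • w + (I * ν) • ψ = F := by
  have e : ∀ k : ℝ, (c * (2 * Real.pi * k) ^ 2 : ℂ) = ((c * (2 * Real.pi * k) ^ 2 : ℝ) : ℂ) :=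
    fun k => by push_cast; ring
  have hre : ∀ k : ℝ, c * (2 * Real.pi * k) ^ 2 ≤ ‖(c * (2 * Real.pi * k) ^ 2 + I * ν : ℂ)‖ :=
    fun k => by
    rw [e]
    refine le_trans (le_of_eq ?_) (re_le_norm _)
    rw [add_re, ofReal_re, mul_comm I, re_ofReal_mul, I_re, mul_zero, add_zero]
  have him : ∀ k : ℝ, |ν| ≤ ‖(c * (2 * Real.pi * k) ^ 2 + I * ν : ℂ)‖ := fun k => by
    rw [e]
    refine le_trans (le_of_eq ?_) (abs_im_le_norm _)
    rw [add_im, ofReal_im, mul_comm I, im_ofReal_mul, I_im, mul_one, zero_add]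
  have hden : ∀ k : ℝ, (c * (2 * Real.pi * k) ^ 2 + I * ν : ℂ) ≠ 0 := fun k =>
    norm_pos_iff.1 ((abs_pos.2 hν).trans_le (him k))
  have m0 : IsMultiplier fun k : ℝ => 1 / (c * (2 * Real.pi * k) ^ 2 + I * ν : ℂ) := by
    refine ⟨by fun_prop, 1 / |ν|, fun k => ?_⟩
    rw [norm_div, norm_one]
    exact one_div_le_one_div_of_le (abs_pos.2 hν) (him k)
  have m2 : IsMultiplier fun k : ℝ =>
      -(2 * Real.pi * k : ℂ) ^ 2 / (c * (2 * Real.pi * k) ^ 2 + I * ν : ℂ) := by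
    refine ⟨by fun_prop, 1 / c, fun k => ?_⟩
    have e : ‖-(2 * Real.pi * k : ℂ) ^ 2‖ = (2 * Real.pi * k) ^ 2 := by
      have : -(2 * Real.pi * k : ℂ) ^ 2 = ((-(2 * Real.pi * k) ^ 2 : ℝ) : ℂ) := by push_cast; ring
      rw [this, norm_real, norm_neg, Real.norm_eq_abs, abs_sq]
    beta_reduce
    rw [norm_div, e, div_le_div_iff₀ (norm_pos_iff.2 (hden k)) hc, one_mul, mul_comm]
    exact hre k
  set Fh := fourierInvL2.symm F with hFh
  have e0 := coeFn_mulCLM m0 Fh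
  have e2 := coeFn_mulCLM m2 Fh
  refine ⟨_, _, _, _, hasSecondDeriv_fourierInvL2 (f := mulCLM _ m0 Fh) (g := mulCLM _ m2 Fh) ?_, ?_⟩
  · filter_upwards [e0, e2] with k h0 h2
    rw [h0, h2]; ring
  · rw [← LinearIsometryEquiv.map_smul, ← LinearIsometryEquiv.map_smul,
      ← LinearIsometryEquiv.map_add, ← LinearIsometryEquiv.eq_symm_apply]
    apply Lp.ext
    filter_upwards [e0, e2, Lp.coeFn_add ((-(c : ℂ)) • mulCLM _ m2 Fh) ((I * ν : ℂ) • mulCLM _ m0 Fh),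
      Lp.coeFn_smul (-(c : ℂ)) (mulCLM _ m2 Fh), Lp.coeFn_smul (I * ν : ℂ) (mulCLM _ m0 Fh)]
      with k h0 h2 h3 h4 h5
    rw [h3, Pi.add_apply, h4, h5, Pi.smul_apply, Pi.smul_apply, h0, h2, smul_eq_mul, smul_eq_mul]
    have := hden k
    rw [div_mul_eq_mul_div, div_mul_eq_mul_div, mul_div_assoc', mul_div_assoc', ← add_div,
      div_eq_iff this]
    ring

/-- `expOdd` has jump `2` and continuous derivative `-κ`, so adding `α` times it to a function with
matching boundary values leaves one linear equation for `α`. -/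
theorem exists_boundaryCondition {ħ m : ℝ} (β : OnePoint ℝ) {κ : ℂ} (hre : 0 < κ.re)
    (him : κ.im ≠ 0) (u v : ℂ) :
    ∃ α : ℂ, BoundaryCondition ħ m β (u + α * 1) (u + α * (-1)) (v + α * (-κ)) (v + α * (-κ)) := by
  induction β using OnePoint.rec with
  | infty =>
    have h0 : κ ≠ 0 := fun h => by simp [h] at hre
    refine ⟨v / κ, rfl, ?_⟩
    simp [h0]
  | coe b =>
    set d : ℝ := 2 * m * b / ħ ^ 2 with hd
    -- The determinant of that equation: as `d` is real and `κ` is not, vanishing would force `d =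
    -- 0`, and then the value is `2`.
    have h0 : (2 + d * κ : ℂ) ≠ 0 := fun h => by
      have h1 := congrArg Complex.im h
      have h2 := congrArg Complex.re h
      simp at h1 h2
      rcases h1 with h1 | h1
      · simp [h1] at h2
      · exact him h1
    refine ⟨d * v / (2 + d * κ), rfl, ?_⟩
    change _ - _ = (d : ℂ) * _
    field_simp
    ring

/-- The operator `H_β/ħ` is self-adjoint. -/
theorem isSelfAdjointGraph_hamiltonian {ħ m : ℝ} (hħ : 0 < ħ) (hm : 0 < m) (β : OnePoint ℝ) :
    IsSelfAdjointGraph fun ψ χ => Hamiltonian ħ m β ψ ((ħ : ℂ) • χ) where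
  add := by
    rintro ψ χ ψ' χ' ⟨w, up, um, vp, vm, h, ⟨hb, hb'⟩, e⟩ ⟨w', up', um', vp', vm', h', ⟨hc, hc'⟩, e'⟩
    refine ⟨_, _, _, _, _, h.add h', ⟨by rw [hb, hc], ?_⟩, by rw [smul_add, e, e', smul_add]⟩
    induction β using OnePoint.rec with
    | infty =>
      change vp = 0 at hb'
      change vp' = 0 at hc'
      change vp + vp' = 0
      rw [hb', hc', add_zero]
    | coe b =>
      change up - um = _ * vp at hb'
      change up' - um' = _ * vp' at hc'
      change up + up' - (um + um') = _ * (vp + vp')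
      linear_combination hb' + hc'
  smul := by
    rintro c ψ χ ⟨w, up, um, vp, vm, h, ⟨hb, hb'⟩, e⟩
    refine ⟨_, _, _, _, _, h.smul c, ⟨by rw [hb], ?_⟩, by rw [smul_comm, e, smul_comm]⟩
    induction β using OnePoint.rec with
    | infty =>
      change vp = 0 at hb'
      change c * vp = 0
      rw [hb', mul_zero]
    | coe b =>
      change up - um = _ * vp at hb'
      change c * up - c * um = _ * (c * vp)
      linear_combination c * hb'
  im_inner := by
    rintro ψ χ ⟨w, up, um, vp, vm, h, ⟨hb, hb'⟩, e⟩
    subst hb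
    have h1 : (inner ℂ ψ w).im = 0 := by
      rw [h.im_inner]
      induction β using OnePoint.rec with
      | infty =>
        change vp = 0 at hb'
        simp [hb']
      | coe b =>
        change up - um = ((2 * m * b / ħ ^ 2 : ℝ) : ℂ) * vp at hb'
        generalize 2 * m * b / ħ ^ 2 = d at hb'
        have e1 : up = um + (d : ℂ) * vp := by rw [← hb']; ring
        rw [e1]
        simp
        ring
    have e2 : inner ℂ ψ ((ħ : ℂ) • χ) = inner ℂ ψ (((-(ħ ^ 2 / (2 * m)) : ℝ) : ℂ) • w) := by rw [e]
    rw [inner_smul_right, inner_smul_right] at e2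
    have e3 := congrArg Complex.im e2
    rw [im_ofReal_mul, im_ofReal_mul, h1, mul_zero] at e3
    exact (mul_eq_zero.1 e3).resolve_left hħ.ne'
  eq_zero := by
    rintro χ ⟨w, up, um, vp, vm, h, -, e⟩
    rw [h.eq_zero, smul_zero] at e
    exact (smul_eq_zero.1 e).resolve_left (by exact_mod_cast hħ.ne')
  surj := by
    intro μ hμ f
    have hc : 0 < ħ ^ 2 / (2 * m) := by positivity
    set c := ħ ^ 2 / (2 * m) with hcdef
    have hν : ħ * μ ≠ 0 := mul_ne_zero hħ.ne' hμ
    obtain ⟨ψ, w, u, v, h, e⟩ := exists_free_resolvent hc hν ((ħ : ℂ) • f)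
    -- This `κ` makes `-c κ² + iħμ = 0`, so `expOdd` solves the homogeneous equation on both
    -- half-lines and can be added freely to meet the boundary condition.
    obtain ⟨κ, hκ, hre, him⟩ := exists_sq_eq_I_mul (div_ne_zero hν hc.ne')
    obtain ⟨α, hα⟩ := exists_boundaryCondition (ħ := ħ) (m := m) β hre him u v
    have hsum := h.add ((hasSecondDeriv_expOdd hre).smul α)
    have hħ' : (ħ : ℂ) ≠ 0 := by exact_mod_cast hħ.ne'
    have hc' : (c : ℂ) ≠ 0 := by exact_mod_cast hc.ne'
    refine ⟨ψ + α • expOdd hre, (ħ : ℂ)⁻¹ • (((-c : ℝ) : ℂ) • (w + α • κ ^ 2 • expOdd hre)),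
      ⟨_, _, _, _, _, hsum, hα, ?_⟩, ?_⟩
    · rw [smul_inv_smul₀ hħ']
    · have e1 : f = (ħ : ℂ)⁻¹ • ((-(c : ℂ)) • w + (I * (ħ * μ : ℝ)) • ψ) := by
        rw [e, inv_smul_smul₀ hħ']
      rw [e1, hκ]
      push_cast
      match_scalars <;> field_simp <;> ring

theorem coe_smul_L2 (r : ℝ) (x : L2) : (r : ℂ) • x = r • x := algebraMap_smul ℂ r x

/-! ### Existence and uniqueness of the unitary group -/

theorem exists_isUnitaryGroupOf {ħ m : ℝ} (hħ : 0 < ħ) (hm : 0 < m) (β : OnePoint ℝ) :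
    ∃ U : ℝ → L2 ≃ₗᵢ[ℂ] L2, IsUnitaryGroupOf ħ (Hamiltonian ħ m β) U := by
  obtain ⟨U, h0, hadd, hcont, hgen⟩ := (isSelfAdjointGraph_hamiltonian hħ hm β).exists_unitaryGroup_isLittleO
  have hħ' : (ħ : ℂ) ≠ 0 := by exact_mod_cast hħ.ne'
  refine ⟨U, h0, hadd, hcont, fun ψ χ => ?_⟩
  have h := hgen ψ ((ħ : ℂ)⁻¹ • χ)
  rw [smul_inv_smul₀ hħ'] at h
  rw [h, hasDerivAt_iff_isLittleO]
  simp only [h0, sub_zero, ← coe_smul_L2, smul_smul, div_eq_mul_inv, neg_mul]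

/-! ### Solutions of the Schrödinger equation and uniqueness of the group -/

namespace IsUnitaryGroupOf

variable {ħ : ℝ} {H : L2 → L2 → Prop} {U : ℝ → L2 ≃ₗᵢ[ℂ] L2} (hU : IsUnitaryGroupOf ħ H U)

include hU

theorem hasDerivAt {ψ χ : L2} (h : H ψ χ) (t : ℝ) :
    HasDerivAt (fun t => U t ψ) (-(I / (ħ : ℂ)) • U t χ) t := by
  have h0 := (hU.generator ψ χ).1 h
  have h1 : HasDerivAt (fun s => U (s - t) ψ) (-(I / (ħ : ℂ)) • χ) t := by
    have := (show HasDerivAt (fun t => U t ψ) (-(I / (ħ : ℂ)) • χ) (t - t) by rwa [sub_self])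
    exact this.comp_sub_const t t
  have h2 := ((U t).toContinuousLinearEquiv.toContinuousLinearMap.restrictScalars ℝ).hasFDerivAt.comp_hasDerivAt
    t h1
  have e : (fun s => U s ψ) = fun s => U t (U (s - t) ψ) := by
    funext s
    rw [← hU.map_add, add_sub_cancel]
  rw [e]
  have e2 : U t (-(I / (ħ : ℂ)) • χ) = -(I / (ħ : ℂ)) • U t χ := _root_.map_smul _ _ _
  rw [← e2]
  exact h2

/-- Solutions of the Schrödinger equation are given by the unitary group. -/
theorem apply_eq_of_hasDerivAt {φ χ : ℝ → L2} (hH : ∀ t, H (φ t) (χ t))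
    (hφ : ∀ t, HasDerivAt φ (-(I / (ħ : ℂ)) • χ t) t) (t : ℝ) : U t (φ 0) = φ t := by
  -- The derivatives of the group and of the solution cancel. Since `U` is only strongly continuous,
  -- the product rule is checked by hand: `h7` and `h4` are the remainders of the two factors, and
  -- `h5` is the mixed term, small by strong continuity at `χ s`.
  have key : ∀ s, HasDerivAt (fun r => U (-r) (φ r)) 0 s := by
    intro s
    rw [hasDerivAt_iff_isLittleO]
    have h1 := (hasDerivAt_iff_isLittleO.1 (hφ s))
    have h2 := hU.hasDerivAt (hH s) (-s)
    have h3 : HasDerivAt (fun r => U (-r) (φ s)) ((I / (ħ : ℂ)) • U (-s) (χ s)) s := by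
      have := h2.scomp s (hasDerivAt_neg s)
      simpa [Function.comp_def] using this
    have h4 := hasDerivAt_iff_isLittleO.1 h3
    have hc : Filter.Tendsto (fun r : ℝ => U (-r) (χ s) - U (-s) (χ s)) (nhds s) (nhds 0) := by
      have : Continuous fun r : ℝ => U (-r) (χ s) - U (-s) (χ s) :=
        ((hU.continuous (χ s)).comp continuous_neg).sub continuous_const
      have h := this.tendsto s
      simpa using h
    have h5 : (fun r : ℝ => (r - s) • ((-(I / (ħ : ℂ))) • (U (-r) (χ s) - U (-s) (χ s))))
        =o[nhds s] fun r => r - s := by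
      have : Filter.Tendsto (fun r : ℝ => (-(I / (ħ : ℂ))) • (U (-r) (χ s) - U (-s) (χ s))) (nhds s)
          (nhds 0) := by
        have := hc.const_smul (-(I / (ħ : ℂ)))
        rwa [smul_zero] at this
      have h6 := (Asymptotics.isBigO_refl (fun r : ℝ => r - s) (nhds s)).smul_isLittleO
        ((Asymptotics.isLittleO_one_iff ℝ).2 this)
      simpa using h6
    have h7 : (fun r => U (-r) (φ r - φ s - (r - s) • (-(I / (ħ : ℂ)) • χ s)))
        =o[nhds s] fun r => r - s := by
      refine Asymptotics.IsLittleO.of_norm_left ?_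
      exact h1.norm_left.congr_left fun r => ((U (-r)).norm_map _).symm
    refine ((h7.add h4).add h5).congr_left fun r => ?_
    have e1 : ∀ x : L2, U (-r) ((r - s) • x) = (r - s) • U (-r) x := fun x => by
      rw [← coe_smul_L2, ← coe_smul_L2]
      exact _root_.map_smul _ _ _
    have e2 : ∀ x : L2, U (-r) (-(I / (ħ : ℂ)) • x) = -(I / (ħ : ℂ)) • U (-r) x := fun x =>
      _root_.map_smul _ _ _
    rw [map_sub, map_sub, e1, e2, smul_zero, sub_zero]
    module
  have hconst : U (-t) (φ t) = U (-0) (φ 0) :=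
    is_const_of_deriv_eq_zero (fun s => (key s).differentiableAt) (fun s => (key s).deriv) t 0
  rw [neg_zero, hU.map_zero] at hconst
  rw [← hconst, ← hU.map_add, add_neg_cancel, hU.map_zero]

theorem graph_apply {ψ χ : L2} (h : H ψ χ) (t : ℝ) : H (U t ψ) (U t χ) := by
  rw [hU.generator]
  have := hU.hasDerivAt h t
  have h1 : HasDerivAt (fun s => U (s + t) ψ) (-(I / (ħ : ℂ)) • U t χ) 0 := by
    have h2 : HasDerivAt (fun t => U t ψ) (-(I / (ħ : ℂ)) • U t χ) (0 + t) := by rwa [zero_add]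
    exact h2.comp_add_const 0 t
  simpa only [hU.map_add] using h1

theorem eq_of_dense {V : ℝ → L2 ≃ₗᵢ[ℂ] L2} (hV : IsUnitaryGroupOf ħ H V)
    (hd : Dense {ψ | ∃ χ, H ψ χ}) : U = V := by
  have h : ∀ t, (U t : L2 → L2) = V t := fun t => by
    refine Continuous.ext_on hd (U t).continuous (V t).continuous ?_
    rintro ψ ⟨χ, hψ⟩
    have := hU.apply_eq_of_hasDerivAt (φ := fun t => V t ψ) (χ := fun t => V t χ)
      (fun t => hV.graph_apply hψ t) (fun t => hV.hasDerivAt hψ t) t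
    rwa [hV.map_zero] at this
  funext t
  exact LinearIsometryEquiv.ext fun ψ => congrFun (h t) ψ

end IsUnitaryGroupOf

theorem dense_domain_hamiltonian {ħ m : ℝ} (hħ : 0 < ħ) (hm : 0 < m) (β : OnePoint ℝ) :
    Dense {ψ | ∃ χ, Hamiltonian ħ m β ψ χ} :=
  (isSelfAdjointGraph_hamiltonian hħ hm β).dense_domain.mono fun _ hψ =>
    ⟨(ħ : ℂ) • hψ.choose, hψ.choose_spec⟩

theorem existsUnique_isUnitaryGroupOf {ħ m : ℝ} (hħ : 0 < ħ) (hm : 0 < m) (β : OnePoint ℝ) :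
    ∃! U : ℝ → L2 ≃ₗᵢ[ℂ] L2, IsUnitaryGroupOf ħ (Hamiltonian ħ m β) U := by
  obtain ⟨U, hU⟩ := exists_isUnitaryGroupOf hħ hm β
  exact ⟨U, hU, fun V hV => hV.eq_of_dense hU (dense_domain_hamiltonian hħ hm β)⟩

/-! ### Scattering solutions -/

/-- The transmission amplitude at wave number `2πk`, for waves incoming from the right if `k < 0`,
and its analytic continuation for `k > 0`. -/
def transmission (ħ m : ℝ) (β : OnePoint ℝ) (k : ℝ) : ℂ :=
  β.elim 0 fun b => 1 / (1 + ((m * b / ħ ^ 2 * (2 * Real.pi * k) : ℝ) : ℂ) * I)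

theorem one_add_mul_I_ne_zero (x : ℝ) : (1 + (x : ℂ) * I) ≠ 0 := fun h => by
  have := congrArg Complex.re h
  simp at this

theorem one_le_norm_one_add_mul_I (x : ℝ) : 1 ≤ ‖1 + (x : ℂ) * I‖ := by
  refine le_trans (le_of_eq ?_) (re_le_norm _)
  simp

theorem abs_le_norm_one_add_mul_I (x : ℝ) : |x| ≤ ‖1 + (x : ℂ) * I‖ := by
  refine le_trans (le_of_eq ?_) (abs_im_le_norm _)
  simp

theorem norm_transmission_le (ħ m : ℝ) (β : OnePoint ℝ) (k : ℝ) : ‖transmission ħ m β k‖ ≤ 1 := by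
  induction β using OnePoint.rec with
  | infty => simp [transmission]
  | coe b =>
    change ‖1 / (1 + ((m * b / ħ ^ 2 * (2 * Real.pi * k) : ℝ) : ℂ) * I)‖ ≤ 1
    rw [norm_div, norm_one]
    exact div_le_one_of_le₀ (one_le_norm_one_add_mul_I _) (norm_nonneg _)

theorem isMultiplier_transmission (ħ m : ℝ) (β : OnePoint ℝ) :
    IsMultiplier (transmission ħ m β) := by
  refine ⟨?_, 1, norm_transmission_le ħ m β⟩
  induction β using OnePoint.rec with
  | infty => exact measurable_const
  | coe b =>
    change Measurable fun k : ℝ => 1 / (1 + ((m * b / ħ ^ 2 * (2 * Real.pi * k) : ℝ) : ℂ) * I)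
    fun_prop

/-- The Fourier multiplier of the transmission amplitude. -/
def transmit (ħ m : ℝ) (β : OnePoint ℝ) : L2 →L[ℂ] L2 :=
  mulCLM (transmission ħ m β) (isMultiplier_transmission ħ m β)

/-- The superposition of scattering states with incoming and outgoing waves on the right, with
amplitude `f`. -/
def scatter (ħ m : ℝ) (β : OnePoint ℝ) : L2 →L[ℂ] L2 :=
  let F : L2 →L[ℂ] L2 := fourierInvL2.toContinuousLinearEquiv.toContinuousLinearMap
  let P : L2 →L[ℂ] L2 := parity.toContinuousLinearMap
  cutPos ∘L (F + P ∘L F ∘L (1 - transmit ħ m β)) + cutNeg ∘L F ∘L transmit ħ m β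

theorem scatter_apply (ħ m : ℝ) (β : OnePoint ℝ) (f : L2) :
    scatter ħ m β f = cutPos (fourierInvL2 f)
      + cutPos (parity (fourierInvL2 (f - transmit ħ m β f)))
      + cutNeg (fourierInvL2 (transmit ħ m β f)) := by
  change cutPos (fourierInvL2 f + parity (fourierInvL2 (f - transmit ħ m β f)))
    + cutNeg (fourierInvL2 (transmit ħ m β f)) = _
  rw [map_add]

/-- Write `y = 2πk` and `a = mβ/ħ²`. Both derivatives at the origin are `∫ iy T f`, and the jump is
`2 ∫ (1 - T) f`; for real `β` the boundary condition is therefore the pointwise identity `1 - T = i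
a y T`, while for `β = ∞` one has `T = 0`. Neither uses the sign of `k`. -/
theorem hamiltonian_scatter {ħ m : ℝ} {β : OnePoint ℝ} {f g : L2}
    (hg : g =ᵐ[volume] fun k : ℝ => -(2 * Real.pi * k : ℂ) ^ 2 * f k) :
    Hamiltonian ħ m β (scatter ħ m β f)
      (((-(ħ ^ 2 / (2 * m)) : ℝ) : ℂ) • scatter ħ m β g) := by
  set Tf := transmit ħ m β f with hTf
  set Tg := transmit ħ m β g with hTg
  have ef : Tf =ᵐ[volume] fun k => transmission ħ m β k * f k := coeFn_mulCLM _ _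
  have eg : Tg =ᵐ[volume] fun k => transmission ħ m β k * g k := coeFn_mulCLM _ _
  have esub := Lp.coeFn_sub f Tf
  have hT : Tg =ᵐ[volume] fun k : ℝ => -(2 * Real.pi * k : ℂ) ^ 2 * Tf k := by
    filter_upwards [hg, ef, eg] with k h1 h2 h3
    rw [h3, h2, h1]; ring
  have hR : (g - Tg : L2) =ᵐ[volume] fun k : ℝ => -(2 * Real.pi * k : ℂ) ^ 2 * (f - Tf : L2) k := by
    filter_upwards [hg, hT, Lp.coeFn_sub g Tg, esub] with k h1 h2 h3 h4
    rw [h3, h4, Pi.sub_apply, Pi.sub_apply, h1, h2]; ring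
  have s1 := (hasSecondDeriv_fourierInvL2 hg).cutPos
  have s2 := (hasSecondDeriv_fourierInvL2 hR).comp_parity.cutPos
  have s3 := (hasSecondDeriv_fourierInvL2 hT).cutNeg
  have s := (s1.add s2).add s3
  rw [← scatter_apply, ← scatter_apply] at s
  refine ⟨_, _, _, _, _, s, ?_, rfl⟩
  have if0 := integrable_of_sq_mul hg
  have iT0 := integrable_of_sq_mul hT
  have if1 := integrable_mul_of_sq_mul hg
  have iT1 := integrable_mul_of_sq_mul hT
  have e0 : ∫ k, (f - Tf : L2) k = (∫ k, f k) - ∫ k, Tf k := by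
    rw [← integral_sub if0 iT0]
    exact integral_congr_ae esub
  have e1 : ∫ k : ℝ, 2 * Real.pi * k * I * (f - Tf : L2) k
      = (∫ k : ℝ, 2 * Real.pi * k * I * f k) - ∫ k : ℝ, 2 * Real.pi * k * I * Tf k := by
    rw [← integral_sub if1 iT1]
    refine integral_congr_ae ?_
    filter_upwards [esub] with k hk
    rw [hk, Pi.sub_apply, mul_sub]
  rw [e0, e1]
  refine ⟨by ring, ?_⟩
  induction β using OnePoint.rec with
  | infty =>
    change _ = (0 : ℂ)
    have : ∫ k : ℝ, 2 * Real.pi * k * I * Tf k = 0 := by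
      rw [← integral_zero ℝ ℂ]
      refine integral_congr_ae ?_
      filter_upwards [ef] with k hk
      rw [hk]
      simp [transmission]
    rw [this]; ring
  | coe b =>
    change _ - _ = ((2 * m * b / ħ ^ 2 : ℝ) : ℂ) * _
    have : (∫ k, f k) - ∫ k, Tf k
        = ((m * b / ħ ^ 2 : ℝ) : ℂ) * ∫ k : ℝ, 2 * Real.pi * k * I * Tf k := by
      rw [← integral_sub if0 iT0, ← integral_const_mul]
      refine integral_congr_ae ?_
      filter_upwards [ef] with k hk
      rw [hk]
      change f k - 1 / (1 + ((m * b / ħ ^ 2 * (2 * Real.pi * k) : ℝ) : ℂ) * I) * f k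
        = ((m * b / ħ ^ 2 : ℝ) : ℂ) * (2 * Real.pi * k * I *
          (1 / (1 + ((m * b / ħ ^ 2 * (2 * Real.pi * k) : ℝ) : ℂ) * I) * f k))
      have h0 := one_add_mul_I_ne_zero (m * b / ħ ^ 2 * (2 * Real.pi * k))
      push_cast at h0 ⊢
      generalize ((m : ℂ) * b / ħ ^ 2) = a at h0 ⊢
      have hw := one_div_mul_cancel h0
      linear_combination (-(f k)) * hw
    have hd : ((2 * m * b / ħ ^ 2 : ℝ) : ℂ) = 2 * ((m * b / ħ ^ 2 : ℝ) : ℂ) := by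
      push_cast; ring
    rw [hd]
    linear_combination 2 * this

theorem norm_exp_neg_I_mul_sub_le (x : ℝ) : ‖cexp (-(I * x)) - 1 + I * x‖ ≤ 3 * x ^ 2 := by
  have hn : ‖-(I * (x : ℂ))‖ = |x| := by simp
  rcases le_total |x| 1 with h | h
  · have := norm_exp_sub_one_sub_id_le (x := -(I * (x : ℂ))) (by rw [hn]; exact h)
    rw [hn, sub_neg_eq_add, sq_abs] at this
    nlinarith [sq_nonneg x]
  · have h1 : ‖cexp (-(I * x))‖ = 1 := by
      have : -(I * (x : ℂ)) = ((-x : ℝ) : ℂ) * I := by push_cast; ring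
      rw [this, norm_exp_ofReal_mul_I]
    calc ‖cexp (-(I * x)) - 1 + I * x‖ ≤ ‖cexp (-(I * x))‖ + ‖(1 : ℂ)‖ + ‖I * (x : ℂ)‖ :=
          (norm_add_le _ _).trans (add_le_add_left (norm_sub_le _ _) _)
      _ = 2 + |x| := by rw [h1]; simp; norm_num
      _ ≤ 3 * x ^ 2 := by rw [← sq_abs]; nlinarith

/-- Differentiability in `L²` of the free evolution in the Fourier representation. -/
theorem hasDerivAt_of_phase {θ : ℝ → ℝ} {G D : ℝ → L2} {N : L2}
    (hG : ∀ t : ℝ, G t =ᵐ[volume] fun k => cexp (-(I * (θ k * t : ℝ))) * G 0 k)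
    (hD : ∀ t : ℝ, D t =ᵐ[volume] fun k => -(I * θ k) * G t k)
    (hN : N =ᵐ[volume] fun k => (θ k : ℂ) ^ 2 * G 0 k) (t : ℝ) : HasDerivAt G (D t) t := by
  -- A pointwise second-order Taylor bound for the phase, taken in `L²`; `N` supplies the factor
  -- `θ²`.
  have key : ∀ s : ℝ, ‖G s - G t - ((s - t : ℝ) : ℂ) • D t‖ ≤ 3 * (s - t) ^ 2 * ‖N‖ := by
    intro s
    apply Lp.norm_le_mul_norm_of_ae_le_mul
    filter_upwards [hG s, hG t, hD t, hN, Lp.coeFn_sub (G s - G t) (((s - t : ℝ) : ℂ) • D t),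
      Lp.coeFn_sub (G s) (G t), Lp.coeFn_smul ((s - t : ℝ) : ℂ) (D t)] with k h1 h2 h3 h4 h5 h6 h7
    have e : cexp (-(I * (θ k * s : ℝ)))
        = cexp (-(I * (θ k * (s - t) : ℝ))) * cexp (-(I * (θ k * t : ℝ))) := by
      rw [← Complex.exp_add]; congr 1; push_cast; ring
    have hb := norm_exp_neg_I_mul_sub_le (θ k * (s - t))
    have h1' : ‖cexp (-(I * (θ k * t : ℝ)))‖ = 1 := by
      have : -(I * ((θ k * t : ℝ) : ℂ)) = ((-(θ k * t) : ℝ) : ℂ) * I := by push_cast; ring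
      rw [this, norm_exp_ofReal_mul_I]
    rw [h5, Pi.sub_apply, h6, Pi.sub_apply, h7, Pi.smul_apply, h3, h1, h2, h4, e, smul_eq_mul]
    have e2 : cexp (-(I * (θ k * (s - t) : ℝ))) * cexp (-(I * (θ k * t : ℝ))) * G 0 k
        - cexp (-(I * (θ k * t : ℝ))) * G 0 k
        - ((s - t : ℝ) : ℂ) * (-(I * θ k) * (cexp (-(I * (θ k * t : ℝ))) * G 0 k))
        = (cexp (-(I * (θ k * (s - t) : ℝ))) - 1 + I * (θ k * (s - t) : ℝ))
          * cexp (-(I * (θ k * t : ℝ))) * G 0 k := by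
      push_cast; ring
    rw [e2, norm_mul, norm_mul, h1', mul_one, norm_mul, norm_pow, norm_real, Real.norm_eq_abs,
      sq_abs, ← mul_assoc]
    refine mul_le_mul_of_nonneg_right (hb.trans (le_of_eq ?_)) (norm_nonneg _)
    ring
  rw [hasDerivAt_iff_isLittleO, Asymptotics.isLittleO_iff]
  intro ε hε
  filter_upwards [Metric.ball_mem_nhds t (show 0 < ε / (3 * ‖N‖ + 1) by positivity)] with s hs
  rw [Metric.mem_ball, Real.dist_eq, lt_div_iff₀ (by positivity)] at hs
  rw [← coe_smul_L2]
  refine (key s).trans ?_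
  rw [Real.norm_eq_abs, ← sq_abs]
  nlinarith [abs_nonneg (s - t), norm_nonneg N]

/-! ### Gaussian wave packets in the Fourier representation -/

/-- The normalization constant of the Fourier transform of a coherent state. -/
def packetConst (ħ σ₀ : ℝ) : ℝ :=
  2 * Real.pi / (2 * Real.pi * ħ) ^ (1 / 4 : ℝ) * Real.sqrt (ħ * σ₀ / Real.pi)

/-- The Fourier transform of a coherent state evolved freely up to time `t`. -/
def packetFourier (ħ m σ₀ q p t : ℝ) (k : ℝ) : ℂ :=
  packetConst ħ σ₀ * cexp (-((ħ * σ₀ ^ 2 * (2 * Real.pi * k - p / ħ) ^ 2 : ℝ) : ℂ)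
    - ((2 * Real.pi * k * q + ħ * (2 * Real.pi * k) ^ 2 / (2 * m) * t : ℝ) : ℂ) * I)

theorem packetConst_pos {ħ σ₀ : ℝ} (hħ : 0 < ħ) (hσ₀ : 0 < σ₀) : 0 < packetConst ħ σ₀ := by
  have := Real.pi_pos
  unfold packetConst
  positivity

theorem packetConst_sq {ħ σ₀ : ℝ} (hħ : 0 < ħ) (hσ₀ : 0 < σ₀) :
    packetConst ħ σ₀ ^ 2 = 2 * Real.sqrt (2 * Real.pi) * (Real.sqrt ħ * σ₀) := by
  have hπ := Real.pi_pos
  have h4 : ((2 * Real.pi * ħ) ^ (1 / 4 : ℝ)) ^ 2 = Real.sqrt (2 * Real.pi) * Real.sqrt ħ := by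
    rw [← Real.rpow_natCast, ← Real.rpow_mul (by positivity), ← Real.sqrt_mul (by positivity),
      Real.sqrt_eq_rpow]
    norm_num
  have h1 : Real.sqrt (2 * Real.pi) ^ 2 = 2 * Real.pi := Real.sq_sqrt (by positivity)
  have h2 : Real.sqrt ħ ^ 2 = ħ := Real.sq_sqrt hħ.le
  have h1p : 0 < Real.sqrt (2 * Real.pi) := Real.sqrt_pos.2 (by positivity)
  have h2p : 0 < Real.sqrt ħ := Real.sqrt_pos.2 hħ
  rw [packetConst, mul_pow, div_pow, h4, Real.sq_sqrt (by positivity)]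
  field_simp
  rw [h1, h2]

theorem norm_packetFourier {ħ σ₀ : ℝ} (hħ : 0 < ħ) (hσ₀ : 0 < σ₀) (m q p t k : ℝ) :
    ‖packetFourier ħ m σ₀ q p t k‖
      = packetConst ħ σ₀ * Real.exp (-(ħ * σ₀ ^ 2 * (2 * Real.pi * k - p / ħ) ^ 2)) := by
  rw [packetFourier, norm_mul, norm_real, Real.norm_eq_abs, abs_of_pos (packetConst_pos hħ hσ₀),
    norm_exp, sub_re, neg_re, ofReal_re, re_ofReal_mul, I_re, mul_zero, sub_zero]

theorem continuous_packetFourier (ħ m σ₀ q p t : ℝ) : Continuous (packetFourier ħ m σ₀ q p t) := by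
  unfold packetFourier
  fun_prop

theorem integrable_pow_mul_exp_neg_mul_sq {b : ℝ} (hb : 0 < b) (n : ℕ) :
    Integrable fun x : ℝ => x ^ n * Real.exp (-b * x ^ 2) := by
  have h := integrable_rpow_mul_exp_neg_mul_sq hb (s := n) (by
    have : (0 : ℝ) ≤ n := Nat.cast_nonneg n
    linarith)
  simpa only [Real.rpow_natCast] using h

theorem memLp_shift_pow_mul_packetFourier {ħ σ₀ : ℝ} (hħ : 0 < ħ) (hσ₀ : 0 < σ₀) (m q p t : ℝ) (n : ℕ) :
    MemLp (fun k : ℝ => ((2 * Real.pi * k - p / ħ : ℝ) : ℂ) ^ n * packetFourier ħ m σ₀ q p t k)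
      2 volume := by
  have hc : Continuous fun k : ℝ =>
      ((2 * Real.pi * k - p / ħ : ℝ) : ℂ) ^ n * packetFourier ħ m σ₀ q p t k :=
    (by fun_prop : Continuous fun k : ℝ => ((2 * Real.pi * k - p / ħ : ℝ) : ℂ) ^ n).mul
      (continuous_packetFourier ħ m σ₀ q p t)
  rw [memLp_two_iff_integrable_sq_norm hc.aestronglyMeasurable]
  have h := ((integrable_pow_mul_exp_neg_mul_sq (b := 2 * (ħ * σ₀ ^ 2)) (by positivity)
    (2 * n)).comp_sub_right (p / ħ)).comp_mul_left' (R := 2 * Real.pi) (by positivity)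
  refine (h.const_mul (packetConst ħ σ₀ ^ 2)).congr (Filter.Eventually.of_forall fun k => ?_)
  beta_reduce
  rw [norm_mul, norm_packetFourier hħ hσ₀, norm_pow, norm_real, Real.norm_eq_abs, mul_pow, mul_pow,
    ← pow_mul, ← Real.exp_nat_mul, mul_comm n 2, pow_mul |_|, sq_abs, ← pow_mul]
  push_cast
  ring_nf

/-- The momentum moments of a wave packet. -/
theorem norm_shift_pow_mul_packetFourier {ħ σ₀ : ℝ} (hħ : 0 < ħ) (hσ₀ : 0 < σ₀) (m q p t : ℝ) (n : ℕ) :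
    ‖(memLp_shift_pow_mul_packetFourier hħ hσ₀ m q p t n).toLp _‖
      = Real.sqrt (2 * Real.sqrt (2 * Real.pi) / (2 * Real.pi)
          * ∫ x : ℝ, x ^ (2 * n) * Real.exp (-2 * x ^ 2)) / (Real.sqrt ħ * σ₀) ^ n := by
  have hM := memLp_shift_pow_mul_packetFourier hħ hσ₀ m q p t n
  set s := Real.sqrt ħ * σ₀ with hs
  have hs0 : 0 < s := mul_pos (Real.sqrt_pos.2 hħ) hσ₀
  have hs2 : s ^ 2 = ħ * σ₀ ^ 2 := by rw [hs, mul_pow, Real.sq_sqrt hħ.le]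
  have hsq : ‖hM.toLp _‖ ^ 2 = ∫ k : ℝ, packetConst ħ σ₀ ^ 2 *
      ((2 * Real.pi * k - p / ħ) ^ (2 * n) * Real.exp (-2 * (s * (2 * Real.pi * k - p / ħ)) ^ 2)) := by
    rw [@norm_sq_eq_re_inner ℂ, inner_eq_integral]
    have e : ∫ x : ℝ, (starRingEnd ℂ) (hM.toLp _ x) * hM.toLp _ x
        = ∫ k : ℝ, ((packetConst ħ σ₀ ^ 2 * ((2 * Real.pi * k - p / ħ) ^ (2 * n)
          * Real.exp (-2 * (s * (2 * Real.pi * k - p / ħ)) ^ 2)) : ℝ) : ℂ) := by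
      refine integral_congr_ae ?_
      filter_upwards [hM.coeFn_toLp] with k hk
      rw [hk, ← normSq_eq_conj_mul_self, normSq_eq_norm_sq, norm_mul, norm_packetFourier hħ hσ₀,
        norm_pow, norm_real, Real.norm_eq_abs, mul_pow, mul_pow,
        ← pow_mul, ← Real.exp_nat_mul, mul_comm n 2, pow_mul |_|, sq_abs, ← pow_mul, mul_pow s, hs2]
      push_cast
      ring_nf
    rw [e, integral_complex_ofReal]
    simp
  have hval : ∫ k : ℝ, packetConst ħ σ₀ ^ 2 *
      ((2 * Real.pi * k - p / ħ) ^ (2 * n) * Real.exp (-2 * (s * (2 * Real.pi * k - p / ħ)) ^ 2))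
      = (2 * Real.sqrt (2 * Real.pi) / (2 * Real.pi)
          * ∫ x : ℝ, x ^ (2 * n) * Real.exp (-2 * x ^ 2)) / (s ^ n) ^ 2 := by
    rw [integral_const_mul, packetConst_sq hħ hσ₀, ← hs]
    have h1 := Measure.integral_comp_mul_left
      (fun y : ℝ => (y - p / ħ) ^ (2 * n) * Real.exp (-2 * (s * (y - p / ħ)) ^ 2)) (2 * Real.pi)
    have h2 := integral_sub_right_eq_self (μ := (volume : Measure ℝ))
      (fun y : ℝ => y ^ (2 * n) * Real.exp (-2 * (s * y) ^ 2)) (p / ħ)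
    have h3 := Measure.integral_comp_mul_left
      (fun y : ℝ => y ^ (2 * n) * Real.exp (-2 * y ^ 2)) s
    have h4 : ∫ y : ℝ, (s * y) ^ (2 * n) * Real.exp (-2 * (s * y) ^ 2)
        = s ^ (2 * n) * ∫ y : ℝ, y ^ (2 * n) * Real.exp (-2 * (s * y) ^ 2) := by
      rw [← integral_const_mul]
      refine integral_congr_ae (Filter.Eventually.of_forall fun y => ?_)
      beta_reduce
      rw [mul_pow]; ring
    rw [h4] at h3
    rw [h1, h2]
    have hπ := Real.pi_pos
    rw [abs_of_pos (by positivity), smul_eq_mul] at *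
    have h5 : ∫ y : ℝ, y ^ (2 * n) * Real.exp (-2 * (s * y) ^ 2)
        = s⁻¹ * (∫ y : ℝ, y ^ (2 * n) * Real.exp (-2 * y ^ 2)) / s ^ (2 * n) := by
      rw [eq_div_iff (by positivity), mul_comm, h3]
    rw [h5]
    field_simp
    ring
  rw [hval] at hsq
  rw [← Real.sqrt_sq (norm_nonneg (hM.toLp _)), hsq, Real.sqrt_div' _ (by positivity),
    Real.sqrt_sq (by positivity)]

section Packet

variable {ħ m σ₀ : ℝ} (hħ : 0 < ħ) (hσ₀ : 0 < σ₀)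

include hħ hσ₀

theorem memLp_pow_mul_packetFourier (m q p t : ℝ) (n : ℕ) :
    MemLp (fun k : ℝ => ((2 * Real.pi * k : ℝ) : ℂ) ^ n * packetFourier ħ m σ₀ q p t k)
      2 volume := by
  have h : ∀ k : ℝ, ((2 * Real.pi * k : ℝ) : ℂ) ^ n * packetFourier ħ m σ₀ q p t k
      = ∑ i ∈ Finset.range (n + 1), ((p / ħ : ℝ) : ℂ) ^ (n - i) * (n.choose i : ℂ) *
        (((2 * Real.pi * k - p / ħ : ℝ) : ℂ) ^ i * packetFourier ħ m σ₀ q p t k) := fun k => by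
    have e : ((2 * Real.pi * k : ℝ) : ℂ) = ((2 * Real.pi * k - p / ħ : ℝ) : ℂ) + ((p / ħ : ℝ) : ℂ) := by
      push_cast; ring
    rw [e, add_pow, Finset.sum_mul]
    refine Finset.sum_congr rfl fun i _ => ?_
    ring
  simp only [h]
  exact memLp_finsetSum _ fun i _ =>
    (memLp_shift_pow_mul_packetFourier hħ hσ₀ m q p t i).const_mul _

theorem memLp_packetFourier (m q p t : ℝ) : MemLp (packetFourier ħ m σ₀ q p t) 2 volume := by
  simpa using memLp_pow_mul_packetFourier hħ hσ₀ m q p t 0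

/-- The Fourier transform of the freely evolved wave packet, as an element of `L²(ℝ)`. -/
def packet (m q p t : ℝ) : L2 := (memLp_packetFourier hħ hσ₀ m q p t).toLp _

theorem coeFn_packet (m q p t : ℝ) :
    packet hħ hσ₀ m q p t =ᵐ[volume] packetFourier ħ m σ₀ q p t :=
  (memLp_packetFourier hħ hσ₀ m q p t).coeFn_toLp

/-- `-(2πk)²` times the Fourier transform of the wave packet. -/
def packetSq (m q p t : ℝ) : L2 := -(memLp_pow_mul_packetFourier hħ hσ₀ m q p t 2).toLp _

theorem coeFn_packetSq (m q p t : ℝ) : packetSq hħ hσ₀ m q p t =ᵐ[volume]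
    fun k : ℝ => -(2 * Real.pi * k : ℂ) ^ 2 * packet hħ hσ₀ m q p t k := by
  have hM := memLp_pow_mul_packetFourier hħ hσ₀ m q p t 2
  filter_upwards [Lp.coeFn_neg (hM.toLp _), hM.coeFn_toLp, coeFn_packet hħ hσ₀ m q p t]
    with k h1 h2 h3
  rw [packetSq, h1, Pi.neg_apply, h2, h3]
  push_cast
  ring

omit hħ hσ₀ in
theorem packetFourier_eq_phase (m q p t k : ℝ) : packetFourier ħ m σ₀ q p t k
    = cexp (-(I * (ħ * (2 * Real.pi * k) ^ 2 / (2 * m) * t : ℝ))) * packetFourier ħ m σ₀ q p 0 k := by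
  rw [packetFourier, packetFourier, mul_left_comm, ← Complex.exp_add]
  congr 2
  push_cast
  ring

theorem hasDerivAt_packet (m q p t : ℝ) : HasDerivAt (packet hħ hσ₀ m q p)
    (-(I / (ħ : ℂ)) • ((-(ħ ^ 2 / (2 * m)) : ℝ) : ℂ) • packetSq hħ hσ₀ m q p t) t := by
  -- The phase is quadratic in `k`, so its square needs the fourth moment.
  have hM := memLp_pow_mul_packetFourier hħ hσ₀ m q p 0 4
  refine hasDerivAt_of_phase (θ := fun k => ħ * (2 * Real.pi * k) ^ 2 / (2 * m))
    (G := packet hħ hσ₀ m q p)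
    (D := fun t => -(I / (ħ : ℂ)) • ((-(ħ ^ 2 / (2 * m)) : ℝ) : ℂ) • packetSq hħ hσ₀ m q p t)
    (N := ((ħ / (2 * m) : ℝ) : ℂ) ^ 2 • hM.toLp _) ?_ ?_ ?_ t
  · intro t
    filter_upwards [coeFn_packet hħ hσ₀ m q p t, coeFn_packet hħ hσ₀ m q p 0] with k h1 h2
    rw [h1, h2, packetFourier_eq_phase]
  · intro t
    have h := coeFn_packetSq hħ hσ₀ m q p t
    filter_upwards [h, Lp.coeFn_smul (-(I / (ħ : ℂ)))
      (((-(ħ ^ 2 / (2 * m)) : ℝ) : ℂ) • packetSq hħ hσ₀ m q p t),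
      Lp.coeFn_smul ((-(ħ ^ 2 / (2 * m)) : ℝ) : ℂ) (packetSq hħ hσ₀ m q p t)] with k h1 h2 h3
    rw [h2, Pi.smul_apply, h3, Pi.smul_apply, h1, smul_eq_mul, smul_eq_mul]
    have : (ħ : ℂ) ≠ 0 := by exact_mod_cast hħ.ne'
    push_cast
    field_simp
  · filter_upwards [hM.coeFn_toLp, coeFn_packet hħ hσ₀ m q p 0,
      Lp.coeFn_smul (((ħ / (2 * m) : ℝ) : ℂ) ^ 2) (hM.toLp _)] with k h1 h2 h3
    rw [h3, Pi.smul_apply, h1, h2, smul_eq_mul]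
    push_cast
    ring

/-- The exact solution of the Schrödinger equation given by a superposition of scattering
states. -/
theorem unitaryGroup_scatter_packet {β : OnePoint ℝ} {U : ℝ → L2 ≃ₗᵢ[ℂ] L2}
    (hU : IsUnitaryGroupOf ħ (Hamiltonian ħ m β) U) (q p t : ℝ) :
    U t (scatter ħ m β (packet hħ hσ₀ m q p 0)) = scatter ħ m β (packet hħ hσ₀ m q p t) := by
  refine hU.apply_eq_of_hasDerivAt (φ := fun t => scatter ħ m β (packet hħ hσ₀ m q p t))
    (χ := fun t => ((-(ħ ^ 2 / (2 * m)) : ℝ) : ℂ) • scatter ħ m β (packetSq hħ hσ₀ m q p t))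
    (fun t => hamiltonian_scatter (coeFn_packetSq hħ hσ₀ m q p t)) (fun t => ?_) t
  have h := ((scatter ħ m β).restrictScalars ℝ).hasFDerivAt.comp_hasDerivAt t
    (hasDerivAt_packet hħ hσ₀ m q p t)
  have e : scatter ħ m β (-(I / (ħ : ℂ)) • ((-(ħ ^ 2 / (2 * m)) : ℝ) : ℂ) • packetSq hħ hσ₀ m q p t)
      = -(I / (ħ : ℂ)) • ((-(ħ ^ 2 / (2 * m)) : ℝ) : ℂ) • scatter ħ m β (packetSq hħ hσ₀ m q p t) := by
    rw [_root_.map_smul, _root_.map_smul]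
  rw [← e]
  exact h

omit hħ hσ₀ in
theorem sigmaAt_re (m σ₀ t : ℝ) : (sigmaAt m σ₀ t).re = σ₀ := by
  have e : sigmaAt m σ₀ t = (σ₀ : ℂ) + ((t / (2 * m * σ₀) : ℝ) : ℂ) * I := by
    rw [sigmaAt]; push_cast; ring
  rw [e, add_re, ofReal_re, re_ofReal_mul, I_re, mul_zero, add_zero]

omit hħ hσ₀ in
theorem sigmaAt_im (m σ₀ t : ℝ) : (sigmaAt m σ₀ t).im = t / (2 * m * σ₀) := by
  have e : sigmaAt m σ₀ t = (σ₀ : ℂ) + ((t / (2 * m * σ₀) : ℝ) : ℂ) * I := by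
    rw [sigmaAt]; push_cast; ring
  rw [e, add_im, ofReal_im, zero_add, im_ofReal_mul, I_im, mul_one]

/-- Matching the branch of the square root: since `Re σ > 0`, the argument of `σ` is not `π`, so the
principal logarithm satisfies `log σ⁻¹ = -log σ`. -/
theorem packetConst_mul_cpow {σ : ℂ} (hσ : 0 < σ.re) :
    (packetConst ħ σ₀ : ℂ) * (Real.pi / (4 * Real.pi ^ 2 * ħ * σ₀ * σ)) ^ (1 / 2 : ℂ)
      = 1 / ((((2 * Real.pi * ħ) ^ (1 / 4 : ℝ) : ℝ) : ℂ) * σ ^ (1 / 2 : ℂ)) := by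
  have hπ := Real.pi_pos
  have hσ0 : σ ≠ 0 := fun h => by simp [h] at hσ
  have harg : arg σ ≠ Real.pi := by
    have := abs_arg_lt_pi_div_two_iff.2 (Or.inl hσ)
    intro h
    rw [h, abs_of_pos hπ] at this
    linarith
  set r : ℝ := 1 / (4 * Real.pi * ħ * σ₀) with hr
  have hr0 : 0 < r := by positivity
  have e1 : (Real.pi / (4 * Real.pi ^ 2 * ħ * σ₀ * σ) : ℂ) = (r : ℂ) * σ⁻¹ := by
    rw [hr]
    have : (Real.pi : ℂ) ≠ 0 := by exact_mod_cast hπ.ne'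
    have : (ħ : ℂ) ≠ 0 := by exact_mod_cast hħ.ne'
    have : (σ₀ : ℂ) ≠ 0 := by exact_mod_cast hσ₀.ne'
    push_cast
    field_simp
  have e2 : ((r : ℂ) * σ⁻¹) ^ (1 / 2 : ℂ) = (Real.sqrt r : ℂ) * (σ ^ (1 / 2 : ℂ))⁻¹ := by
    have hrc : (r : ℂ) ≠ 0 := by exact_mod_cast hr0.ne'
    rw [cpow_def_of_ne_zero (mul_ne_zero hrc (inv_ne_zero hσ0)),
      log_ofReal_mul hr0 (inv_ne_zero hσ0), log_inv _ harg, add_mul, Complex.exp_add,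
      cpow_def_of_ne_zero hσ0, neg_mul, Complex.exp_neg, Real.sqrt_eq_rpow,
      Real.rpow_def_of_pos hr0]
    push_cast
    ring_nf
  have e3 : packetConst ħ σ₀ * Real.sqrt r = 1 / (2 * Real.pi * ħ) ^ (1 / 4 : ℝ) := by
    rw [packetConst, mul_assoc, ← Real.sqrt_mul (by positivity)]
    have : ħ * σ₀ / Real.pi * r = (1 / (2 * Real.pi)) ^ 2 := by
      rw [hr]; field_simp; norm_num
    rw [this, Real.sqrt_sq (by positivity)]
    field_simp
  rw [e1, e2, ← mul_assoc, ← ofReal_mul, e3]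
  rw [ofReal_div, ofReal_one, one_div, one_div (_ * _), mul_inv]

theorem integrable_packetFourier (m q p t : ℝ) : Integrable (packetFourier ħ m σ₀ q p t) := by
  rw [← integrable_norm_iff (continuous_packetFourier ħ m σ₀ q p t).aestronglyMeasurable]
  simp only [norm_packetFourier hħ hσ₀]
  have h := ((integrable_exp_neg_mul_sq (b := ħ * σ₀ ^ 2) (by positivity)).comp_sub_right
    (p / ħ)).comp_mul_left' (R := 2 * Real.pi) (by positivity)
  refine (h.const_mul (packetConst ħ σ₀)).congr (Filter.Eventually.of_forall fun k => ?_)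
  beta_reduce
  rw [neg_mul]

/-- In position space the free evolution of a coherent state is a coherent state. -/
theorem coeFn_fourierInvL2_packet (hm : 0 < m) (q p t : ℝ) :
    fourierInvL2 (packet hħ hσ₀ m q p t) =ᵐ[volume] fun x =>
      cexp (I / ħ * ((p ^ 2 * t / (2 * m) : ℝ) : ℂ)) *
        coherent ħ σ₀ (sigmaAt m σ₀ t) (q + p / m * t, p) x := by
  have hint : Integrable (packet hħ hσ₀ m q p t) :=
    (integrable_packetFourier hħ hσ₀ m q p t).congr (coeFn_packet hħ hσ₀ m q p t).symm
  refine (coeFn_fourierInvL2 hint).trans (Filter.Eventually.of_forall fun x => ?_)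
  have hσ : 0 < (sigmaAt m σ₀ t).re := by rw [sigmaAt_re]; exact hσ₀
  have hSσ : (σ₀ : ℂ) * sigmaAt m σ₀ t = σ₀ ^ 2 + I * t / (2 * m) := by
    have : (σ₀ : ℂ) ≠ 0 := by exact_mod_cast hσ₀.ne'
    have : (m : ℂ) ≠ 0 := by exact_mod_cast hm.ne'
    rw [sigmaAt]; field_simp
  set σ := sigmaAt m σ₀ t with hσdef
  have hσ0 : σ ≠ 0 := fun h => by simp [h] at hσ
  have hπ := Real.pi_pos
  have cπ : (Real.pi : ℂ) ≠ 0 := by exact_mod_cast hπ.ne'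
  have cħ : (ħ : ℂ) ≠ 0 := by exact_mod_cast hħ.ne'
  have cσ₀ : (σ₀ : ℂ) ≠ 0 := by exact_mod_cast hσ₀.ne'
  have cm : (m : ℂ) ≠ 0 := by exact_mod_cast hm.ne'
  have hb : (-(4 * Real.pi ^ 2 * ħ * σ₀ * σ) : ℂ).re < 0 := by
    have e : (-(4 * Real.pi ^ 2 * ħ * σ₀ * σ) : ℂ) = ((-(4 * Real.pi ^ 2 * ħ * σ₀) : ℝ) : ℂ) * σ := by
      push_cast; ring
    rw [e, re_ofReal_mul]
    have : 0 < 4 * Real.pi ^ 2 * ħ * σ₀ := by positivity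
    nlinarith
  have hq := integral_cexp_quadratic hb (2 * Real.pi * I * (x - q) + 4 * Real.pi * σ₀ ^ 2 * p)
    (-(σ₀ ^ 2 * p ^ 2 / ħ))
  beta_reduce
  rw [fourierInv_eq_integral_cexp]
  calc _ = ∫ k : ℝ, (packetConst ħ σ₀ : ℂ) * cexp (-(4 * Real.pi ^ 2 * ħ * σ₀ * σ) * (k : ℂ) ^ 2
        + (2 * Real.pi * I * (x - q) + 4 * Real.pi * σ₀ ^ 2 * p) * k + -(σ₀ ^ 2 * p ^ 2 / ħ)) := by
        refine integral_congr_ae ?_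
        filter_upwards [coeFn_packet hħ hσ₀ m q p t] with k hk
        rw [hk, packetFourier, mul_left_comm, ← Complex.exp_add]
        congr 2
        rw [mul_assoc _ (σ₀ : ℂ) σ, hSσ]
        push_cast
        field_simp
        ring
    _ = _ := by
        rw [integral_const_mul, hq, neg_neg, ← mul_assoc, packetConst_mul_cpow hħ hσ₀ hσ, coherent,
          mul_left_comm, ← Complex.exp_add]
        congr 2
        have e1 : (2 * Real.pi * I * (x - q) + 4 * Real.pi * σ₀ ^ 2 * p : ℂ) ^ 2
              / (4 * -(4 * Real.pi ^ 2 * ħ * σ₀ * σ))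
            = -((I * (x - q) + 2 * σ₀ ^ 2 * p) ^ 2 / (4 * ħ * (σ₀ * σ))) := by
          field_simp
          ring
        have e2 : (-(1 / (4 * ħ * σ₀ * σ)) : ℂ) = -(1 / (4 * ħ * (σ₀ * σ))) := by ring
        rw [e1, e2]
        have hS : (σ₀ : ℂ) * σ ≠ 0 := mul_ne_zero cσ₀ hσ0
        have hS2 : (σ₀ : ℂ) ^ 2 = σ₀ * σ - I * t / (2 * m) := by rw [hSσ]; ring
        rw [hS2]
        generalize (σ₀ : ℂ) * σ = S at hS
        push_cast
        field_simp
        ring_nf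
        simp only [I_sq]
        ring

/-- Normalized Gaussian moments. -/
def momentConst (n : ℕ) : ℝ :=
  Real.sqrt (2 * Real.sqrt (2 * Real.pi) / (2 * Real.pi)
    * ∫ x : ℝ, x ^ (2 * n) * Real.exp (-2 * x ^ 2))

omit hħ hσ₀ in
theorem momentConst_nonneg (n : ℕ) : 0 ≤ momentConst n := Real.sqrt_nonneg _

theorem norm_packet (m q p t : ℝ) : ‖packet hħ hσ₀ m q p t‖ = momentConst 0 := by
  have h := norm_shift_pow_mul_packetFourier hħ hσ₀ m q p t 0
  rw [pow_zero, div_one] at h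
  rw [momentConst, ← h]
  congr 1
  refine MemLp.toLp_congr _ _ (Filter.Eventually.of_forall fun k => ?_)
  simp

theorem norm_coherent (m t q p x : ℝ) :
    ‖coherent ħ σ₀ (sigmaAt m σ₀ t) (q, p) x‖
      = ‖1 / ((((2 * Real.pi * ħ) ^ (1 / 4 : ℝ) : ℝ) : ℂ) * sigmaAt m σ₀ t ^ (1 / 2 : ℂ))‖
        * Real.exp (-((x - q) ^ 2 / (4 * ħ * normSq (sigmaAt m σ₀ t)))) := by
  have hre := sigmaAt_re m σ₀ t
  rw [coherent]
  set σ := sigmaAt m σ₀ t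
  rw [norm_mul, norm_exp]
  congr 2
  have e1 : (-(1 / (4 * ħ * σ₀ * σ)) * ((x - q : ℝ) : ℂ) ^ 2 : ℂ)
      = ((-((x - q) ^ 2 / (4 * ħ * σ₀)) : ℝ) : ℂ) * σ⁻¹ := by
    push_cast
    ring
  have e2 : (I / ħ * p * ((x - q : ℝ) : ℂ) : ℂ) = ((p * (x - q) / ħ : ℝ) : ℂ) * I := by
    push_cast; ring
  rw [e1, e2, add_re, re_ofReal_mul, re_ofReal_mul, I_re, mul_zero, add_zero, inv_re, hre]
  field_simp

/-- Gaussian tail of the freely evolved wave packet. -/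
theorem norm_cut_packet_le (hm : 0 < m) (q p t : ℝ) {s : Set ℝ} (hs : MeasurableSet s)
    (hx : ∀ x ∈ s, x * (q + p / m * t) ≤ 0) :
    ‖cut s hs (fourierInvL2 (packet hħ hσ₀ m q p t))‖
      ≤ Real.exp (-((q + p / m * t) ^ 2 / (4 * ħ * normSq (sigmaAt m σ₀ t)))) * momentConst 0 := by
  -- The comparison packet starts at `-pt/m`, so that at time `t` it has the same width and is
  -- centred at the origin. On `s` the cross term in the exponent has the favourable sign, so the
  -- factor `exp(-d²/…)` splits off, with `d` the actual centre.
  rw [← norm_packet hħ hσ₀ m (-(p / m * t)) p t, ← fourierInvL2.norm_map (packet _ _ _ (-_) _ _)]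
  apply Lp.norm_le_mul_norm_of_ae_le_mul
  filter_upwards [coeFn_cut hs (fourierInvL2 (packet hħ hσ₀ m q p t)),
    coeFn_fourierInvL2_packet hħ hσ₀ hm q p t,
    coeFn_fourierInvL2_packet hħ hσ₀ hm (-(p / m * t)) p t] with x h1 h2 h3
  rw [h1]
  by_cases hxs : x ∈ s
  · rw [Set.indicator_of_mem hxs, h2, h3, norm_mul, norm_mul, norm_coherent hħ hσ₀,
      norm_coherent hħ hσ₀, neg_add_cancel, sub_zero]
    have hσ : 0 < normSq (sigmaAt m σ₀ t) := by
      rw [normSq_pos]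
      intro h
      have := sigmaAt_re m σ₀ t
      rw [h] at this
      simp at this
      linarith
    have key : Real.exp (-((x - (q + p / m * t)) ^ 2 / (4 * ħ * normSq (sigmaAt m σ₀ t))))
        ≤ Real.exp (-((q + p / m * t) ^ 2 / (4 * ħ * normSq (sigmaAt m σ₀ t))))
          * Real.exp (-(x ^ 2 / (4 * ħ * normSq (sigmaAt m σ₀ t)))) := by
      rw [← Real.exp_add, Real.exp_le_exp, ← neg_add, neg_le_neg_iff, ← add_div]
      gcongr
      nlinarith [hx x hxs]
    calc _ ≤ ‖cexp (I / ħ * ((p ^ 2 * t / (2 * m) : ℝ) : ℂ))‖ *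
          (‖1 / ((((2 * Real.pi * ħ) ^ (1 / 4 : ℝ) : ℝ) : ℂ) * sigmaAt m σ₀ t ^ (1 / 2 : ℂ))‖ *
          (Real.exp (-((q + p / m * t) ^ 2 / (4 * ħ * normSq (sigmaAt m σ₀ t))))
          * Real.exp (-(x ^ 2 / (4 * ħ * normSq (sigmaAt m σ₀ t)))))) := by
          gcongr
      _ = _ := by ring
  · rw [Set.indicator_of_notMem hxs, norm_zero]
    positivity

end Packet

/-! ### The transmission amplitude on a wave packet -/

/-- The difference is at most the relative momentum deviation times `1/N`, with `N = |1 + iay|`. If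
`|y| ≥ |y₀|/2`, strong coupling gives `1/N ≤ 2h³`. Otherwise the relative deviation is at least
`1/2`, and `1/N ≤ 1` is absorbed by `64 = 2⁶` times its sixth power; the total power seven is what
yields `h^(7/2)` after averaging. -/
theorem norm_transmission_sub_le {ħ m p h : ℝ} {β : OnePoint ℝ} (hħ : 0 < ħ) (hm : 0 < m)
    (hp : p ≠ 0) (hβ : β ≠ ((0 : ℝ) : OnePoint ℝ)) (hh : 0 ≤ h)
    (hsmall : β.elim 0 (fun b => ħ / (m * |b * p|) ^ (1 / 3 : ℝ)) ≤ h) (k : ℝ) :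
    ‖transmission ħ m β k - transmission ħ m β (p / (2 * Real.pi * ħ))‖
      ≤ 2 * h ^ 3 / |p / ħ| * |2 * Real.pi * k - p / ħ|
        + 64 / |p / ħ| ^ 7 * |2 * Real.pi * k - p / ħ| ^ 7 := by
  have hy0 : 0 < |p / ħ| := abs_pos.2 (div_ne_zero hp hħ.ne')
  induction β using OnePoint.rec with
  | infty =>
    simp only [transmission, OnePoint.elim_infty, sub_self, norm_zero]
    positivity
  | coe b =>
    have hb : b ≠ 0 := fun h => hβ (by rw [h])
    have hmb : 0 < m * |b * p| := mul_pos hm (abs_pos.2 (mul_ne_zero hb hp))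
    change ħ / (m * |b * p|) ^ (1 / 3 : ℝ) ≤ h at hsmall
    set a := m * b / ħ ^ 2 with ha
    have ha0 : 0 < |a| := abs_pos.2 (by positivity)
    set y := 2 * Real.pi * k with hy
    set y₀ := p / ħ with hy₀
    have hε : 1 / (|a| * |y₀|) ≤ h ^ 3 := by
      have e : (ħ / (m * |b * p|) ^ (1 / 3 : ℝ)) ^ 3 = 1 / (|a| * |y₀|) := by
        rw [div_pow, ← Real.rpow_natCast ((m * |b * p|) ^ (1 / 3 : ℝ)) 3, ← Real.rpow_mul hmb.le,
          ← abs_mul]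
        have e3 : (1 / 3 : ℝ) * ((3 : ℕ) : ℝ) = 1 := by norm_num
        have : a * y₀ = m * (b * p) / ħ ^ 3 := by
          rw [ha, hy₀]; field_simp
        rw [e3, Real.rpow_one, this, abs_div, abs_mul m, abs_of_pos hm,
          abs_of_pos (by positivity : 0 < ħ ^ 3), one_div_div]
      rw [← e]
      exact pow_le_pow_left₀ (by positivity) hsmall 3
    have e0 : 2 * Real.pi * (p / (2 * Real.pi * ħ)) = y₀ := by
      rw [hy₀]
      have := Real.pi_pos
      field_simp
    change ‖1 / (1 + ((a * y : ℝ) : ℂ) * I)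
      - 1 / (1 + ((a * (2 * Real.pi * (p / (2 * Real.pi * ħ))) : ℝ) : ℂ) * I)‖ ≤ _
    rw [e0, div_sub_div _ _ (one_add_mul_I_ne_zero _) (one_add_mul_I_ne_zero _), norm_div, norm_mul]
    have enum : (1 * (1 + ((a * y₀ : ℝ) : ℂ) * I) - (1 + ((a * y : ℝ) : ℂ) * I) * 1)
        = ((a * (y₀ - y) : ℝ) : ℂ) * I := by push_cast; ring
    rw [enum, norm_mul, norm_I, mul_one, norm_real, Real.norm_eq_abs, abs_mul, abs_sub_comm]
    have n0 := abs_le_norm_one_add_mul_I (a * y₀)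
    have n1 := one_le_norm_one_add_mul_I (a * y)
    have n2 := abs_le_norm_one_add_mul_I (a * y)
    rw [abs_mul] at n0 n2
    set N := ‖1 + ((a * y : ℝ) : ℂ) * I‖
    have hN : 0 < N := by linarith
    have step : |a| * |y - y₀| / (N * ‖1 + ((a * y₀ : ℝ) : ℂ) * I‖)
        ≤ |y - y₀| / |y₀| * (1 / N) := by
      calc |a| * |y - y₀| / (N * ‖1 + ((a * y₀ : ℝ) : ℂ) * I‖)
          ≤ |a| * |y - y₀| / (N * (|a| * |y₀|)) := by gcongr
        _ = |y - y₀| / |y₀| * (1 / N) := by field_simp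
    have hinv : 1 / N ≤ 2 * h ^ 3 + 64 * (|y - y₀| / |y₀|) ^ 6 := by
      rcases le_total (|y₀| / 2) |y| with hc | hc
      · have : 1 / N ≤ 2 * (1 / (|a| * |y₀|)) := by
          have h3 : |a| * |y₀| / 2 ≤ N := le_trans (by nlinarith) n2
          calc 1 / N ≤ 1 / (|a| * |y₀| / 2) := one_div_le_one_div_of_le (by positivity) h3
            _ = 2 * (1 / (|a| * |y₀|)) := by field_simp
        have h4 : 0 ≤ 64 * (|y - y₀| / |y₀|) ^ 6 := by positivity
        linarith
      · have h5 : 1 / 2 ≤ |y - y₀| / |y₀| := by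
          rw [le_div_iff₀ hy0]
          have := abs_sub_abs_le_abs_sub y₀ y
          rw [abs_sub_comm] at this
          linarith
        have h6 : (1 / 2 : ℝ) ^ 6 ≤ (|y - y₀| / |y₀|) ^ 6 := pow_le_pow_left₀ (by norm_num) h5 6
        have h7 : 1 / N ≤ 1 := by rw [div_le_one hN]; exact n1
        have h8 : 0 ≤ h ^ 3 := by positivity
        norm_num at h6
        linarith
    refine step.trans ((mul_le_mul_of_nonneg_left hinv (by positivity)).trans (le_of_eq ?_))
    field_simp

theorem norm_le_of_ae_le_mul_add_mul {f g h : L2} {a b : ℝ} (ha : 0 ≤ a) (hb : 0 ≤ b)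
    (hf : ∀ᵐ x, ‖f x‖ ≤ a * ‖g x‖ + b * ‖h x‖) : ‖f‖ ≤ a * ‖g‖ + b * ‖h‖ := by
  have hg := (Lp.memLp g).norm
  have hh := (Lp.memLp h).norm
  have eg : ‖hg.toLp _‖ = ‖g‖ := by rw [Lp.norm_toLp, eLpNorm_norm, Lp.norm_def]
  have eh : ‖hh.toLp _‖ = ‖h‖ := by rw [Lp.norm_toLp, eLpNorm_norm, Lp.norm_def]
  calc ‖f‖ ≤ ‖a • hg.toLp _ + b • hh.toLp _‖ := by
        apply Lp.norm_le_norm_of_ae_le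
        filter_upwards [hf, hg.coeFn_toLp, hh.coeFn_toLp, Lp.coeFn_smul a (hg.toLp _),
          Lp.coeFn_smul b (hh.toLp _), Lp.coeFn_add (a • hg.toLp _) (b • hh.toLp _)]
          with x h1 h2 h3 h4 h5 h6
        rw [h6, Pi.add_apply, h4, h5, Pi.smul_apply, Pi.smul_apply, h2, h3]
        exact h1.trans (le_abs_self _)
    _ ≤ ‖a • hg.toLp _‖ + ‖b • hh.toLp _‖ := norm_add_le _ _
    _ = a * ‖g‖ + b * ‖h‖ := by
        rw [norm_smul, norm_smul, eg, eh, Real.norm_of_nonneg ha, Real.norm_of_nonneg hb]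

/-- The relative momentum width `r` of the packet is at most `√h`, so the two terms of
`norm_transmission_sub_le` contribute `h³ r` and `r⁷` times the first and seventh moments. -/
theorem norm_transmit_packet_sub_le {ħ m σ₀ p h : ℝ} {β : OnePoint ℝ} (hħ : 0 < ħ) (hm : 0 < m)
    (hσ₀ : 0 < σ₀) (hp : p ≠ 0) (hβ : β ≠ ((0 : ℝ) : OnePoint ℝ)) (hh : 0 ≤ h)
    (hsmall : β.elim 0 (fun b => ħ / (m * |b * p|) ^ (1 / 3 : ℝ)) ≤ h)
    (hmom : ħ / (σ₀ ^ 2 * p ^ 2) ≤ h) (q t : ℝ) :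
    ‖transmit ħ m β (packet hħ hσ₀ m q p t)
      - transmission ħ m β (p / (2 * Real.pi * ħ)) • packet hħ hσ₀ m q p t‖
      ≤ (2 * momentConst 1 + 64 * momentConst 7) * (h ^ 3 * Real.sqrt h) := by
  have hy0 : 0 < |p / ħ| := abs_pos.2 (div_ne_zero hp hħ.ne')
  have M1 := memLp_shift_pow_mul_packetFourier hħ hσ₀ m q p t 1
  have M7 := memLp_shift_pow_mul_packetFourier hħ hσ₀ m q p t 7
  set G := packet hħ hσ₀ m q p t
  set T₀ := transmission ħ m β (p / (2 * Real.pi * ħ))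
  have n1 : ‖M1.toLp _‖ = momentConst 1 / (Real.sqrt ħ * σ₀) ^ 1 :=
    norm_shift_pow_mul_packetFourier hħ hσ₀ m q p t 1
  have n7 : ‖M7.toLp _‖ = momentConst 7 / (Real.sqrt ħ * σ₀) ^ 7 :=
    norm_shift_pow_mul_packetFourier hħ hσ₀ m q p t 7
  have hs0 : 0 < Real.sqrt ħ * σ₀ := mul_pos (Real.sqrt_pos.2 hħ) hσ₀
  -- The square of the left side is `ħ/(σ₀²p²)`.
  have hr : 1 / (|p / ħ| * (Real.sqrt ħ * σ₀)) ≤ Real.sqrt h := by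
    refine Real.le_sqrt_of_sq_le (le_trans (le_of_eq ?_) hmom)
    rw [div_pow, mul_pow, mul_pow, sq_abs, Real.sq_sqrt hħ.le]
    field_simp
  set r := 1 / (|p / ħ| * (Real.sqrt ħ * σ₀)) with hrdef
  have hr0 : 0 < r := by positivity
  have hb : ‖transmit ħ m β G - T₀ • G‖
      ≤ 2 * h ^ 3 / |p / ħ| * ‖M1.toLp _‖ + 64 / |p / ħ| ^ 7 * ‖M7.toLp _‖ := by
    have hbound := norm_transmission_sub_le hħ hm hp hβ hh hsmall
    refine norm_le_of_ae_le_mul_add_mul (by positivity) (by positivity) ?_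
    filter_upwards [M1.coeFn_toLp, M7.coeFn_toLp, coeFn_packet hħ hσ₀ m q p t,
      coeFn_mulCLM (isMultiplier_transmission ħ m β) G, Lp.coeFn_smul T₀ G, Lp.coeFn_sub (transmit ħ m β G) (T₀ • G)]
      with k h1 h7 hG hT hS hD
    rw [hD, Pi.sub_apply, transmit, hT, hS, Pi.smul_apply, smul_eq_mul, ← sub_mul, norm_mul, h1, h7, hG,
      norm_mul, norm_mul, norm_pow, norm_pow, norm_real, Real.norm_eq_abs, pow_one, ← mul_assoc,
      ← mul_assoc, ← add_mul]
    exact mul_le_mul_of_nonneg_right (hbound k) (norm_nonneg _)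
  refine hb.trans ?_
  rw [n1, n7]
  have e1 : 2 * h ^ 3 / |p / ħ| * (momentConst 1 / (Real.sqrt ħ * σ₀) ^ 1)
      = 2 * momentConst 1 * (h ^ 3 * r) := by
    rw [hrdef]; field_simp
  have e7 : 64 / |p / ħ| ^ 7 * (momentConst 7 / (Real.sqrt ħ * σ₀) ^ 7)
      = 64 * momentConst 7 * r ^ 7 := by
    rw [hrdef]; field_simp
  rw [e1, e7]
  have hr7 : r ^ 7 ≤ h ^ 3 * Real.sqrt h := by
    calc r ^ 7 ≤ Real.sqrt h ^ 7 := pow_le_pow_left₀ hr0.le hr 7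
      _ = (Real.sqrt h ^ 2) ^ 3 * Real.sqrt h := by ring
      _ = h ^ 3 * Real.sqrt h := by rw [Real.sq_sqrt hh]
  have hr1 : h ^ 3 * r ≤ h ^ 3 * Real.sqrt h := mul_le_mul_of_nonneg_left hr (by positivity)
  have := momentConst_nonneg 1
  have := momentConst_nonneg 7
  rw [add_mul]
  exact add_le_add (mul_le_mul_of_nonneg_left hr1 (by positivity))
    (mul_le_mul_of_nonneg_left hr7 (by positivity))

/-! ### Comparison of the scattering solution with the free packet and its reflection -/

section Scatter

variable {ħ m δ : ℝ} {β : OnePoint ℝ} {g : L2} {T : ℂ}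

/-- The deviation from the free wave is exactly `parity D - D`, where `D` is the left part of `(1 -
T) G - E` and `E` is the error of freezing `T`. Thus only the tail of `G` on the left enters. -/
theorem norm_scatter_sub_le_of_incoming (hT : ‖1 - T‖ ≤ 2) (hδ : ‖transmit ħ m β g - T • g‖ ≤ δ) :
    ‖scatter ħ m β g - fourierInvL2 g‖ ≤ 4 * ‖cutNeg (fourierInvL2 g)‖ + 2 * δ := by
  set G := fourierInvL2 g with hG
  set E := fourierInvL2 (transmit ħ m β g - T • g) with hE
  have hEδ : ‖E‖ ≤ δ := by rw [hE, LinearIsometryEquiv.norm_map]; exact hδ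
  have hF : fourierInvL2 (transmit ħ m β g) = T • G + E := by
    rw [hE, hG, _root_.map_sub, LinearIsometryEquiv.map_smul]
    abel
  set D := cutNeg ((1 - T) • G - E) with hD
  have e : scatter ħ m β g - G = parity D - D := by
    rw [scatter_apply, _root_.map_sub, ← hG, hF, cutPos_parity]
    nth_rw 5 [← cutPos_add_cutNeg G]
    have e1 : G - (T • G + E) = (1 - T) • G - E := by module
    rw [e1, ← hD]
    have e2 : cutNeg (T • G + E) = cutNeg G - D := by
      rw [hD, ← _root_.map_sub]
      congr 1
      module
    rw [e2]
    abel
  have hDn : ‖D‖ ≤ 2 * ‖cutNeg G‖ + δ := by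
    rw [hD, _root_.map_sub, _root_.map_smul]
    refine (norm_sub_le _ _).trans (add_le_add ?_ ((norm_cut_le _ _).trans hEδ))
    rw [norm_smul]
    gcongr
  rw [e]
  refine (norm_sub_le _ _).trans ?_
  rw [LinearIsometry.norm_map]
  linarith

/-- With `T` frozen, the left part of `G` is transmitted with weight `T` and reflected to the right
with weight `1 - T`, exactly as in the target; the discrepancy involves only the right part of `G`
and the freezing error. -/
theorem norm_scatter_sub_le_of_outgoing (hT : ‖1 - T‖ ≤ 2) (hδ : ‖transmit ħ m β g - T • g‖ ≤ δ) :
    ‖scatter ħ m β g - (fourierInvL2 g - (1 - T) • (fourierInvL2 g - parity (fourierInvL2 g)))‖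
      ≤ 4 * ‖cutPos (fourierInvL2 g)‖ + 2 * δ := by
  set G := fourierInvL2 g with hG
  set E := fourierInvL2 (transmit ħ m β g - T • g) with hE
  have hEδ : ‖E‖ ≤ δ := by rw [hE, LinearIsometryEquiv.norm_map]; exact hδ
  have hF : fourierInvL2 (transmit ħ m β g) = T • G + E := by
    rw [hE, hG, _root_.map_sub, LinearIsometryEquiv.map_smul]
    abel
  have e : scatter ħ m β g - (G - (1 - T) • (G - parity G))
      = (1 - T) • (cutPos G - parity (cutPos G)) - parity (cutNeg E) + cutNeg E := by
    have hP : parity G = parity (cutPos G) + parity (cutNeg G) := by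
      rw [← _root_.map_add, cutPos_add_cutNeg]
    have e1 : G - (T • G + E) = (1 - T) • G - E := by module
    rw [hP, scatter_apply, _root_.map_sub, ← hG, hF, cutPos_parity, e1, _root_.map_sub,
      _root_.map_smul, _root_.map_sub, _root_.map_add, LinearIsometry.map_smul, _root_.map_smul]
    have hd : G = cutPos G + cutNeg G := (cutPos_add_cutNeg G).symm
    generalize cutPos G = a at *
    generalize cutNeg G = b at *
    rw [hd]
    module
  rw [e]
  have h1 : ‖(1 - T) • (cutPos G - parity (cutPos G))‖ ≤ 4 * ‖cutPos G‖ := by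
    rw [norm_smul]
    have := norm_sub_le (cutPos G) (parity (cutPos G))
    rw [LinearIsometry.norm_map] at this
    calc ‖1 - T‖ * ‖cutPos G - parity (cutPos G)‖ ≤ 2 * (‖cutPos G‖ + ‖cutPos G‖) := by gcongr
      _ = _ := by ring
  have h2 : ‖cutNeg E‖ ≤ δ := (norm_cut_le _ _).trans hEδ
  have h3 := norm_add_le ((1 - T) • (cutPos G - parity (cutPos G)) - parity (cutNeg E)) (cutNeg E)
  have h4 := norm_sub_le ((1 - T) • (cutPos G - parity (cutPos G))) (parity (cutNeg E))
  rw [LinearIsometry.norm_map] at h4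
  linarith

end Scatter

/-! ### Gaussian tails away from the collision time -/

/-- The bound is chosen so that `N h |log h| ≤ 1/16` for `N ≤ 7/2`. It follows from `log x ≤ x - 1`
at `x = h^(-1/2)`, once `√h ≤ 1/112`. -/
theorem mul_abs_log_le {h : ℝ} (h0 : 0 < h) (h1 : h < 1 / 20000) :
    h * |Real.log h| ≤ 1 / 56 := by
  have hs : 0 < Real.sqrt h := Real.sqrt_pos.2 h0
  have hl : Real.log h < 0 := Real.log_neg h0 (by linarith)
  have h2 := Real.log_le_sub_one_of_pos (inv_pos.2 hs)
  rw [Real.log_inv, Real.log_sqrt h0.le] at h2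
  have h3 : |Real.log h| ≤ 2 * (Real.sqrt h)⁻¹ := by
    rw [abs_of_neg hl]; linarith
  have h4 : Real.sqrt h ≤ 1 / 112 := by
    rw [Real.sqrt_le_left (by norm_num)]
    norm_num
    linarith
  calc h * |Real.log h| ≤ h * (2 * (Real.sqrt h)⁻¹) := by gcongr
    _ = 2 * Real.sqrt h := by
        nth_rw 1 [← Real.mul_self_sqrt h0.le]
        field_simp
    _ ≤ 1 / 56 := by linarith

/-- Smallness of the Gaussian tail beyond the origin of a packet centred at `q + (p/m) t`. -/
theorem exp_neg_div_le_rpow {ħ m σ₀ q p t h N : ℝ} (hħ : 0 < ħ) (hm : 0 < m) (hσ₀ : 0 < σ₀)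
    (hq : q ≠ 0) (hp : p ≠ 0) (h0 : 0 < h) (h1 : h < 1 / 20000) (hN0 : 0 ≤ N) (hN : N ≤ 7 / 2)
    (hpos : ħ * σ₀ ^ 2 / q ^ 2 ≤ h) (hmom : ħ / (σ₀ ^ 2 * p ^ 2) ≤ h)
    (hd : 16 * q ^ 2 * (N * h * |Real.log h|) ≤ (q + p / m * t) ^ 2) :
    Real.exp (-((q + p / m * t) ^ 2 / (4 * ħ * normSq (sigmaAt m σ₀ t)))) ≤ h ^ N := by
  have hlog := mul_abs_log_le h0 h1
  have hl : Real.log h < 0 := Real.log_neg h0 (by linarith)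
  rw [Real.rpow_def_of_pos h0, Real.exp_le_exp]
  have hσ : normSq (sigmaAt m σ₀ t) = σ₀ ^ 2 + (t / (2 * m * σ₀)) ^ 2 := by
    rw [normSq_apply, sigmaAt_re, sigmaAt_im]; ring
  have hσpos : 0 < normSq (sigmaAt m σ₀ t) := by rw [hσ]; positivity
  have hq2 : 0 < q ^ 2 := by positivity
  have hp2 : 0 < σ₀ ^ 2 * p ^ 2 := by positivity
  rw [div_le_iff₀ hq2] at hpos
  set d := q + p / m * t with hdd
  -- The spreading of the packet is measured by the distance travelled, `pt/m = d - q`, so both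
  -- terms of the width are controlled by `h`, uniformly in time.
  have hE : ħ * normSq (sigmaAt m σ₀ t) ≤ h * (3 / 2 * q ^ 2 + 1 / 2 * d ^ 2) := by
    have e : ħ * normSq (sigmaAt m σ₀ t)
        = ħ * σ₀ ^ 2 + ħ / (σ₀ ^ 2 * p ^ 2) * ((d - q) ^ 2 / 4) := by
      rw [hσ, hdd]; field_simp; ring
    have h3 : ħ / (σ₀ ^ 2 * p ^ 2) * ((d - q) ^ 2 / 4) ≤ h * ((d - q) ^ 2 / 4) := by gcongr
    have h4 : (d - q) ^ 2 / 4 ≤ 1 / 2 * q ^ 2 + 1 / 2 * d ^ 2 := by nlinarith [sq_nonneg (d + q)]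
    have h5 := mul_le_mul_of_nonneg_left h4 h0.le
    rw [e]
    linarith
  set w := N * h * |Real.log h| with hw
  have hw0 : 0 ≤ w := by positivity
  have hw1 : w ≤ 1 / 16 := by
    have : w = N * (h * |Real.log h|) := by rw [hw]; ring
    rw [this]
    calc N * (h * |Real.log h|) ≤ 7 / 2 * (1 / 56) := by gcongr
      _ = 1 / 16 := by norm_num
  -- The hypothesis `hd` bounds `6 q² w` by `3d²/8`, and `w ≤ 1/16` bounds `2 w d²` by `d²/8`;
  -- together they stay below `d²`.
  have key : N * |Real.log h| ≤ d ^ 2 / (4 * ħ * normSq (sigmaAt m σ₀ t)) := by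
    rw [le_div_iff₀ (by positivity)]
    calc N * |Real.log h| * (4 * ħ * normSq (sigmaAt m σ₀ t))
        = 4 * (N * |Real.log h|) * (ħ * normSq (sigmaAt m σ₀ t)) := by ring
      _ ≤ 4 * (N * |Real.log h|) * (h * (3 / 2 * q ^ 2 + 1 / 2 * d ^ 2)) := by gcongr
      _ = 6 * (q ^ 2 * w) + 2 * (w * d ^ 2) := by rw [hw]; ring
      _ ≤ d ^ 2 := by nlinarith [mul_le_mul_of_nonneg_right hw1 (sq_nonneg d)]
  rw [abs_of_neg hl] at key
  linarith

/-- Multiplying by the speed `|p/m|` turns the time from the collision into the distance of the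
centre from the origin, and the collision time into `|q|`; the constant `4` becomes `16` on
squaring. -/
theorem sq_le_of_le_abs_sub_collisionTime {m q p t w : ℝ} (hm : 0 < m) (hp : p ≠ 0) (hw : 0 ≤ w)
    (h : 4 * |collisionTime m (q, p)| * Real.sqrt w ≤ |t - collisionTime m (q, p)|) :
    16 * q ^ 2 * w ≤ (q + p / m * t) ^ 2 := by
  have hpm : 0 ≤ |p / m| := abs_nonneg _
  have h1 := mul_le_mul_of_nonneg_right h hpm
  have e1 : |t - collisionTime m (q, p)| * |p / m| = |q + p / m * t| := by
    rw [← abs_mul, collisionTime]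
    congr 1
    field_simp
    ring
  have e2 : 4 * |collisionTime m (q, p)| * Real.sqrt w * |p / m| = 4 * |q| * Real.sqrt w := by
    have : |collisionTime m (q, p)| * |p / m| = |q| := by
      rw [← abs_mul, collisionTime, ← abs_neg q]
      congr 1
      field_simp
    rw [← this]; ring
  rw [e1, e2] at h1
  have h2 := pow_le_pow_left₀ (by positivity) h1 2
  rw [mul_pow, mul_pow, sq_abs, sq_abs, Real.sq_sqrt hw] at h2
  linarith

/-! ### The semiclassical approximation as an element of `L²(ℝ)` -/

theorem coherent_neg (ħ σ₀ : ℝ) (σ : ℂ) (ξ : ℝ × ℝ) (x : ℝ) :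
    coherent ħ σ₀ σ (-ξ) x = coherent ħ σ₀ σ ξ (-x) := by
  simp only [coherent, Prod.fst_neg, Prod.snd_neg]
  congr 2
  push_cast
  ring

theorem fourierInvL2_packet_zero {ħ m σ₀ : ℝ} (hħ : 0 < ħ) (hσ₀ : 0 < σ₀) (hm : 0 < m) (q p : ℝ) :
    fourierInvL2 (packet hħ hσ₀ m q p 0) = coherentVec hħ hσ₀ (q, p) := by
  apply Lp.ext
  filter_upwards [coeFn_fourierInvL2_packet hħ hσ₀ hm q p 0,
    (memLp_coherent hħ hσ₀ (q, p)).coeFn_toLp] with x h1 h2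
  rw [coherentVec, h1, h2]
  simp [sigmaAt]

/-- When `pt < 0` one has `sgn(t)|p| = -p`, which removes the sign and the absolute value from the
classical coefficient. With `X = mβp/ħ³` it becomes `1/(1 - i/X)`, which equals `1 - 1/(1 + iX)`. -/
theorem reflectionCoeff_eq {ħ m p t : ℝ} {β : OnePoint ℝ} (hħ : 0 < ħ) (hm : 0 < m)
    (hβ : β ≠ ((0 : ℝ) : OnePoint ℝ)) (hpt : p * t < 0) :
    reflectionCoeff m (β.map fun b => -(2 * b / ħ ^ 3)) t p
      = 1 - transmission ħ m β (p / (2 * Real.pi * ħ)) := by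
  induction β using OnePoint.rec with
  | infty =>
    change (1 : ℂ) = 1 - 0
    rw [sub_zero]
  | coe b =>
    have hb : b ≠ 0 := fun h => hβ (by rw [h])
    have hp : p ≠ 0 := fun h => by simp [h] at hpt
    change 1 / (1 - (Real.sign t : ℂ) * (2 * I * |p| / (m * ((-(2 * b / ħ ^ 3) : ℝ) * p ^ 2))))
      = 1 - 1 / (1 + ((m * b / ħ ^ 2 * (2 * Real.pi * (p / (2 * Real.pi * ħ))) : ℝ) : ℂ) * I)
    set X : ℝ := m * b * p / ħ ^ 3 with hX
    have hX0 : X ≠ 0 := by positivity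
    have e1 : m * b / ħ ^ 2 * (2 * Real.pi * (p / (2 * Real.pi * ħ))) = X := by
      have := Real.pi_pos
      rw [hX]; field_simp
    have e2 : Real.sign t * |p| = -p := by
      rcases lt_or_gt_of_ne hp with h | h
      · have : 0 < t := by nlinarith
        rw [Real.sign_of_pos this, abs_of_neg h, one_mul]
      · have : t < 0 := by nlinarith
        rw [Real.sign_of_neg this, abs_of_pos h]; ring
    have e3 : (Real.sign t : ℂ) * (2 * I * |p| / (m * ((-(2 * b / ħ ^ 3) : ℝ) * p ^ 2)))
        = I / X := by
      have e4 : (Real.sign t : ℂ) * (2 * I * |p| / (m * ((-(2 * b / ħ ^ 3) : ℝ) * p ^ 2)))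
        = ((Real.sign t * |p| : ℝ) : ℂ) * (2 * I / (m * ((-(2 * b / ħ ^ 3) : ℝ) * p ^ 2))) := by
        push_cast; ring
      have : (ħ : ℂ) ≠ 0 := by exact_mod_cast hħ.ne'
      have : (m : ℂ) ≠ 0 := by exact_mod_cast hm.ne'
      have : (b : ℂ) ≠ 0 := by exact_mod_cast hb
      have : (p : ℂ) ≠ 0 := by exact_mod_cast hp
      rw [e4, e2, hX]
      push_cast
      field_simp
    rw [e1, e3]
    have hXc : (X : ℂ) ≠ 0 := by exact_mod_cast hX0
    have h1 := one_add_mul_I_ne_zero X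
    have h2 : (1 - I / X : ℂ) * (X * I) = 1 + X * I := by
      field_simp
      linear_combination (-1 : ℂ) * I_sq
    have h3 : (1 - I / X : ℂ) ≠ 0 := fun h => h1 (by rw [← h2, h, zero_mul])
    rw [one_sub_div h1, div_eq_div_iff h3 h1]
    linear_combination -h2

/-- The semiclassical approximation before the collision. -/
theorem classicalApprox_of_pos {ħ m σ₀ q p t : ℝ} (β : OnePoint ℝ) (hq : 0 < q)
    (hx : 0 < q + p / m * t) (x : ℝ) :
    classicalApprox ħ m σ₀ β t (q, p) x = cexp (I / ħ * ((p ^ 2 * t / (2 * m) : ℝ) : ℂ)) *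
      coherent ħ σ₀ (sigmaAt m σ₀ t) (q + p / m * t, p) x := by
  have h0 : heaviside (-(t * q * p)) * heaviside (|p * t| / m - |q|) = 0 := by
    by_cases h : 0 < -(t * q * p)
    · have hpt : p * t < 0 := by
        by_contra hc
        nlinarith [mul_nonneg hq.le (not_lt.1 hc)]
      have : ¬ 0 < |p * t| / m - |q| := by
        rw [abs_of_neg hpt, abs_of_pos hq]
        have : -(p * t) / m = -(p / m * t) := by ring
        rw [this]
        linarith
      rw [heaviside, heaviside, if_neg this, mul_zero]
    · rw [heaviside, if_neg h, zero_mul]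
  simp only [classicalApprox, classicalGroup, h0, zero_mul, sub_zero, freeFlow]

/-- The semiclassical approximation after the collision. -/
theorem classicalApprox_of_neg {ħ m σ₀ q p t : ℝ} {β : OnePoint ℝ} (hħ : 0 < ħ) (hm : 0 < m)
    (hβ : β ≠ ((0 : ℝ) : OnePoint ℝ)) (hq : 0 < q) (hx : q + p / m * t < 0) (x : ℝ) :
    classicalApprox ħ m σ₀ β t (q, p) x = cexp (I / ħ * ((p ^ 2 * t / (2 * m) : ℝ) : ℂ)) *
      (coherent ħ σ₀ (sigmaAt m σ₀ t) (q + p / m * t, p) x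
        - (1 - transmission ħ m β (p / (2 * Real.pi * ħ))) *
          (coherent ħ σ₀ (sigmaAt m σ₀ t) (q + p / m * t, p) x
            - coherent ħ σ₀ (sigmaAt m σ₀ t) (q + p / m * t, p) (-x))) := by
  have e : p / m * t = p * t / m := by ring
  have hpt : p * t < 0 := by
    by_contra hc
    have : 0 ≤ p * t / m := div_nonneg (not_lt.1 hc) hm.le
    linarith
  have h1 : 0 < -(t * q * p) := by nlinarith
  have h2 : 0 < |p * t| / m - |q| := by
    rw [abs_of_neg hpt, abs_of_pos hq, neg_div]
    linarith
  simp only [classicalApprox, classicalGroup, heaviside, if_pos h1, if_pos h2, one_mul, freeFlow,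
    oddPart, coherent_neg, reflectionCoeff_eq hħ hm hβ hpt]

/-! ### Parity -/

theorem hamiltonian_parity {ħ m : ℝ} {β : OnePoint ℝ} {ψ χ : L2} (h : Hamiltonian ħ m β ψ χ) :
    Hamiltonian ħ m β (parity ψ) (parity χ) := by
  obtain ⟨w, up, um, vp, vm, h1, ⟨h2, h3⟩, rfl⟩ := h
  refine ⟨parity w, um, up, -vm, -vp, h1.comp_parity, ⟨by rw [h2], ?_⟩, LinearIsometry.map_smul _ _ _⟩
  induction β using OnePoint.rec with
  | infty =>
    change vp = 0 at h3
    change -vm = 0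
    rw [← h2, h3, neg_zero]
  | coe b =>
    change up - um = _ * vp at h3
    change um - up = _ * -vm
    rw [← h2]
    linear_combination -h3

theorem hamiltonian_parity_iff {ħ m : ℝ} {β : OnePoint ℝ} {ψ χ : L2} :
    Hamiltonian ħ m β (parity ψ) (parity χ) ↔ Hamiltonian ħ m β ψ χ :=
  ⟨fun h => by simpa only [parity_parity] using hamiltonian_parity h, hamiltonian_parity⟩

/-- The unitary group commutes with the parity operator. -/
theorem unitaryGroup_parity {ħ m : ℝ} {β : OnePoint ℝ} (hħ : 0 < ħ) (hm : 0 < m)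
    {U : ℝ → L2 ≃ₗᵢ[ℂ] L2} (hU : IsUnitaryGroupOf ħ (Hamiltonian ħ m β) U) (t : ℝ) (ψ : L2) :
    U t (parity ψ) = parity (U t ψ) := by
  -- Conjugation by parity preserves the generator, so the uniqueness of the group gives the
  -- commutation.
  have hV : IsUnitaryGroupOf ħ (Hamiltonian ħ m β)
      (fun t => (parityEquiv.trans (U t)).trans parityEquiv) := by
    refine ⟨fun ψ => ?_, fun s t ψ => ?_, fun ψ => ?_, fun ψ χ => ?_⟩
    · change parity (U 0 (parity ψ)) = ψ
      rw [hU.map_zero, parity_parity]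
    · change parity (U (s + t) (parity ψ)) = parity (U s (parity (parity (U t (parity ψ)))))
      rw [hU.map_add, parity_parity]
    · exact parity.continuous.comp (hU.continuous (parity ψ))
    · rw [← hamiltonian_parity_iff, hU.generator]
      have hP : ∀ (f : ℝ → L2) (f' : L2), HasDerivAt f f' 0 →
          HasDerivAt (fun t => parity (f t)) (parity f') 0 := fun f f' hf =>
        ((parity.toContinuousLinearMap).restrictScalars ℝ).hasFDerivAt.comp_hasDerivAt 0 hf
      change _ ↔ HasDerivAt (fun t => parity (U t (parity ψ))) _ 0
      refine ⟨fun h => ?_, fun h => ?_⟩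
      · have := hP _ _ h
        rwa [LinearIsometry.map_smul, parity_parity] at this
      · have := hP _ _ h
        rw [LinearIsometry.map_smul] at this
        simpa only [parity_parity] using this
  have h := congrFun (hU.eq_of_dense hV (dense_domain_hamiltonian hħ hm β)) t
  have h2 : U t (parity ψ) = parity (U t (parity (parity ψ))) := by
    conv_lhs => rw [h]
    rfl
  rw [h2, parity_parity]

theorem parity_coherentVec {ħ σ₀ : ℝ} (hħ : 0 < ħ) (hσ₀ : 0 < σ₀) (ξ : ℝ × ℝ) :
    parity (coherentVec hħ hσ₀ ξ) = coherentVec hħ hσ₀ (-ξ) := by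
  apply Lp.ext
  filter_upwards [coeFn_parity (coherentVec hħ hσ₀ ξ),
    ae_comp_neg (memLp_coherent hħ hσ₀ ξ).coeFn_toLp,
    (memLp_coherent hħ hσ₀ (-ξ)).coeFn_toLp] with x h1 h2 h3
  rw [h1, coherentVec, h2, coherentVec, h3, coherent_neg]

theorem classicalApprox_neg (ħ m σ₀ : ℝ) (β : OnePoint ℝ) (t : ℝ) (ξ : ℝ × ℝ) (x : ℝ) :
    classicalApprox ħ m σ₀ β t (-ξ) x = classicalApprox ħ m σ₀ β t ξ (-x) := by
  have e : ∀ b : OnePoint ℝ, reflectionCoeff m b t (-ξ.2) = reflectionCoeff m b t ξ.2 := fun b => by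
    simp only [reflectionCoeff, abs_neg, ofReal_neg, neg_sq]
  have e2 : (-ξ.1 + -ξ.2 / m * t, -ξ.2) = -(ξ.1 + ξ.2 / m * t, ξ.2) := by
    ext
    · simp only [Prod.fst_neg]; ring
    · rfl
  simp only [classicalApprox, classicalGroup, freeFlow, oddPart, Prod.fst_neg, Prod.snd_neg, neg_sq,
    e, e2, coherent_neg, neg_mul, abs_neg, mul_neg, neg_neg]

theorem smallParam_neg (ħ m σ₀ : ℝ) (β : OnePoint ℝ) (ξ : ℝ × ℝ) :
    smallParam ħ m σ₀ β (-ξ) = smallParam ħ m σ₀ β ξ := by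
  simp only [smallParam, Prod.fst_neg, Prod.snd_neg, neg_sq, mul_neg, abs_neg]

theorem collisionTime_neg (m : ℝ) (ξ : ℝ × ℝ) : collisionTime m (-ξ) = collisionTime m ξ := by
  simp only [collisionTime, Prod.fst_neg, Prod.snd_neg, mul_neg, neg_div_neg_eq]

/-! ### The main estimate -/

/-- The constant in the semiclassical estimate. -/
def errorConst : ℝ := 8 * momentConst 0 + 4 * (2 * momentConst 1 + 64 * momentConst 7)

theorem errorConst_nonneg : 0 ≤ errorConst := by
  have := momentConst_nonneg 0
  have := momentConst_nonneg 1
  have := momentConst_nonneg 7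
  rw [errorConst]
  positivity

/-- The core estimate for `q > 0`. The error splits into a comparison of the coherent state with the
scattering state at time `0` and one of the scattering state with the classical formula at time `t`;
each costs four tails and two freezing errors, which accounts for `errorConst`. -/
theorem exists_norm_unitaryGroup_sub_le {ħ m σ₀ q p t N : ℝ} {β : OnePoint ℝ} (hħ : 0 < ħ)
    (hm : 0 < m) (hσ₀ : 0 < σ₀) (hβ : β ≠ ((0 : ℝ) : OnePoint ℝ)) {U : ℝ → L2 ≃ₗᵢ[ℂ] L2}
    (hU : IsUnitaryGroupOf ħ (Hamiltonian ħ m β) U) (hq : 0 < q) (hp : p ≠ 0)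
    (hN0 : 0 < N) (hN : N ≤ 7 / 2) (hs : smallParam ħ m σ₀ β (q, p) < 1 / 20000)
    (ht : 4 * |collisionTime m (q, p)| * Real.sqrt (N * smallParam ħ m σ₀ β (q, p) *
      |Real.log (smallParam ħ m σ₀ β (q, p))|) ≤ |t - collisionTime m (q, p)|) :
    ∃ v : L2, v =ᵐ[volume] classicalApprox ħ m σ₀ β t (q, p) ∧
      ‖U t (coherentVec hħ hσ₀ (q, p)) - v‖ ≤ errorConst * smallParam ħ m σ₀ β (q, p) ^ N := by
  have hpos : ħ * σ₀ ^ 2 / q ^ 2 ≤ smallParam ħ m σ₀ β (q, p) :=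
    (le_max_left _ _).trans (le_max_left _ _)
  have hmom : ħ / (σ₀ ^ 2 * p ^ 2) ≤ smallParam ħ m σ₀ β (q, p) :=
    (le_max_right _ _).trans (le_max_left _ _)
  have hsmall : β.elim 0 (fun b => ħ / (m * |b * p|) ^ (1 / 3 : ℝ)) ≤ smallParam ħ m σ₀ β (q, p) :=
    le_max_right _ _
  set h := smallParam ħ m σ₀ β (q, p)
  have h0 : 0 < h := lt_of_lt_of_le (by positivity) hpos
  have hl : 0 < |Real.log h| := abs_pos.2 (Real.log_neg h0 (by linarith)).ne
  have hw0 : 0 < N * h * |Real.log h| := by positivity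
  have hd := sq_le_of_le_abs_sub_collisionTime hm hp hw0.le ht
  -- At time `0` the centre is `q`, so the tail condition reads `16 N h |log h| ≤ 1` and follows
  -- from the smallness of `h`.
  have hd0 : 16 * q ^ 2 * (N * h * |Real.log h|) ≤ (q + p / m * 0) ^ 2 := by
    have h1 := mul_abs_log_le h0 hs
    have h2 : N * (h * |Real.log h|) ≤ 7 / 2 * (1 / 56) := by gcongr
    have h3 := mul_le_mul_of_nonneg_left h2 (sq_nonneg q)
    rw [mul_zero, add_zero]
    linarith
  have hx0 : q + p / m * t ≠ 0 := fun h => by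
    rw [h] at hd
    have : 0 < 16 * q ^ 2 * (N * smallParam ħ m σ₀ β (q, p) *
      |Real.log (smallParam ħ m σ₀ β (q, p))|) := by positivity
    linarith
  have tail := fun t (hd : 16 * q ^ 2 * (N * h * |Real.log h|) ≤ (q + p / m * t) ^ 2) =>
    mul_le_mul_of_nonneg_right
      (exp_neg_div_le_rpow hħ hm hσ₀ hq.ne' hp h0 hs hN0.le hN hpos hmom hd) (momentConst_nonneg 0)
  set T := transmission ħ m β (p / (2 * Real.pi * ħ))
  set δ := (2 * momentConst 1 + 64 * momentConst 7) * (h ^ 3 * Real.sqrt h)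
  have hδ : ∀ t, ‖transmit ħ m β (packet hħ hσ₀ m q p t) - T • packet hħ hσ₀ m q p t‖ ≤ δ :=
    norm_transmit_packet_sub_le hħ hm hσ₀ hp hβ h0.le hsmall hmom q
  have hT : ‖1 - T‖ ≤ 2 := by
    have h1 := norm_sub_le (1 : ℂ) T
    have h2 := norm_transmission_le ħ m β (p / (2 * Real.pi * ħ))
    rw [norm_one] at h1
    linarith
  have hδ' : δ ≤ (2 * momentConst 1 + 64 * momentConst 7) * h ^ N := by
    have := momentConst_nonneg 1
    have := momentConst_nonneg 7
    refine mul_le_mul_of_nonneg_left ?_ (by positivity)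
    rw [Real.sqrt_eq_rpow, ← Real.rpow_natCast, ← Real.rpow_add h0]
    exact Real.rpow_le_rpow_of_exponent_ge h0 (by linarith) (by push_cast; linarith)
  have hstart := norm_scatter_sub_le_of_incoming hT (hδ 0)
  have hneg : ∀ t, 0 ≤ q + p / m * t → ‖cutNeg (fourierInvL2 (packet hħ hσ₀ m q p t))‖ ≤ _ :=
    fun t hx => norm_cut_packet_le hħ hσ₀ hm q p t measurableSet_Iio fun x hx' =>
      mul_nonpos_of_nonpos_of_nonneg (le_of_lt hx') hx
  have hτ0 := (hneg 0 (by rw [mul_zero, add_zero]; exact hq.le)).trans (tail 0 hd0)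
  rw [fourierInvL2_packet_zero hħ hσ₀ hm] at hstart hτ0
  -- Unitarity carries the initial error to time `t` unchanged, and the scattering state evolves
  -- exactly; only the comparison at time `t` is left.
  have reduce : ∀ v : L2, ‖scatter ħ m β (packet hħ hσ₀ m q p t) - v‖
      ≤ 4 * (h ^ N * momentConst 0) + 2 * δ →
      ‖U t (coherentVec hħ hσ₀ (q, p)) - v‖ ≤ errorConst * h ^ N := fun v hv => by
    rw [← unitaryGroup_scatter_packet hħ hσ₀ hU] at hv
    have h1 := norm_sub_le_norm_sub_add_norm_sub (U t (coherentVec hħ hσ₀ (q, p)))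
      (U t (scatter ħ m β (packet hħ hσ₀ m q p 0))) v
    rw [← _root_.map_sub, LinearIsometryEquiv.norm_map,
      norm_sub_rev (coherentVec hħ hσ₀ (q, p))] at h1
    rw [errorConst]
    linarith
  rcases lt_or_gt_of_ne hx0 with hx | hx
  · have hτ := (norm_cut_packet_le hħ hσ₀ hm q p t measurableSet_Ioi fun x hx' =>
      mul_nonpos_of_nonneg_of_nonpos (le_of_lt hx') hx.le).trans (tail t hd)
    have hend := norm_scatter_sub_le_of_outgoing hT (hδ t)
    refine ⟨_, ?_, reduce _ (hend.trans (by rw [cutPos]; linarith))⟩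
    set G := fourierInvL2 (packet hħ hσ₀ m q p t) with hG
    have hc := coeFn_fourierInvL2_packet hħ hσ₀ hm q p t
    rw [← hG] at hc
    filter_upwards [Lp.coeFn_sub G ((1 - T) • (G - parity G)), Lp.coeFn_smul (1 - T) (G - parity G),
      Lp.coeFn_sub G (parity G), coeFn_parity G, hc, ae_comp_neg hc] with x e1 e2 e3 e4 e5 e6
    rw [e1, Pi.sub_apply, e2, Pi.smul_apply, e3, Pi.sub_apply, e4, e5, e6, smul_eq_mul,
      classicalApprox_of_neg hħ hm hβ hq hx]
    ring
  · have hend := norm_scatter_sub_le_of_incoming hT (hδ t)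
    have hτ := (hneg t hx.le).trans (tail t hd)
    refine ⟨_, ?_, reduce _ (hend.trans (by linarith))⟩
    filter_upwards [coeFn_fourierInvL2_packet hħ hσ₀ hm q p t] with x hx'
    rw [hx', classicalApprox_of_pos β hq hx]

theorem eLpNorm_unitaryGroup_sub_le {ħ m σ₀ q p t N : ℝ} {β : OnePoint ℝ} (hħ : 0 < ħ)
    (hm : 0 < m) (hσ₀ : 0 < σ₀) (hβ : β ≠ ((0 : ℝ) : OnePoint ℝ)) {U : ℝ → L2 ≃ₗᵢ[ℂ] L2}
    (hU : IsUnitaryGroupOf ħ (Hamiltonian ħ m β) U) (hqp : q * p ≠ 0)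
    (hN0 : 0 < N) (hN : N ≤ 7 / 2) (hs : smallParam ħ m σ₀ β (q, p) < 1 / 20000)
    (ht : 4 * |collisionTime m (q, p)| * Real.sqrt (N * smallParam ħ m σ₀ β (q, p) *
      |Real.log (smallParam ħ m σ₀ β (q, p))|) ≤ |t - collisionTime m (q, p)|) :
    eLpNorm (fun x : ℝ => (U t (coherentVec hħ hσ₀ (q, p)) : ℝ → ℂ) x
        - classicalApprox ħ m σ₀ β t (q, p) x) 2 volume
      ≤ ENNReal.ofReal (errorConst * smallParam ħ m σ₀ β (q, p) ^ N) := by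
  obtain ⟨v, hv, hle⟩ : ∃ v : L2, v =ᵐ[volume] classicalApprox ħ m σ₀ β t (q, p) ∧
      ‖U t (coherentVec hħ hσ₀ (q, p)) - v‖ ≤ errorConst * smallParam ħ m σ₀ β (q, p) ^ N := by
    -- For `q < 0`, reflect: the group, the coherent states and the classical formula all commute
    -- with parity, while the small parameter and the collision time are even in `(q, p)`.
    rcases lt_or_gt_of_ne (left_ne_zero_of_mul hqp) with hq | hq
    · have e : (q, p) = -(-q, -p) := by simp
      rw [e, smallParam_neg, collisionTime_neg] at ht
      rw [e, smallParam_neg] at hs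
      obtain ⟨v, hv, hle⟩ := exists_norm_unitaryGroup_sub_le hħ hm hσ₀ hβ hU (neg_pos.2 hq)
        (neg_ne_zero.2 (right_ne_zero_of_mul hqp)) hN0 hN hs ht
      refine ⟨parity v, ?_, ?_⟩
      · filter_upwards [coeFn_parity v, ae_comp_neg hv] with x h1 h2
        rw [h1, h2, e, classicalApprox_neg]
      · rw [e, smallParam_neg, ← parity_coherentVec, unitaryGroup_parity hħ hm hU, ← _root_.map_sub,
          LinearIsometry.norm_map]
        exact hle
    · exact exists_norm_unitaryGroup_sub_le hħ hm hσ₀ hβ hU hq (right_ne_zero_of_mul hqp) hN0 hN hs ht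
  have e : eLpNorm (fun x : ℝ => (U t (coherentVec hħ hσ₀ (q, p)) : ℝ → ℂ) x
      - classicalApprox ħ m σ₀ β t (q, p) x) 2 volume
      = eLpNorm (U t (coherentVec hħ hσ₀ (q, p)) - v : L2) 2 volume := by
    refine eLpNorm_congr_ae ?_
    filter_upwards [hv, Lp.coeFn_sub (U t (coherentVec hħ hσ₀ (q, p))) v] with x h1 h2
    rw [h2, Pi.sub_apply, h1]
  rw [e, ← Lp.enorm_def, ← ofReal_norm]
  exact ENNReal.ofReal_le_ofReal hle

end DeltaPrime

end

open DeltaPrime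
theorem corollary1p2 :
    (∀ (ħ m : ℝ) (β : OnePoint ℝ), 0 < ħ → 0 < m → β ≠ ((0 : ℝ) : OnePoint ℝ) →
      ∃! U : ℝ → L2 ≃ₗᵢ[ℂ] L2, IsUnitaryGroupOf ħ (Hamiltonian ħ m β) U) ∧
    ∀ lam : ℝ, 0 < lam → lam < 1 / 2 →
      ∃ hs C c₀ : ℝ, 0 < hs ∧ hs < 1 ∧ 0 < C ∧ 0 < c₀ ∧
        ∀ (ħ m σ₀ : ℝ) (hħ : 0 < ħ) (_ : 0 < m) (hσ₀ : 0 < σ₀)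
          (β : OnePoint ℝ) (_ : β ≠ ((0 : ℝ) : OnePoint ℝ))
          (U : ℝ → L2 ≃ₗᵢ[ℂ] L2) (_ : IsUnitaryGroupOf ħ (Hamiltonian ħ m β) U)
          (q p t : ℝ), q * p ≠ 0 →
          smallParam ħ m σ₀ β (q, p) < hs →
          c₀ * |collisionTime m (q, p)| *
              Real.sqrt ((7 / 2 - lam) * smallParam ħ m σ₀ β (q, p) *
                |Real.log (smallParam ħ m σ₀ β (q, p))|)
            ≤ |t - collisionTime m (q, p)| →
          eLpNorm (fun x : ℝ => (U t (coherentVec hħ hσ₀ (q, p)) : ℝ → ℂ) x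
              - classicalApprox ħ m σ₀ β t (q, p) x) 2 volume
            ≤ ENNReal.ofReal (C * smallParam ħ m σ₀ β (q, p) ^ (7 / 2 - lam)) := by
  -- `1/20000` and `4` come from `mul_abs_log_le` and `sq_le_of_le_abs_sub_collisionTime`; adding
  -- `1` to `errorConst` makes the constant strictly positive.
  refine ⟨fun ħ m β hħ hm _ => existsUnique_isUnitaryGroupOf hħ hm β, fun lam hlam hlam' =>
    ⟨1 / 20000, errorConst + 1, 4, by norm_num, by norm_num, ?_, by norm_num, ?_⟩⟩
  · linarith [errorConst_nonneg]
  · intro ħ m σ₀ hħ hm hσ₀ β hβ U hU q p t hqp hs ht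
    refine (eLpNorm_unitaryGroup_sub_le hħ hm hσ₀ hβ hU hqp (by linarith) (by linarith) hs ht).trans
      (ENNReal.ofReal_le_ofReal ?_)
    have h0 : 0 ≤ smallParam ħ m σ₀ β (q, p) :=
      le_trans (by positivity) ((le_max_left _ _).trans (le_max_left _ _))
    have := Real.rpow_nonneg h0 (7 / 2 - lam)
    linarith
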